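/- Let $c>0$ and let $k\ge 0$ be an integer. Let $u_0:\mathbb R\to\mathbb R$ satisfy $\int_{\mathbb R}|u_0(x)|(1+|x|)^{k+1}\,dx<\infty$, put $H_c(x)=0$ for $x\le 0$ and $H_c(x)=-c^2$ for $x>0$, and $u=u_0+H_c$. Setting. Let $\lambda(z)$ be the analytic function on $\mathbb C\setminus[-c,c]$ with $\lambda(z)^2=z^2-c^2$ and $\lambda(z)=z+O(z^{-1})$ at infinity; on $[-c,c]$ we use its boundary values from the upper half-plane, $\lambda(s)=i\sqrt{c^2-s^2}$. Let $\phi^{p}(z;\cdot),\phi^{m}(z;\cdot),\psi^{p}(z;\cdot),\psi^{m}(z;\cdot)$ be the Jost solutions of $-f''-uf=z^2f$, determined by $\phi^{p/m}(z;x)=e^{\pm izx}(1+o(1))$ as $x\to-\infty$ and $\psi^{p/m}(z;x)=e^{\pm i\lambda(z)x}(1+o(1))$ as $x\to+\infty$ (for $z$ real, and for $\phi^m,\psi^p$ also for $\operatorname{Im}z>0$; $\psi^m$ is used only for $z$ real with $|z|>c$). With $W(f,g)=fg'-gf'$ put $$a=\frac{W(\phi^m,\psi^p)}{2iz},\quad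 b=-\frac{W(\phi^p,\psi^p)}{2iz},\quad A=\frac{W(\phi^m,\psi^p)}{2i\lambda(z)},\quad B=\frac{W(\psi^m,\phi^m)}{2i\lambda(z)},$$ so that $\psi^p=a\phi^p+b\phi^m$ and $\phi^m=B\psi^p+A\psi^m$ for real $|z|>c$; let $a^+,A^+$ be the boundary values of $a,A$ on $(-c,c)$ (for $a^+$ also at $\pm c$) from the upper half-plane. The left reflection coefficient is $$R_l(s)=\frac{b(s)}{a(s)}\ (|s|>c),\qquad R_l(s)=\frac{a^+(-s)}{a^+(s)}\ (|s|\le c),$$ where the value at $s=0$ is the limit of the quotient. For constants $\alpha,\beta\in\mathbb C$ put $\ell(s)=\alpha s^2+\beta\sqrt{c^2-s^2}$; the right reflection coefficient is $$R_r(s)=\frac{B(s)}{A(s)}\ (|s|>c),\qquad R_r(s)=\frac{\frac12+\frac{\ell(s)}{s\sqrt{c^2-s^2}}}{a^+(-s)A^+(s)}\ (|s|<c),$$ where the value at $s=0$ is the limit of the second expression and the values at $s=\pm c$ are the limits of $B/A$ from $|s|>c$. Assume that $u_0$ is generic: $W(\phi^m(c;\cdot),\psi^p(c;\cdot))\ne0$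 and $W(\psi(0;\cdot),\phi^p(0;\cdot))\neq0$, where $\psi(0;x)=e^{-cx}(1+o(1))$ as $x\to+\infty$ is the common boundary value of $\psi^{p}$ from above and $\psi^m$ from below at $z=0$. Theorem. (i) There are constants $c_0,\dots,c_k$ and $\tilde c_0,\dots,\tilde c_k$ in $\mathbb C$ with $$R_l(s)=\sum_{j=0}^k c_j\bigl(\sqrt{-s-c}\bigr)^j+o(|s+c|^{k/2}),\quad s\to-c,\ s<-c,$$ $$R_l(s)=\sum_{j=0}^k \tilde c_j\bigl(\sqrt{-s-c}\bigr)_+^j+o(|s+c|^{k/2}),\quad s\to-c,\ s>-c,$$ and $c_j=\tilde c_j$ for $j=0,\dots,k$; here $(\sqrt{-s-c})_+=-i\sqrt{s+c}$ is the boundary value from the upper half-plane of the principal branch of $\sqrt{-z-c}$. Likewise there are such expansions at $c$, with equal coefficients on the two sides, in powers of $\sqrt{s-c}$ for $s>c$ and of $(\sqrt{s-c})_+=i\sqrt{c-s}$ for $s<c$, up to $o(|s-c|^{k/2})$. (ii) $R_l$ is $C^k$ on $\mathbb R\setminus\{c,-c\}$ and $R_l(0)=-1$. (iii) For all $\alpha,\beta\in\mathbb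 C$, $R_r$ is $C^k$ on $\mathbb R\setminus\{c,-c\}$, $R_r(\pm c)=-1$, and $R_r$ restricted to $\{|s|\ge c\}$ is continuous at $\pm c$. Moreover $\frac1{a^+(-s)A^+(s)}=\kappa_1\sqrt{s+c}\,(1+o(1))$ as $s\downarrow -c$ for some $\kappa_1\neq0$, and if $\alpha$ is chosen so that $\kappa_1\alpha\sqrt c/\sqrt2=1$ then, for every $\beta$, $R_r$ is continuous at $\pm c$ from both sides. -/

import Mathlib

open Filter Topology Asymptotics MeasureTheory

noncomputable section

namespace StepKdV

/-- Left-normalised potential: the initial datum `u₀ + H_c` itself, where the step `H_c` is `0` for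
`x ≤ 0` and `-c²` for `x > 0`. It is asymptotically `0` at `-∞`. -/
def potL (c : ℝ) (u₀ : ℝ → ℝ) (x : ℝ) : ℝ := if x ≤ 0 then u₀ x else u₀ x - c ^ 2

/-- Right-normalised potential: the initial datum shifted by `c²`, asymptotically `0` at `+∞`. -/
def potR (c : ℝ) (u₀ : ℝ → ℝ) (x : ℝ) : ℝ := if 0 ≤ x then u₀ x else u₀ x + c ^ 2

/-- `f` solves `-f'' - q f = E f` on the whole line in the Carathéodory sense (`q` is only locally
integrable): `f` is differentiable, and `f'` is the indefinite integral of `-(q + E) f`. -/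
def SolvesSchrodinger (q : ℝ → ℝ) (E : ℂ) (f : ℝ → ℂ) : Prop :=
  Differentiable ℝ f ∧
    ∀ x y : ℝ, deriv f y - deriv f x = ∫ t in x..y, -((q t : ℂ) + E) * f t

/-- `f` is a Jost solution for the potential `q`: it solves `-f'' - q f = κ² f`, and
`f(x) = exp(iκx) (1 + o(1))` along the filter `l`, which is `atBot` or `atTop`. -/
def IsJost (q : ℝ → ℝ) (κ : ℂ) (l : Filter ℝ) (f : ℝ → ℂ) : Prop :=
  SolvesSchrodinger q (κ ^ 2) f ∧
    Tendsto (fun x : ℝ => f x * Complex.exp (-(Complex.I * κ * x))) l (𝓝 1)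

/-- The Jost solution. It exists and is unique when `(1 + |x|) q(x)` is integrable near the end `l`,
`q` is locally integrable, and `0 ≤ Im κ` (for `l = atTop`) or `Im κ ≤ 0` (for `l = atBot`);
it is used only for such `κ`. -/
def jost (q : ℝ → ℝ) (κ : ℂ) (l : Filter ℝ) : ℝ → ℂ := Classical.epsilon (IsJost q κ l)

/-- The function `λ(z)` with `λ² = z² - c²`, analytic off `[-c, c]`, and `λ(z) = z + O(1/z)`
at infinity. With the principal square root, its values on the cut `[-c, c]` are the boundary values
from the upper half-plane, `λ(s) = i √(c² - s²)`. -/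
def lam (c : ℝ) (z : ℂ) : ℂ := (z - c) ^ (1 / 2 : ℂ) * (z + c) ^ (1 / 2 : ℂ)

/-- `φᵖ(z; x) = exp(izx) (1 + o(1))` as `x → -∞`. -/
def phiP (c : ℝ) (u₀ : ℝ → ℝ) (z : ℂ) : ℝ → ℂ := jost (potL c u₀) z atBot

/-- `φᵐ(z; x) = exp(-izx) (1 + o(1))` as `x → -∞`. -/
def phiM (c : ℝ) (u₀ : ℝ → ℝ) (z : ℂ) : ℝ → ℂ := jost (potL c u₀) (-z) atBot

/-- `ψᵖ(z; x) = exp(iλ(z)x) (1 + o(1))` as `x → +∞`. For `z` in `[-c, c]` this is the common boundary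
value of `ψᵖ` from the upper and of `ψᵐ` from the lower half-plane. -/
def psiP (c : ℝ) (u₀ : ℝ → ℝ) (z : ℂ) : ℝ → ℂ := jost (potR c u₀) (lam c z) atTop

/-- `ψᵐ(z; x) = exp(-iλ(z)x) (1 + o(1))` as `x → +∞`; used only for real `z` with `|z| > c`. -/
def psiM (c : ℝ) (u₀ : ℝ → ℝ) (z : ℂ) : ℝ → ℂ := jost (potR c u₀) (-lam c z) atTop

/-- The Wronskian `f g' - f' g`, evaluated at `x = 0` (it does not depend on `x` for two solutions of
the same equation). -/
def wronskian (f g : ℝ → ℂ) : ℂ := f 0 * deriv g 0 - deriv f 0 * g 0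

/-- The coefficient `a` in `ψᵖ = a φᵖ + b φᵐ`, for `|z| > c` real; also its analytic extension to
the upper half-plane. -/
def coefa (c : ℝ) (u₀ : ℝ → ℝ) (z : ℂ) : ℂ :=
  wronskian (phiM c u₀ z) (psiP c u₀ z) / (2 * Complex.I * z)

/-- The coefficient `b` in `ψᵖ = a φᵖ + b φᵐ`, for `|z| > c` real. -/
def coefb (c : ℝ) (u₀ : ℝ → ℝ) (z : ℂ) : ℂ :=
  -wronskian (phiP c u₀ z) (psiP c u₀ z) / (2 * Complex.I * z)

/-- The coefficient `A` in `φᵐ = B ψᵖ + A ψᵐ`, for `|z| > c` real; also its analytic extension to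
the upper half-plane. -/
def coefA (c : ℝ) (u₀ : ℝ → ℝ) (z : ℂ) : ℂ :=
  wronskian (phiM c u₀ z) (psiP c u₀ z) / (2 * Complex.I * lam c z)

/-- The coefficient `B` in `φᵐ = B ψᵖ + A ψᵐ`, for `|z| > c` real. -/
def coefB (c : ℝ) (u₀ : ℝ → ℝ) (z : ℂ) : ℂ :=
  wronskian (psiM c u₀ z) (phiM c u₀ z) / (2 * Complex.I * lam c z)

/-- Boundary value at the real point `s`, from the upper half-plane. -/
def bdryPlus (f : ℂ → ℂ) (s : ℝ) : ℂ := limUnder (𝓝[{z : ℂ | 0 < z.im}] (s : ℂ)) f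

/-- `a⁺` -/
def aPlus (c : ℝ) (u₀ : ℝ → ℝ) (s : ℝ) : ℂ := bdryPlus (coefa c u₀) s

/-- `A⁺` -/
def APlus (c : ℝ) (u₀ : ℝ → ℝ) (s : ℝ) : ℂ := bdryPlus (coefA c u₀) s

/-- Genericity of the perturbation: `W(φᵐ(c), ψᵖ(c)) ≠ 0` and `W(ψᵐ(0), φᵖ(0)) ≠ 0`, where
`ψᵐ(0) = ψᵖ(0)` is the boundary value on the cut, that is, the solution asymptotic to `exp(-cx)`. -/
def IsGeneric (c : ℝ) (u₀ : ℝ → ℝ) : Prop :=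
  wronskian (phiM c u₀ (c : ℂ)) (psiP c u₀ (c : ℂ)) ≠ 0 ∧
    wronskian (psiP c u₀ 0) (phiP c u₀ 0) ≠ 0

/-- The left reflection coefficient: `b / a` for `|s| > c`, and `a⁺(-s) / a⁺(s)` for `|s| ≤ c`. As `a⁺`
has a pole at `0`, the value at `s = 0` is the limit of this quotient. -/
def Rl (c : ℝ) (u₀ : ℝ → ℝ) (s : ℝ) : ℂ :=
  if c < |s| then coefb c u₀ s / coefa c u₀ s
  else if s = 0 then limUnder (𝓝[≠] (0 : ℝ)) (fun t : ℝ => aPlus c u₀ (-t) / aPlus c u₀ t)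
  else aPlus c u₀ (-s) / aPlus c u₀ s

/-- The expression that defines the right reflection coefficient for `0 < |s| < c`, with the even
function `ℓ(s) = α s² + β √(c² - s²)`. -/
def RrInner (c : ℝ) (u₀ : ℝ → ℝ) (α β : ℂ) (s : ℝ) : ℂ :=
  (1 / 2 + (α * (s : ℂ) ^ 2 + β * (Real.sqrt (c ^ 2 - s ^ 2) : ℂ)) /
      ((s : ℂ) * (Real.sqrt (c ^ 2 - s ^ 2) : ℂ))) /
    (aPlus c u₀ (-s) * APlus c u₀ s)

/-- The right reflection coefficient: `B / A` for `|s| > c`, its limit from `|s| > c` at `s = ± c`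
(both `A` and `B` have the denominator `λ(s)`, which vanishes there), and `RrInner` for `|s| < c`,
with its limit as the value at `s = 0`. -/
def Rr (c : ℝ) (u₀ : ℝ → ℝ) (α β : ℂ) (s : ℝ) : ℂ :=
  if c < |s| then coefB c u₀ s / coefA c u₀ s
  else if |s| = c then
    limUnder (𝓝[{t : ℝ | c < |t|}] s) (fun t : ℝ => coefB c u₀ t / coefA c u₀ t)
  else if s = 0 then limUnder (𝓝[≠] (0 : ℝ)) (RrInner c u₀ α β)
  else RrInner c u₀ α β s

end StepKdV

end

open StepKdV

/-!
The argument reduces both reflection coefficients to Cauchy data at the origin of Jost solutions, and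
obtains the regularity of these data in the spectral parameter `κ` on the closed upper half-plane.

Write a Jost solution at `+∞` as `f = exp (iκx) m`. Its amplitude `m` solves the Volterra equation
`m(x) = 1 - ∫_x^∞ D_κ(t - x) q(t) m(t) dt` with `D_κ(r) = ∫₀ʳ exp (2iκs) ds`. After conjugation by a
suitable weight, constant near `+∞` and growing fast towards `-∞`, the integral operator `K_κ` is a
contraction of the bounded continuous functions on the whole line, uniformly in `Im κ ≥ 0`
(`IsJostPotential.exists_integral_majorant_lt_one`). The `j`-th derivative of `D_κ(r)` in `κ` is
bounded by `2^j r^(j+1)`, so `k + 1` moments of `q` make `κ ↦ K_κ` a `C^k` map in operator norm, in the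
sense of complex derivatives within the closed half-plane (`contDiffOn_kernelOp`), and
`(1 - K_κ)⁻¹` inherits this. So do the Cauchy data at `0` (`IsJostPotential.contDiffOn_jost`).
Jost solutions are unique by a Wronskian argument (`IsAmplitude.eq_of_isJost`), and those at `-∞` are
reflections of those at `+∞`.

Let `w(s) = W(φᵐ, ψᵖ)` and `v(s) = W(φᵖ, ψᵖ)`. As `φᵐ(-s) = φᵖ(s)`, and `λ(-s) = λ(s)` on the cut, the
two definitions of `R_l` merge into `R_l = -v / w` on the whole real line (`Rl_eq`). The denominator
has no real zeros: for `s ≠ 0` because of the Wronskians of the Jost solutions with their complex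
conjugates, and for `s = 0` by genericity (`jostW_ne_zero`). Away from `± c`, `λ` is smooth, and so
are `w` and `v` up to order `k`. Near `c`, with `μ = √(s - c)` taken from the upper half-plane,
`s = c + μ²` and `λ = μ √(2c + μ²)`; since the data of `ψᵖ` have a Taylor expansion at `κ = 0` within
the half-plane, `w`, `v` and `R_l` have expansions in powers of `μ`, valid on both sides at once
(`hasExpansion_Rl`). The symmetry `R_l(-s) = conj R_l(s)` gives the expansion at `-c`.

The right coefficient is `W(ψᵐ, φᵐ) / w` for `|s| ≥ c`, where it tends to `-1` at
`± c` because `ψᵐ` and `ψᵖ` coincide there (`outerR`), and for `|s| < c` it is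
`4i (s √(c² - s²) / 2 + ℓ(s)) / (w(s) w(-s))` (`innerR`), which at `± c` equals
`4i α c² / (w(c) w(-c))`. The condition on `α` says that this is `-1`.
-/

noncomputable section

namespace StepKdV

open scoped ComplexConjugate BoundedContinuousFunction

/-! ### Symbols and integral operators depending on a parameter -/

/-- The closed upper half-plane, in which the spectral parameter of a Jost solution at `+∞` lives. -/
def uhp : Set ℂ := {z | 0 ≤ z.im}

lemma convex_uhp : Convex ℝ uhp := convex_halfSpace_im_ge 0

lemma uniqueDiffOn_uhp : UniqueDiffOn ℂ uhp := by
  intro z hz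
  refine UniqueDiffWithinAt.mono_field (𝕜 := ℝ) ?_
  refine uniqueDiffOn_convex convex_uhp ⟨Complex.I, ?_⟩ z hz
  refine mem_interior.2 ⟨{z | 0 < z.im}, fun z (hz : 0 < z.im) => (le_of_lt hz : 0 ≤ z.im),
    isOpen_lt continuous_const Complex.continuous_im, by simp⟩

/-- The `j`-th derivative in `κ` of the oscillating exponential `exp (2iκr)`. -/
def expSymbol (j : ℕ) (κ : ℂ) (r : ℝ) : ℂ :=
  (2 * Complex.I * r) ^ j * Complex.exp (2 * Complex.I * κ * r)

/-- The `j`-th derivative in `κ` of `∫₀ʳ exp (2iκs) ds`, the kernel of the Volterra equation. -/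
def volterraSymbol (j : ℕ) (κ : ℂ) (r : ℝ) : ℂ := ∫ s in (0 : ℝ)..r, expSymbol j κ s

lemma continuous_expSymbol (j : ℕ) (κ : ℂ) : Continuous (expSymbol j κ) := by
  unfold expSymbol; fun_prop

lemma norm_exp_le_one {κ : ℂ} (hκ : κ ∈ uhp) {r : ℝ} (hr : 0 ≤ r) :
    ‖Complex.exp (2 * Complex.I * κ * r)‖ ≤ 1 := by
  rw [Complex.norm_exp]
  have : (2 * Complex.I * κ * r).re = -(2 * κ.im * r) := by simp
  rw [this, Real.exp_le_one_iff]
  have : 0 ≤ κ.im := hκ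
  have := mul_nonneg this hr
  linarith

lemma norm_expSymbol_le {κ : ℂ} (hκ : κ ∈ uhp) {r : ℝ} (hr : 0 ≤ r) (j : ℕ) :
    ‖expSymbol j κ r‖ ≤ (2 * r) ^ j := by
  unfold expSymbol
  rw [norm_mul, norm_pow]
  have h : ‖2 * Complex.I * (r : ℂ)‖ = 2 * r := by simp [abs_of_nonneg hr]
  rw [h]
  exact mul_le_of_le_one_right (by positivity) (norm_exp_le_one hκ hr)

lemma hasDerivAt_expSymbol (j : ℕ) (κ : ℂ) (r : ℝ) :
    HasDerivAt (fun κ => expSymbol j κ r) (expSymbol (j + 1) κ r) κ := by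
  unfold expSymbol
  have h : HasDerivAt (fun κ : ℂ => 2 * Complex.I * κ * r) (2 * Complex.I * r) κ := by
    simpa using ((hasDerivAt_id κ).const_mul (2 * Complex.I)).mul_const (r : ℂ)
  exact (h.cexp.const_mul ((2 * Complex.I * (r : ℂ)) ^ j)).congr_deriv (by ring)

lemma norm_expSymbol_sub_le {κ κ' : ℂ} (hκ : κ ∈ uhp) (hκ' : κ' ∈ uhp) {r : ℝ} (hr : 0 ≤ r)
    (j : ℕ) : ‖expSymbol j κ' r - expSymbol j κ r‖ ≤ (2 * r) ^ (j + 1) * ‖κ' - κ‖ :=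
  convex_uhp.norm_image_sub_le_of_norm_hasDerivWithin_le
    (fun z _ => (hasDerivAt_expSymbol j z r).hasDerivWithinAt)
    (fun _ hz => norm_expSymbol_le hz hr (j + 1)) hκ hκ'

/-- A `C¹` function on a convex set whose derivative stays within `C` of its value at `x`. -/
lemma norm_sub_sub_le_of_hasDerivAt {f f' : ℂ → ℂ} {s : Set ℂ} (hs : Convex ℝ s)
    (hf : ∀ z ∈ s, HasDerivAt f (f' z) z) {x y : ℂ} {C : ℝ} (hx : x ∈ s) (hy : y ∈ s)
    (hC : ∀ z ∈ segment ℝ x y, ‖f' z - f' x‖ ≤ C) :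
    ‖f y - f x - (y - x) * f' x‖ ≤ C * ‖y - x‖ := by
  have hsub : segment ℝ x y ⊆ s := hs.segment_subset hx hy
  have := (convex_segment x y).norm_image_sub_le_of_norm_hasDerivWithin_le
    (f := fun z => f z - (z - x) * f' x) (f' := fun z => f' z - f' x) (C := C) (x := x) (y := y)
    (fun z hz => by
      have h1 := ((hasDerivAt_id z).sub_const x).mul_const (f' x)
      exact ((((hf z (hsub hz)).sub h1).congr_deriv (by simp)).hasDerivWithinAt))
    (fun z hz => hC z hz) (left_mem_segment ℝ x y) (right_mem_segment ℝ x y)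
  have e : f y - f x - (y - x) * f' x = f y - (y - x) * f' x - (f x - (x - x) * f' x) := by ring
  rw [e]
  exact this

lemma norm_expSymbol_taylor_le {κ κ' : ℂ} (hκ : κ ∈ uhp) (hκ' : κ' ∈ uhp) {r : ℝ} (hr : 0 ≤ r)
    (j : ℕ) :
    ‖expSymbol j κ' r - expSymbol j κ r - (κ' - κ) * expSymbol (j + 1) κ r‖
      ≤ (2 * r) ^ (j + 2) * ‖κ' - κ‖ * ‖κ' - κ‖ := by
  refine norm_sub_sub_le_of_hasDerivAt convex_uhp
    (fun z _ => hasDerivAt_expSymbol j z r) hκ hκ' fun z hz => ?_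
  refine (norm_expSymbol_sub_le hκ (convex_uhp.segment_subset hκ hκ' hz) hr (j + 1)).trans ?_
  gcongr
  rw [segment_eq_image'] at hz
  obtain ⟨θ, ⟨h0, h1⟩, rfl⟩ := hz
  simp only [add_sub_cancel_left, norm_smul, Real.norm_of_nonneg h0]
  exact mul_le_of_le_one_left (norm_nonneg _) h1

/-- A family of kernels `E j κ r`, the `j`-th derivatives in `κ` of `E 0 κ r`, with the bounds of
`exp (2iκr)` up to a power `r ^ p`. Both symbols below are of this type, with `p = 0` and
`p = 1`. -/
structure IsSymbol (p : ℕ) (E : ℕ → ℂ → ℝ → ℂ) : Prop where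
  cont : ∀ j κ, Continuous (E j κ)
  bound : ∀ j, ∀ κ ∈ uhp, ∀ r, 0 ≤ r → ‖E j κ r‖ ≤ 2 ^ j * r ^ (j + p)
  lip : ∀ j, ∀ κ ∈ uhp, ∀ κ' ∈ uhp, ∀ r, 0 ≤ r →
    ‖E j κ' r - E j κ r‖ ≤ 2 ^ (j + 1) * r ^ (j + 1 + p) * ‖κ' - κ‖
  taylor : ∀ j, ∀ κ ∈ uhp, ∀ κ' ∈ uhp, ∀ r, 0 ≤ r →
    ‖E j κ' r - E j κ r - (κ' - κ) * E (j + 1) κ r‖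
      ≤ 2 ^ (j + 2) * r ^ (j + 2 + p) * ‖κ' - κ‖ * ‖κ' - κ‖

lemma isSymbol_exp : IsSymbol 0 expSymbol where
  cont := continuous_expSymbol
  bound j κ hκ r hr := by simpa [mul_pow] using norm_expSymbol_le hκ hr j
  lip j κ hκ κ' hκ' r hr := by simpa [mul_pow] using norm_expSymbol_sub_le hκ hκ' hr j
  taylor j κ hκ κ' hκ' r hr := by simpa [mul_pow] using norm_expSymbol_taylor_le hκ hκ' hr j

lemma norm_integral_zero_le {f : ℝ → ℂ} {r C : ℝ} (hr : 0 ≤ r) {n : ℕ} (hC : 0 ≤ C)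
    (h : ∀ s, 0 ≤ s → ‖f s‖ ≤ C * s ^ n) : ‖∫ s in (0 : ℝ)..r, f s‖ ≤ C * r ^ (n + 1) := by
  refine (intervalIntegral.norm_integral_le_of_norm_le_const (C := C * r ^ n) ?_).trans ?_
  · intro s hs
    rw [Set.uIoc_of_le hr] at hs
    refine (h s hs.1.le).trans ?_
    have := hs.1.le
    gcongr
    exact hs.2
  · rw [sub_zero, abs_of_nonneg hr, pow_succ, mul_assoc]

lemma isSymbol_volterra : IsSymbol 1 volterraSymbol where
  cont j κ := intervalIntegral.continuous_primitive
    (fun _ _ => (continuous_expSymbol j κ).intervalIntegrable _ _) 0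
  bound j κ hκ r hr :=
    norm_integral_zero_le hr (by positivity) fun s hs => isSymbol_exp.bound j κ hκ s hs
  lip j κ hκ κ' hκ' r hr := by
    have i (j : ℕ) (κ : ℂ) := (continuous_expSymbol j κ).intervalIntegrable (μ := volume) 0 r
    unfold volterraSymbol
    rw [← intervalIntegral.integral_sub (i _ _) (i _ _)]
    have := norm_integral_zero_le (f := fun s => expSymbol j κ' s - expSymbol j κ s) hr
      (C := 2 ^ (j + 1) * ‖κ' - κ‖) (n := j + 1) (by positivity) fun s hs =>
        (isSymbol_exp.lip j κ hκ κ' hκ' s hs).trans (le_of_eq (by ring))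
    exact this.trans (le_of_eq (by ring))
  taylor j κ hκ κ' hκ' r hr := by
    have i (j : ℕ) (κ : ℂ) := (continuous_expSymbol j κ).intervalIntegrable (μ := volume) 0 r
    unfold volterraSymbol
    rw [← intervalIntegral.integral_const_mul, ← intervalIntegral.integral_sub (i _ _) (i _ _),
      ← intervalIntegral.integral_sub ((i _ _).sub (i _ _)) ((i _ _).const_mul _)]
    have := norm_integral_zero_le (f := fun s => expSymbol j κ' s - expSymbol j κ s
        - (κ' - κ) * expSymbol (j + 1) κ s) hr
      (C := 2 ^ (j + 2) * ‖κ' - κ‖ * ‖κ' - κ‖) (n := j + 2) (by positivity) fun s hs =>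
        (isSymbol_exp.taylor j κ hκ κ' hκ' s hs).trans (le_of_eq (by ring))
    exact this.trans (le_of_eq (by ring))


/-- `k x t` is the kernel of an integral operator on bounded continuous functions: continuous in
`x`, measurable in `t`, and dominated by the integrable function `b t`. -/
structure IsKernel (k : ℝ → ℝ → ℂ) (b : ℝ → ℝ) : Prop where
  cont : ∀ t, Continuous fun x => k x t
  meas : ∀ x, AEStronglyMeasurable (k x) volume
  bound : ∀ x t, ‖k x t‖ ≤ b t
  integrable : Integrable b

namespace IsKernel

variable {k : ℝ → ℝ → ℂ} {b : ℝ → ℝ}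

lemma integrable_apply (h : IsKernel k b) (x : ℝ) : Integrable (k x) :=
  h.integrable.mono' (h.meas x) (.of_forall (h.bound x))

lemma integrable_mul (h : IsKernel k b) (g : ℝ →ᵇ ℂ) (x : ℝ) :
    Integrable fun t => k x t * g t :=
  (h.integrable_apply x).mul_bdd (c := ‖g‖) g.continuous.aestronglyMeasurable
    (.of_forall g.norm_coe_le_norm)

lemma norm_integral_le (h : IsKernel k b) (g : ℝ →ᵇ ℂ) (x : ℝ) :
    ‖∫ t, k x t * g t‖ ≤ (∫ t, b t) * ‖g‖ := by
  rw [← integral_mul_const]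
  refine norm_integral_le_of_norm_le (h.integrable.mul_const _) (.of_forall fun t => ?_)
  rw [norm_mul]
  have := (norm_nonneg _).trans (h.bound x t)
  gcongr
  · exact h.bound x t
  · exact g.norm_coe_le_norm t

lemma integral_bound_nonneg (h : IsKernel k b) : 0 ≤ ∫ t, b t :=
  integral_nonneg fun t => (norm_nonneg _).trans (h.bound 0 t)

lemma continuous_integral (h : IsKernel k b) (g : ℝ →ᵇ ℂ) :
    Continuous fun x => ∫ t, k x t * g t := by
  refine continuous_of_dominated (bound := fun t => b t * ‖g‖)
    (fun x => (h.integrable_mul g x).aestronglyMeasurable) (fun x => .of_forall fun t => ?_)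
    (h.integrable.mul_const _) (.of_forall fun t => (h.cont t).mul_const _)
  rw [norm_mul]
  have := (norm_nonneg _).trans (h.bound x t)
  gcongr
  · exact h.bound x t
  · exact g.norm_coe_le_norm t

lemma exists_op (h : IsKernel k b) :
    ∃ T : (ℝ →ᵇ ℂ) →L[ℂ] (ℝ →ᵇ ℂ), ∀ g x, T g x = ∫ t, k x t * g t := by
  refine ⟨LinearMap.mkContinuous
    { toFun := fun g => BoundedContinuousFunction.ofNormedAddCommGroup
        (fun x => ∫ t, k x t * g t) (h.continuous_integral g) _ (h.norm_integral_le g)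
      map_add' := fun g g' => ?_
      map_smul' := fun a g => ?_ } (∫ t, b t) fun g => ?_, fun g x => rfl⟩
  · ext x
    simp only [BoundedContinuousFunction.coe_ofNormedAddCommGroup,
      BoundedContinuousFunction.coe_add, Pi.add_apply, mul_add]
    exact integral_add (h.integrable_mul g x) (h.integrable_mul g' x)
  · ext x
    simp only [BoundedContinuousFunction.coe_ofNormedAddCommGroup,
      BoundedContinuousFunction.coe_smul, smul_eq_mul, RingHom.id_apply, ← integral_const_mul]
    congr 1 with t
    ring
  · exact BoundedContinuousFunction.norm_ofNormedAddCommGroup_le _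
      (mul_nonneg h.integral_bound_nonneg (norm_nonneg _)) (h.norm_integral_le g)

end IsKernel

open Classical in
/-- The integral operator with kernel `k`; it is `0` if `k` does not define one. -/
def kernelOp (k : ℝ → ℝ → ℂ) : (ℝ →ᵇ ℂ) →L[ℂ] (ℝ →ᵇ ℂ) :=
  if h : ∃ T : (ℝ →ᵇ ℂ) →L[ℂ] (ℝ →ᵇ ℂ), ∀ g x, T g x = ∫ t, k x t * g t then h.choose else 0

lemma IsKernel.kernelOp_apply {k : ℝ → ℝ → ℂ} {b : ℝ → ℝ} (h : IsKernel k b) (g : ℝ →ᵇ ℂ)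
    (x : ℝ) : kernelOp k g x = ∫ t, k x t * g t := by
  have h' := h.exists_op
  rw [kernelOp, dif_pos h']
  exact h'.choose_spec g x

lemma IsKernel.norm_kernelOp_le {k : ℝ → ℝ → ℂ} {b : ℝ → ℝ} (h : IsKernel k b) :
    ‖kernelOp k‖ ≤ ∫ t, b t := by
  refine ContinuousLinearMap.opNorm_le_bound _ h.integral_bound_nonneg fun g => ?_
  refine (BoundedContinuousFunction.norm_le
    (mul_nonneg h.integral_bound_nonneg (norm_nonneg _))).2 fun x => ?_
  rw [h.kernelOp_apply]
  exact h.norm_integral_le g x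

lemma IsKernel.sub {k k' : ℝ → ℝ → ℂ} {b b' β : ℝ → ℝ} (h : IsKernel k b) (h' : IsKernel k' b')
    (hβ : ∀ x t, ‖k x t - k' x t‖ ≤ β t) (hβi : Integrable β) :
    IsKernel (fun x t => k x t - k' x t) β :=
  ⟨fun t => (h.cont t).sub (h'.cont t), fun x => (h.meas x).sub (h'.meas x), hβ, hβi⟩

lemma IsKernel.kernelOp_sub {k k' : ℝ → ℝ → ℂ} {b b' : ℝ → ℝ} (h : IsKernel k b)
    (h' : IsKernel k' b') :
    kernelOp (fun x t => k x t - k' x t) = kernelOp k - kernelOp k' := by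
  ext g x
  have h'' : IsKernel (fun x t => k x t - k' x t) (fun t => b t + b' t) := h.sub h'
    (fun x t => (norm_sub_le _ _).trans (add_le_add (h.bound x t) (h'.bound x t)))
    (h.integrable.add h'.integrable)
  simp only [h''.kernelOp_apply, sub_apply, BoundedContinuousFunction.coe_sub,
    Pi.sub_apply, h.kernelOp_apply, h'.kernelOp_apply, sub_mul]
  exact integral_sub (h.integrable_mul g x) (h'.integrable_mul g x)

lemma IsKernel.const_mul {k : ℝ → ℝ → ℂ} {b : ℝ → ℝ} (h : IsKernel k b) (a : ℂ) :
    IsKernel (fun x t => a * k x t) (fun t => ‖a‖ * b t) :=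
  ⟨fun t => continuous_const.mul (h.cont t), fun x => (h.meas x).const_mul a,
    fun x t => by rw [norm_mul]; exact mul_le_mul_of_nonneg_left (h.bound x t) (norm_nonneg _),
    h.integrable.const_mul _⟩

lemma IsKernel.kernelOp_const_mul {k : ℝ → ℝ → ℂ} {b : ℝ → ℝ} (h : IsKernel k b) (a : ℂ) :
    kernelOp (fun x t => a * k x t) = a • kernelOp k := by
  ext g x
  simp only [(h.const_mul a).kernelOp_apply, smul_apply,
    BoundedContinuousFunction.coe_smul, h.kernelOp_apply, smul_eq_mul, mul_assoc,
    integral_const_mul]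

/-- A function is `C^n` as soon as it starts a chain of `n` successive derivatives, the last of
which is continuous. -/
lemma contDiffOn_of_chain {F : Type*} [NormedAddCommGroup F] [NormedSpace ℂ F] {s : Set ℂ}
    (hs : UniqueDiffOn ℂ s) (n : ℕ) :
    ∀ f : ℕ → ℂ → F,
      (∀ j < n, ∀ z ∈ s, HasDerivWithinAt (𝕜 := ℂ) (f j) (f (j + 1) z) s z) →
      ContinuousOn (f n) s → ContDiffOn ℂ n (f 0) s := by
  induction n with
  | zero => intro f _ hc; exact contDiffOn_zero.2 hc
  | succ n ih =>
    intro f hd hc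
    have h1 := ih (fun j => f (j + 1)) (fun j hj => hd (j + 1) (by omega)) hc
    have : ((n + 1 : ℕ) : WithTop ℕ∞) = (n : WithTop ℕ∞) + 1 := by norm_cast
    rw [this, contDiffOn_succ_iff_derivWithin hs]
    refine ⟨fun z hz => (hd 0 (by omega) z hz).differentiableWithinAt, by simp, ?_⟩
    exact h1.congr fun z hz => (hd 0 (by omega) z hz).derivWithin (hs z hz)

/-- The dominated convergence that drives the differentiation of integral operators. -/
lemma tendsto_integral_min {b B : ℝ → ℝ} (hb : Integrable b)
    (hB : AEStronglyMeasurable B volume) (hb0 : ∀ t, 0 ≤ b t) (hB0 : ∀ t, 0 ≤ B t)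
    {κ : ℂ} {s : Set ℂ} :
    Tendsto (fun κ' : ℂ => ∫ t, min (2 * b t) (B t * ‖κ' - κ‖)) (𝓝[s] κ) (𝓝 0) := by
  have : Tendsto (fun κ' : ℂ => ∫ t, min (2 * b t) (B t * ‖κ' - κ‖)) (𝓝[s] κ)
      (𝓝 (∫ _ : ℝ, (0 : ℝ))) := by
    refine tendsto_integral_filter_of_dominated_convergence (fun t => 2 * b t)
      (.of_forall fun κ' => (hb.const_mul 2).aestronglyMeasurable.inf (hB.mul_const _))
      (.of_forall fun κ' => .of_forall fun t => ?_) (hb.const_mul 2) (.of_forall fun t => ?_)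
    · have h1 := hb0 t
      have h2 := hB0 t
      rw [Real.norm_of_nonneg (by positivity)]
      exact min_le_left _ _
    · have h1 := hb0 t
      have h : Tendsto (fun κ' : ℂ => B t * ‖κ' - κ‖) (𝓝[s] κ) (𝓝 0) := by
        have : Continuous fun κ' : ℂ => B t * ‖κ' - κ‖ := by fun_prop
        simpa using (this.tendsto κ).mono_left nhdsWithin_le_nhds
      have := (tendsto_const_nhds (x := 2 * b t)).min h
      rwa [min_eq_right (by positivity)] at this
  simpa using this

lemma integrable_min {b B : ℝ → ℝ} (hb : Integrable b)
    (hB : AEStronglyMeasurable B volume) (hb0 : ∀ t, 0 ≤ b t) (hB0 : ∀ t, 0 ≤ B t) (κ κ' : ℂ) :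
    Integrable fun t => min (2 * b t) (B t * ‖κ' - κ‖) := by
  refine (hb.const_mul 2).mono' ((hb.const_mul 2).aestronglyMeasurable.inf (hB.mul_const _))
    (.of_forall fun t => ?_)
  have h1 := hb0 t
  have h2 := hB0 t
  rw [Real.norm_of_nonneg (by positivity)]
  exact min_le_left _ _

/-- A family of integral operators is `C^n` in the parameter, in operator norm, when the kernels
have `n` integrably dominated derivatives; the next derivative need only be finite. -/
theorem contDiffOn_kernelOp {k : ℕ → ℂ → ℝ → ℝ → ℂ} {b B : ℕ → ℝ → ℝ} {n : ℕ} {s : Set ℂ}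
    (hs : UniqueDiffOn ℂ s)
    (hk : ∀ j ≤ n, ∀ κ ∈ s, IsKernel (k j κ) (b j))
    (hB : ∀ j, AEStronglyMeasurable (B j) volume) (hB0 : ∀ j t, 0 ≤ B j t)
    (hlip : ∀ j ≤ n, ∀ κ ∈ s, ∀ κ' ∈ s, ∀ x t,
      ‖k j κ' x t - k j κ x t‖ ≤ B j t * ‖κ' - κ‖)
    (htaylor : ∀ j < n, ∀ κ ∈ s, ∀ κ' ∈ s, ∀ x t,
      ‖k j κ' x t - k j κ x t - (κ' - κ) * k (j + 1) κ x t‖ ≤ B (j + 1) t * ‖κ' - κ‖ * ‖κ' - κ‖)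
    (htaylor' : ∀ j < n, ∀ κ ∈ s, ∀ κ' ∈ s, ∀ x t,
      ‖k j κ' x t - k j κ x t - (κ' - κ) * k (j + 1) κ x t‖ ≤ 2 * b (j + 1) t * ‖κ' - κ‖) :
    ContDiffOn ℂ n (fun κ => kernelOp (k 0 κ)) s := by
  refine contDiffOn_of_chain hs n (fun j κ => kernelOp (k j κ)) (fun j hj κ hκ => ?_) ?_
  · have hb0 : ∀ t, 0 ≤ b (j + 1) t := fun t =>
      (norm_nonneg _).trans ((hk (j + 1) hj κ hκ).bound 0 t)
    have hbi := (hk (j + 1) hj κ hκ).integrable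
    rw [hasDerivWithinAt_iff_isLittleO, isLittleO_iff]
    intro ε hε
    have h1 := (tendsto_integral_min hbi (hB (j + 1)) hb0 (hB0 (j + 1)) (κ := κ) (s := s)).eventually
      (gt_mem_nhds hε)
    filter_upwards [h1, self_mem_nhdsWithin] with κ' h1 hκ'
    have e1 := (hk j hj.le κ' hκ').sub (hk j hj.le κ hκ) (hlip j hj.le κ hκ κ' hκ')
    have hk1 := hk j hj.le κ hκ
    have hk1' := hk j hj.le κ' hκ'
    have hk2 := hk (j + 1) hj κ hκ
    have hd : IsKernel (fun x t => k j κ' x t - k j κ x t) (fun t => b j t + b j t) :=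
      hk1'.sub hk1
      (fun x t => (norm_sub_le _ _).trans (add_le_add (hk1'.bound x t) (hk1.bound x t)))
      (hk1.integrable.add hk1.integrable)
    have hdd := hd.sub (hk2.const_mul (κ' - κ)) (β := fun t =>
      ‖κ' - κ‖ * min (2 * b (j + 1) t) (B (j + 1) t * ‖κ' - κ‖)) (fun x t => by
        rw [mul_min_of_nonneg _ _ (norm_nonneg _)]
        refine le_min ?_ ?_
        · exact (htaylor' j hj κ hκ κ' hκ' x t).trans (le_of_eq (by ring))
        · exact (htaylor j hj κ hκ κ' hκ' x t).trans (le_of_eq (by ring)))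
      ((integrable_min hbi (hB _) hb0 (hB0 _) κ κ').const_mul _)
    have := hdd.norm_kernelOp_le
    rw [hd.kernelOp_sub (hk2.const_mul _), hk1'.kernelOp_sub hk1, hk2.kernelOp_const_mul,
      integral_const_mul] at this
    refine this.trans ?_
    rw [mul_comm]
    gcongr
  · intro κ hκ
    have hb0 : ∀ t, 0 ≤ b n t := fun t =>
      (norm_nonneg _).trans ((hk n le_rfl κ hκ).bound 0 t)
    have hbi := (hk n le_rfl κ hκ).integrable
    rw [ContinuousWithinAt, tendsto_iff_norm_sub_tendsto_zero]
    refine squeeze_zero' (.of_forall fun _ => norm_nonneg _) ?_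
      (tendsto_integral_min hbi (hB n) hb0 (hB0 n) (κ := κ) (s := s))
    filter_upwards [self_mem_nhdsWithin] with κ' hκ'
    have hk1 := hk n le_rfl κ hκ
    have hk1' := hk n le_rfl κ' hκ'
    rw [← hk1'.kernelOp_sub hk1]
    refine (hk1'.sub hk1 (fun x t => le_min ?_ ?_)
      (integrable_min hbi (hB n) hb0 (hB0 n) κ κ')).norm_kernelOp_le
    · refine (norm_sub_le _ _).trans ?_
      linarith [hk1'.bound x t, hk1.bound x t]
    · exact hlip n le_rfl κ hκ κ' hκ' x t

/-! ### Weights and the Volterra kernels -/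

/-- A family of integral operators built from a symbol is `C^k` in the spectral parameter. -/
theorem contDiffOn_symbolOp {p k : ℕ} {E : ℕ → ℂ → ℝ → ℂ} (hE : IsSymbol p E)
    {r : ℝ → ℝ → ℝ} {a : ℝ → ℝ → ℂ} {M : ℕ → ℝ → ℝ} (hr : ∀ x t, 0 ≤ r x t)
    (hcont : ∀ j κ t, Continuous fun x => E j κ (r x t) * a x t)
    (hrm : ∀ x, Measurable (r x)) (ham : ∀ x, AEStronglyMeasurable (a x) volume)
    (hM : ∀ n, p ≤ n → ∀ x t, r x t ^ n * ‖a x t‖ ≤ M n t)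
    (hMm : ∀ n, AEStronglyMeasurable (M n) volume)
    (hMi : ∀ n, p ≤ n → n ≤ k + p → Integrable (M n)) :
    (∀ j ≤ k, ∀ κ ∈ uhp, IsKernel (fun x t => E j κ (r x t) * a x t)
      (fun t => 2 ^ j * M (j + p) t)) ∧
    ContDiffOn ℂ k (fun κ => kernelOp fun x t => E 0 κ (r x t) * a x t) uhp := by
  have hM0 : ∀ n, p ≤ n → ∀ t, 0 ≤ M n t := fun n hn t =>
    (mul_nonneg (pow_nonneg (hr 0 t) n) (norm_nonneg _)).trans (hM n hn 0 t)
  have key : ∀ n, p ≤ n → ∀ x t (z : ℂ) (C : ℝ), 0 ≤ C → ‖z‖ ≤ C * r x t ^ n →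
      ‖z * a x t‖ ≤ C * M n t := fun n hn x t z C hC hz => by
    rw [norm_mul]
    calc ‖z‖ * ‖a x t‖ ≤ C * r x t ^ n * ‖a x t‖ := by gcongr
      _ = C * (r x t ^ n * ‖a x t‖) := by ring
      _ ≤ C * M n t := by gcongr; exact hM n hn x t
  have hk : ∀ j ≤ k, ∀ κ ∈ uhp, IsKernel (fun x t => E j κ (r x t) * a x t)
      (fun t => 2 ^ j * M (j + p) t) := fun j hj κ hκ =>
    ⟨hcont j κ, fun x => (((hE.cont j κ).measurable.comp (hrm x)).aestronglyMeasurable).mul (ham x),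
      fun x t => key _ (by omega) _ _ _ _ (by positivity) (hE.bound j κ hκ _ (hr x t)),
      (hMi _ (by omega) (by omega)).const_mul _⟩
  refine ⟨hk, contDiffOn_kernelOp (k := fun j κ x t => E j κ (r x t) * a x t)
    (b := fun j t => 2 ^ j * M (j + p) t)
    (B := fun j t => 2 ^ (j + 1) * M (j + 1 + p) t) uniqueDiffOn_uhp hk
    (fun j => (hMm _).const_mul _)
    (fun j t => mul_nonneg (by positivity) (hM0 _ (by omega) t)) ?_ ?_ ?_⟩
  · intro j hj κ hκ κ' hκ' x t
    rw [← sub_mul]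
    have := key (j + 1 + p) (by omega) x t (E j κ' (r x t) - E j κ (r x t))
      (2 ^ (j + 1) * ‖κ' - κ‖) (by positivity)
      ((hE.lip j κ hκ κ' hκ' _ (hr x t)).trans (le_of_eq (by ring)))
    exact this.trans (le_of_eq (by ring))
  · intro j hj κ hκ κ' hκ' x t
    have := key (j + 2 + p) (by omega) x t
      (E j κ' (r x t) - E j κ (r x t) - (κ' - κ) * E (j + 1) κ (r x t))
      (2 ^ (j + 2) * ‖κ' - κ‖ * ‖κ' - κ‖) (by positivity)
      ((hE.taylor j κ hκ κ' hκ' _ (hr x t)).trans (le_of_eq (by ring)))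
    rw [← sub_mul, ← mul_assoc, ← sub_mul]
    exact this.trans (le_of_eq (by ring))
  · intro j hj κ hκ κ' hκ' x t
    have h1 := hE.lip j κ hκ κ' hκ' _ (hr x t)
    have h2 := hE.bound (j + 1) κ hκ _ (hr x t)
    have h3 : ‖E j κ' (r x t) - E j κ (r x t) - (κ' - κ) * E (j + 1) κ (r x t)‖
        ≤ 2 * 2 ^ (j + 1) * ‖κ' - κ‖ * r x t ^ (j + 1 + p) := by
      refine (norm_sub_le _ _).trans ?_
      rw [norm_mul]
      calc _ ≤ 2 ^ (j + 1) * r x t ^ (j + 1 + p) * ‖κ' - κ‖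
          + ‖κ' - κ‖ * (2 ^ (j + 1) * r x t ^ (j + 1 + p)) := by gcongr
        _ = _ := by ring
    have := key (j + 1 + p) (by omega) x t _ _ (by positivity) h3
    rw [← sub_mul, ← mul_assoc, ← sub_mul]
    exact this.trans (le_of_eq (by ring))

/-- The potentials for which the Jost solution at `+∞` has `k` derivatives in the spectral
parameter at the origin: integrable against `(1 + |x|) ^ (k + 1)` on the right. On the left, where
only existence of solutions is at stake, `q` may be the sum of an integrable and a bounded
function. -/
structure IsJostPotential (k : ℕ) (q : ℝ → ℝ) : Prop where
  left : Integrable fun x => q x / (1 + x ^ 2)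
  right : IntegrableOn (fun x => (1 + |x|) ^ (k + 1) * q x) (Set.Ioi 0)

namespace IsJostPotential

variable {k : ℕ} {q : ℝ → ℝ}

lemma aestronglyMeasurable (hq : IsJostPotential k q) : AEStronglyMeasurable q volume := by
  have h : Continuous fun x : ℝ => 1 + x ^ 2 := by fun_prop
  refine (hq.left.aestronglyMeasurable.mul h.aestronglyMeasurable).congr (.of_forall fun x => ?_)
  have : (1 + x ^ 2 : ℝ) ≠ 0 := by positivity
  simp [this]

lemma locallyIntegrable (hq : IsJostPotential k q) : LocallyIntegrable q volume := by
  rw [locallyIntegrable_iff]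
  intro K hK
  have h : Continuous fun x : ℝ => 1 + x ^ 2 := by fun_prop
  refine (hq.left.integrableOn.mul_continuousOn h.continuousOn hK).congr
    (.of_forall fun x => ?_)
  have : (1 + x ^ 2 : ℝ) ≠ 0 := by positivity
  simp [this]

lemma integrableOn_pow (hq : IsJostPotential k q) {n : ℕ} (hn : n ≤ k + 1) (x₀ : ℝ) :
    IntegrableOn (fun x => (1 + |x|) ^ n * |q x|) (Set.Ioi x₀) := by
  have hc (n : ℕ) : Continuous fun x : ℝ => (1 + |x|) ^ n := by fun_prop
  have h1 : IntegrableOn (fun x => (1 + |x|) ^ n * |q x|) (Set.Ioi 0) := by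
    refine hq.right.norm.mono' (((hc n).aestronglyMeasurable.mul
      hq.aestronglyMeasurable.norm).restrict) (.of_forall fun x => ?_)
    simp only [norm_mul, norm_pow, Real.norm_eq_abs, abs_abs]
    rw [abs_of_nonneg (by positivity : 0 ≤ 1 + |x|)]
    gcongr
    linarith [abs_nonneg x]
  have h2 : IntegrableOn (fun x => (1 + |x|) ^ n * |q x|) (Set.uIcc x₀ 0) :=
    IntegrableOn.continuousOn_mul (hc n).continuousOn
      (hq.locallyIntegrable.integrableOn_isCompact isCompact_uIcc).norm isCompact_uIcc
  refine (h1.union h2).mono_set fun x hx => ?_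
  rcases lt_or_ge 0 x with h | h
  · exact Or.inl h
  · exact Or.inr (Set.mem_uIcc_of_le (le_of_lt hx) h)

end IsJostPotential

/-- The integral of an integrable function over `(x, ∞)` tends to `0` as `x → ∞`. -/
lemma tendsto_setIntegral_Ioi_zero {b : ℝ → ℝ} {x₀ : ℝ} (hb : IntegrableOn b (Set.Ioi x₀)) :
    Tendsto (fun x => ∫ t in Set.Ioi x, b t) atTop (𝓝 0) := by
  have := tendsto_integral_filter_of_dominated_convergence (μ := volume.restrict (Set.Ioi x₀))
    (l := (atTop : Filter ℝ)) (F := fun x t => (Set.Ioi x).indicator b t) (f := fun _ => 0)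
    (fun t => ‖b t‖)
    (.of_forall fun x => hb.aestronglyMeasurable.indicator measurableSet_Ioi)
    (.of_forall fun x => .of_forall fun t => norm_indicator_le_norm_self _ _) hb.norm
    (.of_forall fun t => by
      refine tendsto_const_nhds.congr' ?_
      filter_upwards [eventually_ge_atTop t] with x hx
      rw [Set.indicator_of_notMem]
      simpa using hx)
  rw [integral_zero] at this
  refine this.congr' ?_
  filter_upwards [eventually_ge_atTop x₀] with x hx
  rw [integral_indicator measurableSet_Ioi, Measure.restrict_restrict measurableSet_Ioi,
    Set.inter_eq_left.2 (Set.Ioi_subset_Ioi hx)]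

/-- The exponent of the weight: increasing up to `X`, and constant from there on. -/
def weightExponent (X γ x : ℝ) : ℝ := γ * (min x X + 4 / 3 * min x X ^ 3)

/-- The weight that turns the Volterra equation on the whole line into a contraction. It is constant
on `[X, ∞)` and grows towards `-∞`, faster than any solution does. -/
def weight (X γ x : ℝ) : ℝ := Real.exp (-weightExponent X γ x)

lemma weight_pos (X γ x : ℝ) : 0 < weight X γ x := Real.exp_pos _

lemma continuous_weight (X γ : ℝ) : Continuous (weight X γ) := by
  unfold weight weightExponent; fun_prop

/-- The factor `4/3` in the exponent makes the cubic term dominate `t²(t - x)`, for all `x ≤ t`. -/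
lemma weightExponent_sub_ge {X γ x t : ℝ} (hγ : 0 ≤ γ) (hxt : x ≤ t) (ht : t ≤ X) :
    γ * (1 + t ^ 2) * (t - x) ≤ weightExponent X γ t - weightExponent X γ x := by
  unfold weightExponent
  rw [min_eq_left ht, min_eq_left (hxt.trans ht)]
  have : t ^ 2 * (t - x) ≤ 4 / 3 * (t ^ 3 - x ^ 3) := by
    nlinarith [mul_nonneg (sub_nonneg.2 hxt) (sq_nonneg (t + 2 * x))]
  nlinarith [mul_le_mul_of_nonneg_left this hγ]

lemma weightExponent_eq_of_le {X γ t : ℝ} (ht : X ≤ t) :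
    weightExponent X γ t = weightExponent X γ X := by
  unfold weightExponent
  rw [min_eq_right ht, min_self]

lemma weightExponent_mono {X γ : ℝ} (hγ : 0 ≤ γ) : Monotone (weightExponent X γ) := by
  intro x t hxt
  unfold weightExponent
  have h : min x X ≤ min t X := min_le_min_right X hxt
  have h3 : min x X ^ 3 ≤ min t X ^ 3 := by
    exact Odd.pow_le_pow (by decide) |>.2 h
  gcongr

lemma weight_antitone {X γ : ℝ} (hγ : 0 ≤ γ) : Antitone (weight X γ) := fun _ _ h =>
  Real.exp_le_exp.2 (neg_le_neg (weightExponent_mono hγ h))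

lemma weight_zero {X γ : ℝ} (hX : 0 ≤ X) : weight X γ 0 = 1 := by
  simp [weight, weightExponent, hX]

lemma weight_ge {X γ : ℝ} (hγ : 0 ≤ γ) (x : ℝ) : weight X γ X ≤ weight X γ x := by
  rcases le_total x X with h | h
  · exact weight_antitone hγ h
  · rw [weight, weight, weightExponent_eq_of_le h]

lemma weight_div (X γ x t : ℝ) : weight X γ t / weight X γ x =
    Real.exp (-(weightExponent X γ t - weightExponent X γ x)) := by
  rw [weight, weight, ← Real.exp_sub]
  congr 1
  ring

/-- A bound, uniform in `x ≤ t`, for the `n`-th power of `t - x` times a quotient of weights. -/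
def majorant (X γ : ℝ) (n : ℕ) (t : ℝ) : ℝ :=
  if t ≤ X then n.factorial / γ * (1 + t ^ 2)⁻¹ else Real.exp 1 * n.factorial * (1 + |t|) ^ n

lemma majorant_nonneg {X γ : ℝ} (hγ : 1 ≤ γ) (n : ℕ) (t : ℝ) : 0 ≤ majorant X γ n t := by
  unfold majorant
  split_ifs <;> positivity

lemma measurable_majorant (X γ : ℝ) (n : ℕ) : Measurable (majorant X γ n) := by
  unfold majorant
  refine Measurable.ite measurableSet_Iic ?_ ?_ <;> fun_prop

lemma pow_mul_exp_neg_le {r a : ℝ} (hr : 0 ≤ r) (ha : 0 < a) (n : ℕ) :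
    r ^ n * Real.exp (-(a * r)) ≤ n.factorial / a ^ n := by
  have h := Real.pow_div_factorial_le_exp (x := a * r) (by positivity) n
  rw [Real.exp_neg, ← div_eq_mul_inv, div_le_div_iff₀ (Real.exp_pos _) (by positivity)]
  rw [div_le_iff₀ (by positivity), mul_pow] at h
  linarith

lemma pow_mul_weight_div_le {X γ x t : ℝ} (hX : 0 ≤ X) (hγ : 1 ≤ γ) {n : ℕ} (hn : 1 ≤ n)
    (hxt : x ≤ t) :
    (t - x) ^ n * (weight X γ t / weight X γ x) ≤ majorant X γ n t := by
  have hr : 0 ≤ t - x := sub_nonneg.2 hxt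
  rw [weight_div, majorant]
  split_ifs with ht
  · have h1 := weightExponent_sub_ge (γ := γ) (by linarith) hxt ht
    have ha : 1 ≤ γ * (1 + t ^ 2) := by nlinarith [sq_nonneg t]
    calc (t - x) ^ n * Real.exp (-(weightExponent X γ t - weightExponent X γ x))
        ≤ (t - x) ^ n * Real.exp (-(γ * (1 + t ^ 2) * (t - x))) := by gcongr
      _ ≤ n.factorial / (γ * (1 + t ^ 2)) ^ n := pow_mul_exp_neg_le hr (by linarith) n
      _ ≤ n.factorial / (γ * (1 + t ^ 2)) := by
        gcongr
        exact le_self_pow₀ ha (by omega)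
      _ = _ := by field_simp
  · rw [not_le] at ht
    have hf : (1 : ℝ) ≤ n.factorial := by exact_mod_cast Nat.one_le_iff_ne_zero.2 n.factorial_ne_zero
    have ht0 : 0 < t := hX.trans_lt ht
    rw [abs_of_pos ht0]
    rcases le_total x X with hx | hx
    · have h1 := weightExponent_sub_ge (γ := γ) (by linarith) hx le_rfl
      rw [weightExponent_eq_of_le ht.le]
      have h2 : X - x ≤ weightExponent X γ X - weightExponent X γ x := by
        refine le_trans ?_ h1
        have ha : 1 ≤ γ * (1 + X ^ 2) := by nlinarith [sq_nonneg X]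
        nlinarith
      have h3 : t - x ≤ (1 + t) * (1 + (X - x)) := by nlinarith
      have h4 := Real.pow_div_factorial_le_exp (x := 1 + (X - x)) (by linarith) n
      rw [div_le_iff₀ (by positivity)] at h4
      calc (t - x) ^ n * Real.exp (-(weightExponent X γ X - weightExponent X γ x))
          ≤ ((1 + t) * (1 + (X - x))) ^ n * Real.exp (-(X - x)) := by gcongr
        _ = (1 + t) ^ n * Real.exp (-(X - x)) * (1 + (X - x)) ^ n := by rw [mul_pow]; ring
        _ ≤ (1 + t) ^ n * Real.exp (-(X - x)) * (Real.exp (1 + (X - x)) * n.factorial) := by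
          gcongr
        _ = (1 + t) ^ n * n.factorial * (Real.exp (-(X - x)) * Real.exp (1 + (X - x))) := by ring
        _ = _ := by rw [← Real.exp_add]; ring_nf
    · rw [weightExponent_eq_of_le ht.le, weightExponent_eq_of_le hx, sub_self, neg_zero,
        Real.exp_zero, mul_one]
      have he : 1 ≤ Real.exp 1 := Real.one_le_exp zero_le_one
      calc (t - x) ^ n ≤ (1 + t) ^ n := by gcongr; linarith
        _ ≤ Real.exp 1 * n.factorial * (1 + t) ^ n :=
          le_mul_of_one_le_left (by positivity) (one_le_mul_of_one_le_of_one_le he hf)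

namespace IsJostPotential

variable {k : ℕ} {q : ℝ → ℝ}

lemma integrable_majorant (hq : IsJostPotential k q) {X γ : ℝ} {n : ℕ}
    (hn : n ≤ k + 1) : Integrable fun t => majorant X γ n t * |q t| := by
  have h1 : IntegrableOn (fun t => majorant X γ n t * |q t|) (Set.Iic X) := by
    refine IntegrableOn.congr_fun (f := fun t => n.factorial / γ * |q t / (1 + t ^ 2)|)
      (hq.left.norm.const_mul _).integrableOn (fun t ht => ?_) measurableSet_Iic
    simp only [majorant, if_pos (Set.mem_Iic.1 ht), abs_div,
      abs_of_pos (by positivity : 0 < 1 + t ^ 2)]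
    ring
  have h2 : IntegrableOn (fun t => majorant X γ n t * |q t|) (Set.Ioi X) := by
    refine IntegrableOn.congr_fun
      (f := fun t => Real.exp 1 * n.factorial * ((1 + |t|) ^ n * |q t|))
      ((hq.integrableOn_pow hn X).const_mul _) (fun t ht => ?_) measurableSet_Ioi
    simp only [majorant, if_neg (not_le.2 (Set.mem_Ioi.1 ht))]
    ring
  rw [← integrableOn_univ, ← Set.Iic_union_Ioi (a := X)]
  exact h1.union h2

/-- The weight can be chosen so that the Volterra operator has norm less than `1`: the part of the
integral beyond a large `X` is small, and the rest is small for a large exponent `γ`. -/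
lemma exists_integral_majorant_lt_one (hq : IsJostPotential k q) :
    ∃ X γ : ℝ, 0 ≤ X ∧ 1 ≤ γ ∧ ∫ t, majorant X γ 1 t * |q t| < 1 := by
  have hi := (hq.integrableOn_pow (n := 1) (by omega) 0).const_mul (Real.exp 1)
  obtain ⟨X, hX, hX0⟩ := (((tendsto_setIntegral_Ioi_zero hi).eventually
    (gt_mem_nhds (show (0 : ℝ) < 1 / 2 by norm_num))).and (eventually_ge_atTop 0)).exists
  set J := ∫ t, |q t / (1 + t ^ 2)| with hJ
  have hJ0 : 0 ≤ J := integral_nonneg fun _ => abs_nonneg _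
  refine ⟨X, 2 * J + 1, hX0, by linarith, ?_⟩
  have hint := hq.integrable_majorant (X := X) (γ := 2 * J + 1) (n := 1) (by omega)
  rw [← integral_add_compl measurableSet_Iic hint (s := Set.Iic X), Set.compl_Iic]
  have h1 : ∫ t in Set.Iic X, majorant X (2 * J + 1) 1 t * |q t| ≤ (2 * J + 1)⁻¹ * J := by
    have : ∫ t in Set.Iic X, majorant X (2 * J + 1) 1 t * |q t|
        = ∫ t in Set.Iic X, (2 * J + 1)⁻¹ * |q t / (1 + t ^ 2)| := by
      refine setIntegral_congr_fun measurableSet_Iic fun t ht => ?_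
      simp only [majorant, if_pos (Set.mem_Iic.1 ht), abs_div,
        abs_of_pos (by positivity : 0 < 1 + t ^ 2), Nat.factorial_one, Nat.cast_one]
      ring
    rw [this, integral_const_mul]
    gcongr
    exact setIntegral_le_integral hq.left.norm (.of_forall fun _ => abs_nonneg _)
  have h2 : ∫ t in Set.Ioi X, majorant X (2 * J + 1) 1 t * |q t|
      = ∫ t in Set.Ioi X, Real.exp 1 * ((1 + |t|) ^ 1 * |q t|) := by
    refine setIntegral_congr_fun measurableSet_Ioi fun t ht => ?_
    simp only [majorant, if_neg (not_le.2 (Set.mem_Ioi.1 ht)), Nat.factorial_one, Nat.cast_one]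
    ring
  have h3 : (2 * J + 1)⁻¹ * J < 1 / 2 := by
    rw [inv_mul_lt_iff₀ (by linarith)]
    linarith
  rw [h2]
  linarith

end IsJostPotential

/-- The kernel of the Volterra operator `g ↦ -∫_x^∞ D(t - x) q(t) g(t) dt`, conjugated by the
weight; its `j`-th derivative in `κ`. -/
def volterraKernel (q : ℝ → ℝ) (X γ : ℝ) (j : ℕ) (κ : ℂ) (x t : ℝ) : ℂ :=
  volterraSymbol j κ (max (t - x) 0) * (-((weight X γ t / weight X γ x * q t : ℝ) : ℂ))

/-- The kernel, constant in `x`, of the functional `g ↦ ∫_0^∞ exp (2iκt) q(t) w(t) g(t) dt` that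
gives the derivative at `0`; its `j`-th derivative in `κ`. -/
def slopeKernel (q : ℝ → ℝ) (X γ : ℝ) (j : ℕ) (κ : ℂ) (_x t : ℝ) : ℂ :=
  expSymbol j κ (max t 0) * (Set.Ioi (0 : ℝ)).indicator (fun t => ((weight X γ t * q t : ℝ) : ℂ)) t

namespace IsJostPotential

variable {k : ℕ} {q : ℝ → ℝ}

lemma volterraKernel_spec (hq : IsJostPotential k q) {X γ : ℝ} (hX : 0 ≤ X) (hγ : 1 ≤ γ) :
    (∀ j ≤ k, ∀ κ ∈ uhp, IsKernel (volterraKernel q X γ j κ)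
      (fun t => 2 ^ j * (majorant X γ (j + 1) t * |q t|))) ∧
    ContDiffOn ℂ k (fun κ => kernelOp (volterraKernel q X γ 0 κ)) uhp := by
  refine contDiffOn_symbolOp isSymbol_volterra (r := fun x t => max (t - x) 0)
    (a := fun x t => -((weight X γ t / weight X γ x * q t : ℝ) : ℂ))
    (M := fun n t => majorant X γ n t * |q t|) (fun x t => le_max_right _ _) ?_ ?_ ?_ ?_ ?_ ?_
  · intro j κ t
    have h1 := isSymbol_volterra.cont j κ
    have h2 : Continuous fun x => weight X γ t / weight X γ x :=
      continuous_const.div (continuous_weight X γ) fun x => (weight_pos X γ x).ne'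
    fun_prop
  · intro x
    fun_prop
  · intro x
    have h2 : Continuous fun t => weight X γ t / weight X γ x := (continuous_weight X γ).div_const _
    exact (Complex.continuous_ofReal.comp_aestronglyMeasurable
      (h2.aestronglyMeasurable.mul hq.aestronglyMeasurable)).neg
  · intro n hn x t
    have hw : 0 < weight X γ t / weight X γ x := div_pos (weight_pos _ _ _) (weight_pos _ _ _)
    rw [norm_neg, Complex.norm_real, norm_mul, Real.norm_of_nonneg hw.le, Real.norm_eq_abs,
      ← mul_assoc]
    gcongr
    rcases le_total x t with h | h
    · rw [max_eq_left (sub_nonneg.2 h)]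
      exact pow_mul_weight_div_le hX hγ hn h
    · rw [max_eq_right (sub_nonpos.2 h), zero_pow (by omega), zero_mul]
      exact majorant_nonneg hγ n t
  · exact fun n => (measurable_majorant X γ n).aestronglyMeasurable.mul hq.aestronglyMeasurable.norm
  · exact fun n _ hn => hq.integrable_majorant hn

lemma slopeKernel_spec (hq : IsJostPotential k q) {X γ : ℝ} (hX : 0 ≤ X) (hγ : 1 ≤ γ) :
    (∀ j ≤ k, ∀ κ ∈ uhp, IsKernel (slopeKernel q X γ j κ)
      (fun t => 2 ^ j * (Set.Ioi (0 : ℝ)).indicator (fun t => (1 + |t|) ^ (j + 0) * |q t|) t)) ∧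
    ContDiffOn ℂ k (fun κ => kernelOp (slopeKernel q X γ 0 κ)) uhp := by
  have hc (n : ℕ) : Continuous fun x : ℝ => (1 + |x|) ^ n := by fun_prop
  refine contDiffOn_symbolOp isSymbol_exp (r := fun _ t => max t 0)
    (a := fun _ t => (Set.Ioi (0 : ℝ)).indicator (fun t => ((weight X γ t * q t : ℝ) : ℂ)) t)
    (M := fun n t => (Set.Ioi (0 : ℝ)).indicator (fun t => (1 + |t|) ^ n * |q t|) t)
    (fun x t => le_max_right _ _) ?_ ?_ ?_ ?_ ?_ ?_
  · exact fun j κ t => continuous_const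
  · intro x
    fun_prop
  · exact fun x => (Complex.continuous_ofReal.comp_aestronglyMeasurable
      ((continuous_weight X γ).aestronglyMeasurable.mul hq.aestronglyMeasurable)).indicator
      measurableSet_Ioi
  · intro n hn x t
    by_cases ht : t ∈ Set.Ioi (0 : ℝ)
    · have h0 : 0 < t := ht
      rw [Set.indicator_of_mem ht, Set.indicator_of_mem ht, max_eq_left h0.le, Complex.norm_real,
        norm_mul, Real.norm_of_nonneg (weight_pos _ _ _).le, Real.norm_eq_abs, ← mul_assoc]
      gcongr
      have hw : weight X γ t ≤ 1 := (weight_antitone (by linarith) h0.le).trans_eq (weight_zero hX)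
      refine (mul_le_of_le_one_right (by positivity) hw).trans ?_
      gcongr
      linarith [le_abs_self t]
    · rw [Set.indicator_of_notMem ht, Set.indicator_of_notMem ht, norm_zero, mul_zero]
  · exact fun n => ((hc n).aestronglyMeasurable.mul hq.aestronglyMeasurable.norm).indicator
      measurableSet_Ioi
  · exact fun n _ hn => (integrable_indicator_iff measurableSet_Ioi).2
      (hq.integrableOn_pow (by omega) 0)

end IsJostPotential

/-! ### Existence of Jost solutions and regularity of their Cauchy data -/

lemma hasDerivAt_volterraSymbol (κ : ℂ) (r : ℝ) :
    HasDerivAt (volterraSymbol 0 κ) (expSymbol 0 κ r) r :=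
  intervalIntegral.integral_hasDerivAt_right ((continuous_expSymbol 0 κ).intervalIntegrable _ _)
    ((continuous_expSymbol 0 κ).stronglyMeasurableAtFilter _ _) (continuous_expSymbol 0 κ).continuousAt

lemma norm_volterraSymbol_sub_le {κ : ℂ} (hκ : κ ∈ uhp) {r r' : ℝ} (hr : 0 ≤ r) (hr' : 0 ≤ r') :
    ‖volterraSymbol 0 κ r' - volterraSymbol 0 κ r‖ ≤ ‖r' - r‖ := by
  have := (convex_Ici (0 : ℝ)).norm_image_sub_le_of_norm_hasDerivWithin_le (C := 1)
    (fun r _ => (hasDerivAt_volterraSymbol κ r).hasDerivWithinAt)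
    (fun r hr => by simpa using norm_expSymbol_le hκ hr 0) hr hr'
  simpa using this

lemma volterraSymbol_zero_right (κ : ℂ) : volterraSymbol 0 κ 0 = 0 := by simp [volterraSymbol]

/-- Differentiation of the Volterra integral: since the kernel vanishes on the diagonal, there is no
boundary term, and the density `h` need only be integrable. -/
lemma hasDerivAt_volterra_integral {κ : ℂ} (hκ : κ ∈ uhp) {h : ℝ → ℂ}
    (hh : ∀ x₀, IntegrableOn h (Set.Ioi x₀)) (hm : AEStronglyMeasurable h volume) {x : ℝ}
    (hx : Integrable fun t => volterraSymbol 0 κ (max (t - x) 0) * h t) :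
    HasDerivAt (fun x => ∫ t, volterraSymbol 0 κ (max (t - x) 0) * h t)
      (-∫ t in Set.Ioi x, expSymbol 0 κ (t - x) * h t) x := by
  have hD := isSymbol_volterra.cont 0 κ
  have hE := continuous_expSymbol 0 κ
  have key := hasDerivAt_integral_of_dominated_loc_of_lip (μ := volume)
    (F := fun x t => volterraSymbol 0 κ (max (t - x) 0) * h t) (x₀ := x)
    (F' := fun t => -(Set.Ioi x).indicator (fun t => expSymbol 0 κ (t - x) * h t) t)
    (bound := (Set.Ioi (x - 1)).indicator fun t => ‖h t‖) (Metric.ball_mem_nhds x one_pos)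
    (.of_forall fun y => (by fun_prop : Continuous fun t =>
      volterraSymbol 0 κ (max (t - y) 0)).aestronglyMeasurable.mul hm) hx
    ((((by fun_prop : Continuous fun t => expSymbol 0 κ (t - x)).aestronglyMeasurable.mul
      hm).indicator measurableSet_Ioi).neg) (.of_forall fun t => ?_)
    ((integrable_indicator_iff measurableSet_Ioi).2 (hh _).norm) ?_
  · have := key.2
    rwa [integral_neg, integral_indicator measurableSet_Ioi] at this
  · refine LipschitzOnWith.of_dist_le_mul fun y hy z hz => ?_
    rw [Metric.mem_ball, Real.dist_eq, abs_lt] at hy hz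
    rw [dist_eq_norm, ← sub_mul, norm_mul, Real.coe_nnabs]
    by_cases ht : t ∈ Set.Ioi (x - 1)
    · rw [Set.indicator_of_mem ht, abs_of_nonneg (norm_nonneg _), mul_comm]
      gcongr
      refine (norm_volterraSymbol_sub_le hκ (le_max_right _ _) (le_max_right _ _)).trans ?_
      refine (abs_max_sub_max_le_abs _ _ _).trans (le_of_eq ?_)
      rw [Real.dist_eq, abs_sub_comm]
      congr 1
      ring
    · have ht' : t ≤ x - 1 := not_lt.1 ht
      rw [max_eq_right (by linarith), max_eq_right (by linarith)]
      simp [Set.indicator_of_notMem ht]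
  · filter_upwards [compl_mem_ae_iff.2 (measure_singleton x)] with t ht
    rcases lt_or_gt_of_ne (show t ≠ x from ht) with h1 | h1
    · have : t ∉ Set.Ioi x := not_lt.2 h1.le
      rw [Set.indicator_of_notMem this, neg_zero]
      refine (hasDerivAt_const x (0 : ℂ)).congr_of_eventuallyEq ?_
      filter_upwards [lt_mem_nhds h1] with y hy
      rw [max_eq_right (by linarith), volterraSymbol_zero_right, zero_mul]
    · rw [Set.indicator_of_mem (show t ∈ Set.Ioi x from h1)]
      have h2 : HasDerivAt (fun y : ℝ => t - y) (-1) x := by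
        simpa using (hasDerivAt_id x).const_sub t
      have h3 := ((hasDerivAt_volterraSymbol κ (t - x)).scomp x h2).mul_const (h t)
      refine (h3.congr_deriv (by simp)).congr_of_eventuallyEq ?_
      filter_upwards [gt_mem_nhds h1] with y hy
      rw [max_eq_left (by linarith)]
      rfl

lemma exp_eq_expSymbol_mul (κ : ℂ) (x t : ℝ) :
    expSymbol 0 κ (t - x) =
      Complex.exp (-(2 * Complex.I * κ * x)) * Complex.exp (2 * Complex.I * κ * t) := by
  rw [← Complex.exp_add, expSymbol, pow_zero, one_mul]
  congr 1
  push_cast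
  ring

/-- The amplitude `m = exp (-iκx) f` of a Jost solution `f` and its derivative `n`, with the
equations and the asymptotics that characterize them. -/
structure IsAmplitude (q : ℝ → ℝ) (κ : ℂ) (m n : ℝ → ℂ) : Prop where
  hasDerivAt : ∀ x, HasDerivAt m (n x) x
  sub_eq : ∀ x y : ℝ, Complex.exp (2 * Complex.I * κ * y) * n y
      - Complex.exp (2 * Complex.I * κ * x) * n x
    = ∫ t in x..y, -(Complex.exp (2 * Complex.I * κ * t) * (q t * m t))
  tendsto_one : Tendsto m atTop (𝓝 1)
  tendsto_zero : Tendsto n atTop (𝓝 0)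

/-- A solution of the Volterra equation is the amplitude of a Jost solution. -/
lemma isAmplitude_of_volterra {q : ℝ → ℝ} {κ : ℂ} (hκ : κ ∈ uhp) {m : ℝ → ℂ}
    (hm : AEStronglyMeasurable (fun t => (q t : ℂ) * m t) volume)
    (hint : ∀ x₀, IntegrableOn (fun t => (1 + |t|) * ‖(q t : ℂ) * m t‖) (Set.Ioi x₀))
    (hint' : ∀ x, Integrable fun t => volterraSymbol 0 κ (max (t - x) 0) * (q t * m t))
    (heq : ∀ x, m x = 1 - ∫ t, volterraSymbol 0 κ (max (t - x) 0) * (q t * m t)) :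
    IsAmplitude q κ m (fun x => ∫ t in Set.Ioi x, expSymbol 0 κ (t - x) * (q t * m t)) := by
  have hh : ∀ x₀, IntegrableOn (fun t => (q t : ℂ) * m t) (Set.Ioi x₀) := fun x₀ =>
    (hint x₀).mono' hm.restrict (.of_forall fun t =>
      le_mul_of_one_le_left (norm_nonneg _) (by linarith [abs_nonneg t]))
  have hexp : Continuous fun t : ℝ => Complex.exp (2 * Complex.I * κ * t) := by fun_prop
  have hexpint : ∀ x₀, IntegrableOn
      (fun t : ℝ => Complex.exp (2 * Complex.I * κ * t) * (q t * m t)) (Set.Ioi x₀) := fun x₀ => by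
    have h1 : IntegrableOn (fun t : ℝ => expSymbol 0 κ (t - x₀) * (q t * m t)) (Set.Ioi x₀) := by
      refine (hh x₀).norm.mono' ((Continuous.aestronglyMeasurable (by
        have := continuous_expSymbol 0 κ; fun_prop)).mul hm).restrict ?_
      filter_upwards [ae_restrict_mem measurableSet_Ioi] with t ht
      rw [norm_mul]
      refine mul_le_of_le_one_left (norm_nonneg _) ?_
      simpa using norm_expSymbol_le hκ (sub_nonneg.2 (le_of_lt ht)) 0
    refine (h1.const_mul (Complex.exp (2 * Complex.I * κ * x₀))).congr (.of_forall fun t => ?_)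
    simp only [exp_eq_expSymbol_mul, ← mul_assoc, ← Complex.exp_add]
    simp
  refine ⟨fun x => ?_, fun x y => ?_, ?_, ?_⟩
  · have := (hasDerivAt_volterra_integral hκ hh hm (hint' x)).const_sub 1
    rw [neg_neg] at this
    exact this.congr_of_eventuallyEq (.of_forall heq)
  · have h2 (x : ℝ) : Complex.exp (2 * Complex.I * κ * x) *
        ∫ t in Set.Ioi x, expSymbol 0 κ (t - x) * (q t * m t)
        = ∫ t in Set.Ioi x, Complex.exp (2 * Complex.I * κ * t) * (q t * m t) := by
      rw [← integral_const_mul]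
      congr 1 with t
      simp only [exp_eq_expSymbol_mul, ← mul_assoc, ← Complex.exp_add]
      simp
    simp only [h2]
    rw [intervalIntegral.integral_neg,
      ← intervalIntegral.integral_Ioi_sub_Ioi' (hexpint x) (hexpint y), neg_sub]
  · have h1 : Tendsto (fun x => ∫ t, volterraSymbol 0 κ (max (t - x) 0) * (q t * m t)) atTop
        (𝓝 0) := by
      refine squeeze_zero_norm' ?_ (tendsto_setIntegral_Ioi_zero (hint 0))
      filter_upwards [eventually_ge_atTop 0] with x hx
      rw [← integral_indicator measurableSet_Ioi]
      refine norm_integral_le_of_norm_le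
        ((integrable_indicator_iff measurableSet_Ioi).2 (hint x)) (.of_forall fun t => ?_)
      by_cases ht : t ∈ Set.Ioi x
      · have ht' : x < t := ht
        rw [Set.indicator_of_mem ht, norm_mul, max_eq_left (by linarith)]
        gcongr
        have := isSymbol_volterra.bound 0 κ hκ (t - x) (by linarith)
        simp only [pow_zero, zero_add, pow_one, one_mul] at this
        linarith [le_abs_self t]
      · have ht' : t ≤ x := not_lt.1 ht
        rw [Set.indicator_of_notMem ht, max_eq_right (by linarith), volterraSymbol_zero_right,
          zero_mul, norm_zero]
    have := (tendsto_const_nhds (x := (1 : ℂ))).sub h1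
    rw [sub_zero] at this
    exact this.congr fun x => (heq x).symm
  · refine squeeze_zero_norm' (.of_forall fun x => ?_)
      (tendsto_setIntegral_Ioi_zero (hh 0).norm)
    refine norm_integral_le_of_norm_le (hh x).norm ?_
    filter_upwards [ae_restrict_mem measurableSet_Ioi] with t ht
    rw [norm_mul]
    refine mul_le_of_le_one_left (norm_nonneg _) ?_
    simpa using norm_expSymbol_le hκ (sub_nonneg.2 (le_of_lt ht)) 0

/-- Existence of the amplitudes of the Jost solutions, for all `κ` in the closed upper half-plane,
with Cauchy data at the origin that are `C^k` in `κ`. -/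
theorem IsJostPotential.exists_amplitude {k : ℕ} {q : ℝ → ℝ} (hq : IsJostPotential k q) :
    ∃ M N : ℂ → ℂ, ContDiffOn ℂ k M uhp ∧ ContDiffOn ℂ k N uhp ∧
      ∀ κ ∈ uhp, ∃ m n : ℝ → ℂ, IsAmplitude q κ m n ∧ m 0 = M κ ∧ n 0 = N κ := by
  obtain ⟨X, γ, hX, hγ, hlt⟩ := hq.exists_integral_majorant_lt_one
  have hγ0 : 0 ≤ γ := by linarith
  obtain ⟨hV, hVs⟩ := hq.volterraKernel_spec hX hγ
  obtain ⟨hS, hSs⟩ := hq.slopeKernel_spec hX hγ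
  set K : ℂ → (ℝ →ᵇ ℂ) →L[ℂ] (ℝ →ᵇ ℂ) := fun κ => kernelOp (volterraKernel q X γ 0 κ) with hK
  set L : ℂ → (ℝ →ᵇ ℂ) →L[ℂ] (ℝ →ᵇ ℂ) := fun κ => kernelOp (slopeKernel q X γ 0 κ) with hL
  have hKn : ∀ κ ∈ uhp, ‖K κ‖ < 1 := fun κ hκ =>
    (hV 0 (Nat.zero_le _) κ hκ).norm_kernelOp_le.trans_lt (by simpa using hlt)
  have hunit : ∀ κ ∈ uhp, IsUnit (1 - K κ) := fun κ hκ =>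
    isUnit_one_sub_of_norm_lt_one (x := K κ) (hKn κ hκ)
  have hw0 (x : ℝ) : weight X γ x ≠ 0 := (weight_pos X γ x).ne'
  have hwc (x : ℝ) : ((weight X γ x : ℝ) : ℂ) ≠ 0 := Complex.ofReal_ne_zero.2 (hw0 x)
  -- the constant function `1`, divided by the weight
  let e : ℝ →ᵇ ℂ := BoundedContinuousFunction.ofNormedAddCommGroup
    (fun x => (((weight X γ x)⁻¹ : ℝ) : ℂ))
    (Complex.continuous_ofReal.comp ((continuous_weight X γ).inv₀ hw0)) (weight X γ X)⁻¹
    (fun x => by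
      rw [Complex.norm_real, Real.norm_of_nonneg (inv_nonneg.2 (weight_pos X γ x).le)]
      exact inv_anti₀ (weight_pos X γ X) (weight_ge hγ0 x))
  have he (x : ℝ) : e x = ((weight X γ x : ℝ) : ℂ)⁻¹ := by
    simp [e]
  set G : ℂ → (ℝ →ᵇ ℂ) := fun κ => Ring.inverse (1 - K κ) e with hG
  have hGs : ContDiffOn ℂ k G uhp := by
    intro κ hκ
    have hu := hunit κ hκ
    have h1 : ContDiffAt ℂ k Ring.inverse (1 - K κ) := by
      have := contDiffAt_ringInverse ℂ (R := (ℝ →ᵇ ℂ) →L[ℂ] (ℝ →ᵇ ℂ)) (n := k) hu.unit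
      rwa [hu.unit_spec] at this
    have h2 : ContDiffWithinAt ℂ k (fun κ => Ring.inverse (1 - K κ)) uhp κ :=
      ContDiffAt.comp_contDiffWithinAt (g := Ring.inverse) (f := fun κ => 1 - K κ) κ h1
        (contDiffWithinAt_const.sub (hVs κ hκ))
    exact h2.clm_apply contDiffWithinAt_const
  have hGeq : ∀ κ ∈ uhp, ∀ x, G κ x = e x + K κ (G κ) x := fun κ hκ x => by
    have hu := hunit κ hκ
    have h1 : (1 - K κ) (G κ) = e := by
      rw [hG]
      simp only
      rw [← mul_apply_eq_comp, Ring.mul_inverse_cancel _ hu]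
      rfl
    have h2 : (1 - K κ) (G κ) x = G κ x - K κ (G κ) x := rfl
    rw [← h1, h2, sub_add_cancel]
  have ev : ContDiff ℂ k fun g : ℝ →ᵇ ℂ => g 0 :=
    (BoundedContinuousFunction.evalCLM ℂ (0 : ℝ) : (ℝ →ᵇ ℂ) →L[ℂ] ℂ).contDiff
  refine ⟨fun κ => G κ 0, fun κ => L κ (G κ) 0, ev.comp_contDiffOn hGs,
    ev.comp_contDiffOn (hSs.clm_apply hGs), fun κ hκ => ?_⟩
  have hGc : Continuous (G κ) := (G κ).continuous
  have hwcont := continuous_weight X γ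
  have hqm := hq.aestronglyMeasurable
  set m : ℝ → ℂ := fun x => weight X γ x * G κ x with hm
  have hmc : Continuous m := by fun_prop
  have hmm : AEStronglyMeasurable (fun t => (q t : ℂ) * m t) volume :=
    (Complex.continuous_ofReal.comp_aestronglyMeasurable hqm).mul hmc.aestronglyMeasurable
  have hconv (x t : ℝ) : volterraSymbol 0 κ (max (t - x) 0) * (q t * m t)
      = -(weight X γ x : ℂ) * (volterraKernel q X γ 0 κ x t * G κ t) := by
    simp only [volterraKernel, hm]
    push_cast
    field_simp [hwc x]
  have hVκ := hV 0 (Nat.zero_le _) κ hκ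
  refine ⟨m, _, isAmplitude_of_volterra hκ hmm (fun x₀ => ?_) (fun x => ?_) (fun x => ?_), ?_, ?_⟩
  · have h1 := (hq.integrableOn_pow (n := 1) (by omega) x₀).mul_const (weight X γ x₀ * ‖G κ‖)
    refine h1.mono' ((Continuous.aestronglyMeasurable (by fun_prop)).mul hmm.norm).restrict ?_
    filter_upwards [ae_restrict_mem measurableSet_Ioi] with t ht
    have ht' : x₀ < t := ht
    rw [Real.norm_of_nonneg (by positivity), norm_mul, hm, norm_mul, Complex.norm_real,
      Complex.norm_real, Real.norm_of_nonneg (weight_pos _ _ _).le, pow_one, Real.norm_eq_abs,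
      mul_assoc]
    gcongr
    · exact (weight_pos _ _ _).le
    · exact weight_antitone hγ0 ht'.le
    · exact (G κ).norm_coe_le_norm t
  · simp only [hconv]
    exact (hVκ.integrable_mul (G κ) x).const_mul _
  · simp only [hconv, integral_const_mul]
    rw [← hVκ.kernelOp_apply, hm]
    simp only
    conv_lhs => rw [hGeq κ hκ x, he, mul_add, mul_inv_cancel₀ (hwc x)]
    rw [neg_mul, sub_neg_eq_add]
  · simp [hm, weight_zero hX]
  · simp only [hL]
    rw [(hS 0 (Nat.zero_le _) κ hκ).kernelOp_apply, ← integral_indicator measurableSet_Ioi]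
    congr 1 with t
    by_cases ht : t ∈ Set.Ioi (0 : ℝ)
    · have ht' : 0 < t := ht
      rw [Set.indicator_of_mem ht, slopeKernel, Set.indicator_of_mem ht, max_eq_left ht'.le,
        sub_zero]
      push_cast
      ring
    · rw [Set.indicator_of_notMem ht, slopeKernel, Set.indicator_of_notMem ht]
      ring

/-! ### Carathéodory solutions of the Schrödinger equation -/

lemma continuous_of_sub_eq_integral {F φ : ℝ → ℂ} (hφ : LocallyIntegrable φ volume)
    (hF : ∀ x y, F y - F x = ∫ t in x..y, φ t) : Continuous F := by
  have h : F = fun y => F 0 + ∫ t in (0 : ℝ)..y, φ t := by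
    ext y
    rw [← hF 0 y]
    ring
  rw [h]
  exact continuous_const.add (intervalIntegral.continuous_primitive
    (fun a b => (hφ.integrableOn_isCompact isCompact_uIcc).intervalIntegrable) 0)

/-- Product rule for an indefinite integral `F` and a `C¹` function `G`. The difference of the two
sides is differentiable everywhere with derivative `0`, although `F` need not be. -/
lemma mul_sub_mul_eq_integral {F φ G G' : ℝ → ℂ} (hφ : LocallyIntegrable φ volume)
    (hF : ∀ x y, F y - F x = ∫ t in x..y, φ t) (hG : ∀ x, HasDerivAt G (G' x) x)
    (hG' : Continuous G') (x y : ℝ) :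
    F y * G y - F x * G x = ∫ t in x..y, (φ t * G t + F t * G' t) := by
  have hGc : Continuous G := continuous_iff_continuousAt.2 fun x => (hG x).continuousAt
  have hFc := continuous_of_sub_eq_integral hφ hF
  have hφi (a b : ℝ) : IntervalIntegrable φ volume a b :=
    (hφ.integrableOn_isCompact isCompact_uIcc).intervalIntegrable
  have hφG (a b : ℝ) : IntervalIntegrable (fun t => φ t * G t) volume a b :=
    (hφi a b).mul_continuousOn hGc.continuousOn
  have hFG' (a b : ℝ) : IntervalIntegrable (fun t => F t * G' t) volume a b :=
    (hFc.mul hG').intervalIntegrable a b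
  have hΦ : ∀ y₀, HasDerivAt
      (fun y => F y * G y - (∫ t in x..y, φ t * G t) - ∫ t in x..y, F t * G' t) 0 y₀ := by
    intro y₀
    have h1 : HasDerivAt (fun y => ∫ t in x..y, F t * G' t) (F y₀ * G' y₀) y₀ :=
      intervalIntegral.integral_hasDerivAt_right (hFG' _ _)
        ((hFc.mul hG').stronglyMeasurableAtFilter _ _) (hFc.mul hG').continuousAt
    have hGO : (fun y => G y - G y₀) =O[𝓝 y₀] fun y => y - y₀ := (hG y₀).isBigO_sub
    have h2 : HasDerivAt (fun y => (F y - F y₀) * (G y - G y₀)) 0 y₀ := by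
      rw [hasDerivAt_iff_isLittleO]
      have : (fun y => F y - F y₀) =o[𝓝 y₀] fun _ => (1 : ℝ) := by
        rw [isLittleO_one_iff]
        simpa using (hFc.tendsto y₀).sub_const (F y₀)
      simpa using this.mul_isBigO hGO
    have h3 : HasDerivAt (fun y => ∫ t in y₀..y, φ t * (G t - G y₀)) 0 y₀ := by
      rw [hasDerivAt_iff_isLittleO]
      obtain ⟨C, hC⟩ := hGO.bound
      obtain ⟨δ, hδ, hball⟩ := Metric.eventually_nhds_iff_ball.1 hC
      have hP : (fun y => ∫ t in y₀..y, ‖φ t‖) =o[𝓝 y₀] fun _ => (1 : ℝ) := by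
        rw [isLittleO_one_iff]
        have := (intervalIntegral.continuous_primitive
          (fun a b => (hφi a b).norm) y₀).tendsto y₀
        simpa using this
      have hO : (fun y => ∫ t in y₀..y, φ t * (G t - G y₀)) =O[𝓝 y₀]
          fun y => (∫ t in y₀..y, ‖φ t‖) * (y - y₀) := by
        refine IsBigO.of_bound C ?_
        filter_upwards [Metric.ball_mem_nhds y₀ hδ] with y hy
        have hb : ∀ t ∈ Set.uIoc y₀ y, ‖φ t * (G t - G y₀)‖ ≤ ‖φ t‖ * (C * ‖y - y₀‖) := by
          intro t ht
          have htd : |t - y₀| ≤ |y - y₀| := Set.abs_sub_left_of_mem_uIcc (Set.uIoc_subset_uIcc ht)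
          have hC0 := hball t (by
            rw [Metric.mem_ball, Real.dist_eq] at hy ⊢
            exact htd.trans_lt hy)
          rw [norm_mul]
          refine mul_le_mul_of_nonneg_left ?_ (norm_nonneg _)
          rcases eq_or_ne t y₀ with rfl | hne
          · have := hball y hy
            simpa using (norm_nonneg _).trans this
          · have hCn : 0 ≤ C := by
              by_contra hneg
              have : 0 < ‖t - y₀‖ := norm_pos_iff.2 (sub_ne_zero.2 hne)
              nlinarith [(norm_nonneg _).trans hC0]
            exact hC0.trans (mul_le_mul_of_nonneg_left htd hCn)
        have := intervalIntegral.norm_integral_le_abs_of_norm_le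
          (μ := volume) (a := y₀) (b := y) (g := fun t => ‖φ t‖ * (C * ‖y - y₀‖))
          (by filter_upwards [ae_restrict_mem measurableSet_uIoc] with t ht using hb t ht)
          ((hφi _ _).norm.mul_const _)
        refine this.trans (le_of_eq ?_)
        have hCn : 0 ≤ C * ‖y - y₀‖ := (norm_nonneg _).trans (hball y hy)
        rw [intervalIntegral.integral_mul_const, abs_mul, abs_of_nonneg hCn, norm_mul]
        simp only [Real.norm_eq_abs]
        ring
      have h4 := hO.trans_isLittleO (hP.mul_isBigO (isBigO_refl (fun y => y - y₀) (𝓝 y₀)))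
      simpa using h4
    have h5 := (((hG y₀).const_mul (F y₀)).add h2).sub h3
    refine ((h5.sub h1).add_const
      (-∫ t in x..y₀, φ t * G t)).congr_of_eventuallyEq
      (.of_forall fun y => ?_) |>.congr_deriv (by ring)
    have e1 : ∫ t in x..y, φ t * G t = (∫ t in x..y₀, φ t * G t) + ∫ t in y₀..y, φ t * G t :=
      (intervalIntegral.integral_add_adjacent_intervals (hφG _ _) (hφG _ _)).symm
    have e2 : ∫ t in y₀..y, φ t * (G t - G y₀) = (∫ t in y₀..y, φ t * G t)
        - (F y - F y₀) * G y₀ := by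
      rw [hF y₀ y, ← intervalIntegral.integral_mul_const, ← intervalIntegral.integral_sub (hφG _ _)
        ((hφi _ _).mul_const _)]
      congr 1 with t
      ring
    simp only [Pi.add_apply, Pi.sub_apply, e1, e2]
    ring
  have := is_const_of_deriv_eq_zero (fun y => (hΦ y).differentiableAt) (fun y => (hΦ y).deriv) y x
  simp only [intervalIntegral.integral_same, sub_zero] at this
  rw [intervalIntegral.integral_add (hφG _ _) (hFG' _ _), ← this]
  ring

namespace SolvesSchrodinger

variable {q : ℝ → ℝ} {E : ℂ} {f g : ℝ → ℂ}

lemma locallyIntegrable (hq : LocallyIntegrable q volume) (hf : Continuous f) :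
    LocallyIntegrable (fun t => -((q t : ℂ) + E) * f t) volume := by
  rw [locallyIntegrable_iff]
  intro K hK
  refine IntegrableOn.mul_continuousOn ?_ hf.continuousOn hK
  have h1 : IntegrableOn (fun t => (q t : ℂ)) K := (hq.integrableOn_isCompact hK).ofReal
  exact (h1.add (continuous_const.locallyIntegrable.integrableOn_isCompact hK)).neg

lemma continuous_deriv (hq : LocallyIntegrable q volume) (hf : SolvesSchrodinger q E f) :
    Continuous (deriv f) :=
  continuous_of_sub_eq_integral (locallyIntegrable hq hf.1.continuous) hf.2

lemma intervalIntegrable (hq : LocallyIntegrable q volume) (hf : SolvesSchrodinger q E f)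
    (x y : ℝ) : IntervalIntegrable (fun t => -((q t : ℂ) + E) * f t) volume x y :=
  ((locallyIntegrable hq hf.1.continuous).integrableOn_isCompact
    isCompact_uIcc).intervalIntegrable

lemma sub (hq : LocallyIntegrable q volume) (hf : SolvesSchrodinger q E f)
    (hg : SolvesSchrodinger q E g) : SolvesSchrodinger q E (fun x => f x - g x) := by
  refine ⟨hf.1.sub hg.1, fun x y => ?_⟩
  have hd (x : ℝ) : deriv (fun x => f x - g x) x = deriv f x - deriv g x :=
    deriv_fun_sub (hf.1 x) (hg.1 x)
  rw [hd, hd]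
  simp only [mul_sub]
  rw [intervalIntegral.integral_sub (hf.intervalIntegrable hq x y) (hg.intervalIntegrable hq x y),
    ← hf.2, ← hg.2]
  ring

/-- The Wronskian of two solutions of the same equation is constant. -/
lemma wronskian_const (hq : LocallyIntegrable q volume) (hf : SolvesSchrodinger q E f)
    (hg : SolvesSchrodinger q E g) (x y : ℝ) :
    f y * deriv g y - deriv f y * g y = f x * deriv g x - deriv f x * g x := by
  have h1 := mul_sub_mul_eq_integral (locallyIntegrable hq hf.1.continuous) hf.2
    (fun x => (hg.1 x).hasDerivAt) (hg.continuous_deriv hq) x y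
  have h2 := mul_sub_mul_eq_integral (locallyIntegrable hq hg.1.continuous) hg.2
    (fun x => (hf.1 x).hasDerivAt) (hf.continuous_deriv hq) x y
  have h3 : ∫ t in x..y, (-((q t : ℂ) + E) * f t * g t + deriv f t * deriv g t)
      = ∫ t in x..y, (-((q t : ℂ) + E) * g t * f t + deriv g t * deriv f t) := by
    congr 1 with t
    ring
  rw [h3, ← h2] at h1
  linear_combination -h1

/-- A solution with vanishing Cauchy data at `X` vanishes to the left of `X`: the weighted maximum
`M` of `‖h x‖ exp (γx)` satisfies `M ≤ M I / γ`, where `I` is the integral of `‖q + E‖`. -/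
lemma eq_zero_of_cauchy (hq : LocallyIntegrable q volume) (hf : SolvesSchrodinger q E f) {X : ℝ}
    (h0 : f X = 0) (h1 : deriv f X = 0) {a : ℝ} (ha : a ≤ X) : f a = 0 := by
  have hQ : LocallyIntegrable (fun t => -((q t : ℂ) + E) * 1) volume :=
    locallyIntegrable hq continuous_const
  have hQi (x y : ℝ) : IntervalIntegrable (fun t => ‖-((q t : ℂ) + E)‖) volume x y := by
    simpa using (hQ.integrableOn_isCompact isCompact_uIcc).intervalIntegrable.norm
  set I := ∫ t in a..X, ‖-((q t : ℂ) + E)‖ with hI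
  have hI0 : 0 ≤ I := intervalIntegral.integral_nonneg ha fun _ _ => norm_nonneg _
  set γ := I + 1 with hγ
  have hγ0 : 0 < γ := by linarith
  have hfc := hf.1.continuous
  obtain ⟨z, hz, hmax⟩ := (isCompact_Icc (a := a) (b := X)).exists_isMaxOn
    (Set.nonempty_Icc.2 ha) (f := fun x => ‖f x‖ * Real.exp (γ * x)) (by fun_prop)
  set M := ‖f z‖ * Real.exp (γ * z) with hM
  have hM0 : 0 ≤ M := by positivity
  have hfM : ∀ x ∈ Set.Icc a X, ‖f x‖ ≤ M * Real.exp (-(γ * x)) := fun x hx => by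
    have : ‖f x‖ * Real.exp (γ * x) ≤ M := hmax hx
    rwa [Real.exp_neg, ← div_eq_mul_inv, le_div_iff₀ (Real.exp_pos _)]
  have hd : ∀ x ∈ Set.Icc a X, ‖deriv f x‖ ≤ M * I * Real.exp (-(γ * x)) := fun x hx => by
    have e := hf.2 x X
    rw [h1, zero_sub] at e
    rw [← norm_neg, e]
    have hb : ∀ t ∈ Set.Ioc x X, ‖-((q t : ℂ) + E) * f t‖
        ≤ ‖-((q t : ℂ) + E)‖ * (M * Real.exp (-(γ * x))) := fun t ht => by
      rw [norm_mul]
      refine mul_le_mul_of_nonneg_left ((hfM t ⟨hx.1.trans ht.1.le, ht.2⟩).trans ?_)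
        (norm_nonneg _)
      have := ht.1.le
      gcongr
    refine (intervalIntegral.norm_integral_le_of_norm_le hx.2 (.of_forall hb)
      ((hQi _ _).mul_const _)).trans ?_
    rw [intervalIntegral.integral_mul_const]
    have : ∫ t in x..X, ‖-((q t : ℂ) + E)‖ ≤ I :=
      intervalIntegral.integral_mono_interval hx.1 hx.2 le_rfl
        (.of_forall fun _ => norm_nonneg _) (hQi _ _)
    calc _ ≤ I * (M * Real.exp (-(γ * x))) := by gcongr
      _ = _ := by ring
  have hexp : ∀ t : ℝ, HasDerivAt (fun t => -(Real.exp (-(γ * t)) / γ)) (Real.exp (-(γ * t))) t :=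
    fun t => by
      have h : HasDerivAt (fun t : ℝ => -(γ * t)) (-γ) t := by
        exact ((hasDerivAt_id t).const_mul γ).neg.congr_deriv (by simp)
      exact ((h.exp.div_const γ).neg).congr_deriv (by field_simp)
  have hfz : ‖f z‖ ≤ M * I * (Real.exp (-(γ * z)) / γ) := by
    have e : ∫ t in z..X, deriv f t = -f z := by
      rw [intervalIntegral.integral_eq_sub_of_hasDerivAt (fun t _ => (hf.1 t).hasDerivAt)
        ((hf.continuous_deriv hq).intervalIntegrable _ _), h0, zero_sub]
    rw [← norm_neg, ← e]
    have hci : IntervalIntegrable (fun t => Real.exp (-(γ * t))) volume z X :=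
      Continuous.intervalIntegrable (by fun_prop) _ _
    refine (intervalIntegral.norm_integral_le_of_norm_le hz.2
      (.of_forall fun t ht => hd t ⟨hz.1.trans ht.1.le, ht.2⟩) (hci.const_mul _)).trans ?_
    rw [intervalIntegral.integral_const_mul,
      intervalIntegral.integral_eq_sub_of_hasDerivAt (fun t _ => hexp t) hci]
    have : 0 ≤ Real.exp (-(γ * X)) / γ := by positivity
    gcongr
    linarith
  have hMle : M ≤ M * I / γ := by
    calc M ≤ M * I * (Real.exp (-(γ * z)) / γ) * Real.exp (γ * z) := by rw [hM]; gcongr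
      _ = M * I / γ * (Real.exp (-(γ * z)) * Real.exp (γ * z)) := by ring
      _ = M * I / γ := by rw [← Real.exp_add]; simp
  have hMz : M = 0 := by
    rw [le_div_iff₀ hγ0] at hMle
    nlinarith
  have := hfM a ⟨le_rfl, ha⟩
  rw [hMz, zero_mul] at this
  exact norm_le_zero_iff.1 this

end SolvesSchrodinger

namespace IsAmplitude

variable {q : ℝ → ℝ} {κ : ℂ} {m n : ℝ → ℂ}

lemma hasDerivAt_exp_mul (h : IsAmplitude q κ m n) (x : ℝ) :
    HasDerivAt (fun x : ℝ => Complex.exp (Complex.I * κ * x) * m x)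
      (Complex.exp (Complex.I * κ * x) * (Complex.I * κ * m x + n x)) x := by
  have h1 : HasDerivAt (fun x : ℝ => Complex.I * κ * x) (Complex.I * κ) x := by
    simpa using (Complex.ofRealCLM.hasDerivAt (x := x)).const_mul (Complex.I * κ)
  exact (h1.cexp.mul (h.hasDerivAt x)).congr_deriv (by ring)

lemma isJost (hq : LocallyIntegrable q volume) (h : IsAmplitude q κ m n) :
    IsJost q κ atTop (fun x => Complex.exp (Complex.I * κ * x) * m x) := by
  have hd (x : ℝ) : deriv (fun x : ℝ => Complex.exp (Complex.I * κ * x) * m x) x =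
      Complex.exp (Complex.I * κ * x) * (Complex.I * κ * m x + n x) := (h.hasDerivAt_exp_mul x).deriv
  have hmc : Continuous m := continuous_iff_continuousAt.2 fun x => (h.hasDerivAt x).continuousAt
  have hloc : LocallyIntegrable
      (fun t : ℝ => -(Complex.exp (2 * Complex.I * κ * t) * (q t * m t))) volume := by
    have := SolvesSchrodinger.locallyIntegrable (E := 0) hq
      (f := fun t : ℝ => Complex.exp (2 * Complex.I * κ * t) * m t) (by fun_prop)
    refine this.congr (.of_forall fun t => ?_)
    ring
  have hN := continuous_of_sub_eq_integral
    (F := fun y : ℝ => Complex.exp (2 * Complex.I * κ * y) * n y) hloc h.sub_eq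
  have hnc : Continuous n := by
    have : n = fun y : ℝ => Complex.exp (-(2 * Complex.I * κ * y))
        * (Complex.exp (2 * Complex.I * κ * y) * n y) := by
      ext y
      rw [← mul_assoc, ← Complex.exp_add]
      simp
    rw [this]
    fun_prop
  have hG (x : ℝ) : HasDerivAt (fun x : ℝ => Complex.exp (-(Complex.I * κ * x)))
      (-(Complex.I * κ) * Complex.exp (-(Complex.I * κ * x))) x := by
    have h1 : HasDerivAt (fun x : ℝ => -(Complex.I * κ * x)) (-(Complex.I * κ)) x := by
      exact ((Complex.ofRealCLM.hasDerivAt (x := x)).const_mul (Complex.I * κ)).neg.congr_deriv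
        (by simp)
    exact h1.cexp.congr_deriv (by ring)
  refine ⟨⟨fun x => (h.hasDerivAt_exp_mul x).differentiableAt, fun x y => ?_⟩, ?_⟩
  · have h1 := mul_sub_mul_eq_integral hloc h.sub_eq hG (by fun_prop) x y
    have h2 := intervalIntegral.integral_eq_sub_of_hasDerivAt (a := x) (b := y)
      (fun t _ => (h.hasDerivAt_exp_mul t).const_mul (Complex.I * κ))
      (Continuous.intervalIntegrable (by fun_prop) _ _)
    have e1 (t : ℝ) : Complex.exp (2 * Complex.I * κ * t) * Complex.exp (-(Complex.I * κ * t))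
        = Complex.exp (Complex.I * κ * t) := by
      rw [← Complex.exp_add]
      congr 1
      ring
    have h3 : ∀ t : ℝ, -((q t : ℂ) + κ ^ 2) * (Complex.exp (Complex.I * κ * t) * m t)
        = (-(Complex.exp (2 * Complex.I * κ * t) * (q t * m t))
            * Complex.exp (-(Complex.I * κ * t))
          + Complex.exp (2 * Complex.I * κ * t) * n t
            * (-(Complex.I * κ) * Complex.exp (-(Complex.I * κ * t))))
          + Complex.I * κ * (Complex.exp (Complex.I * κ * t) * (Complex.I * κ * m t + n t)) := by
      intro t
      rw [← e1 t]
      ring_nf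
      rw [Complex.I_sq]
      ring
    have hi1 : IntervalIntegrable (fun t : ℝ =>
        -(Complex.exp (2 * Complex.I * κ * t) * (q t * m t)) * Complex.exp (-(Complex.I * κ * t))
          + Complex.exp (2 * Complex.I * κ * t) * n t
            * (-(Complex.I * κ) * Complex.exp (-(Complex.I * κ * t)))) volume x y := by
      refine IntervalIntegrable.add ?_ (Continuous.intervalIntegrable (by fun_prop) _ _)
      exact ((hloc.integrableOn_isCompact isCompact_uIcc).intervalIntegrable).mul_continuousOn
        (Continuous.continuousOn (by fun_prop))
    simp only [h3]
    rw [intervalIntegral.integral_add hi1 (Continuous.intervalIntegrable (by fun_prop) _ _), ← h1,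
      h2, hd, hd]
    linear_combination (-n y) * e1 y + n x * e1 x
  · refine h.tendsto_one.congr fun x => ?_
    rw [mul_right_comm, ← Complex.exp_add]
    simp

end IsAmplitude

/-! ### Uniqueness, conjugation and reflection of Jost solutions -/

/-- If the derivative of a function with a limit at `+∞` is `C exp (-2iκx) (1 + o(1))` with
`Im κ ≥ 0`, then `C = 0`: the increments over `[x, x + δ]`, divided by `exp (-2iκx)`, tend both to
`0` and to `C ∫₀^δ exp (-2iκs) ds`. -/
lemma eq_zero_of_tendsto_of_deriv {κ C L : ℂ} (hκ : κ ∈ uhp) {y ρ : ℝ → ℂ} {X : ℝ}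
    (hy : Tendsto y atTop (𝓝 L)) (hρ : Tendsto ρ atTop (𝓝 1)) (hρc : ContinuousOn ρ (Set.Ici X))
    (hd : ∀ x ≥ X, HasDerivAt y (C * Complex.exp (-(2 * Complex.I * κ * x)) * ρ x) x) : C = 0 := by
  set ω : ℂ := 2 * Complex.I * κ with hω
  have hint : ∀ δ : ℝ, 0 < δ → ∫ s in (0 : ℝ)..δ, C * Complex.exp (-(ω * s)) = 0 := by
    intro δ hδ
    have h1 : Tendsto (fun x : ℝ => ∫ s in (0 : ℝ)..δ, C * Complex.exp (-(ω * s)) * ρ (x + s)) atTop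
        (𝓝 (∫ s in (0 : ℝ)..δ, C * Complex.exp (-(ω * s)))) := by
      obtain ⟨X', hX'⟩ := eventually_atTop.1
        ((hρ.norm).eventually (gt_mem_nhds (show ‖(1 : ℂ)‖ < 2 by norm_num)))
      refine intervalIntegral.tendsto_integral_filter_of_dominated_convergence
        (fun s => ‖C * Complex.exp (-(ω * s))‖ * 2) ?_ ?_ ?_ ?_
      · filter_upwards [eventually_ge_atTop X] with x hx
        refine ContinuousOn.aestronglyMeasurable ?_ measurableSet_uIoc
        refine ContinuousOn.mul (Continuous.continuousOn (by fun_prop)) ?_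
        refine hρc.comp (Continuous.continuousOn (by fun_prop)) fun s hs => ?_
        rw [Set.uIoc_of_le hδ.le] at hs
        exact hx.trans (by linarith [hs.1])
      · filter_upwards [eventually_ge_atTop X'] with x hx
        refine .of_forall fun s hs => ?_
        rw [Set.uIoc_of_le hδ.le] at hs
        rw [norm_mul]
        gcongr
        exact (hX' (x + s) (by linarith [hs.1])).le
      · exact Continuous.intervalIntegrable (by fun_prop) _ _
      · refine .of_forall fun s hs => ?_
        have := (hρ.comp (tendsto_atTop_add_const_right atTop s tendsto_id)).const_mul
          (C * Complex.exp (-(ω * s)))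
        simpa using this
    have h2 : Tendsto (fun x : ℝ => ∫ s in (0 : ℝ)..δ, C * Complex.exp (-(ω * s)) * ρ (x + s)) atTop
        (𝓝 0) := by
      have h3 : Tendsto (fun x => y (x + δ) - y x) atTop (𝓝 0) := by
        simpa using (hy.comp (tendsto_atTop_add_const_right atTop δ tendsto_id)).sub hy
      refine squeeze_zero_norm' ?_ (by simpa using h3.norm)
      filter_upwards [eventually_ge_atTop X, eventually_ge_atTop 0] with x hx hx0
      have e : ∫ t in x..(x + δ), C * Complex.exp (-(ω * t)) * ρ t = y (x + δ) - y x := by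
        refine intervalIntegral.integral_eq_sub_of_hasDerivAt (fun t ht => hd t ?_) ?_
        · rw [Set.uIcc_of_le (by linarith)] at ht
          exact hx.trans ht.1
        · refine ContinuousOn.intervalIntegrable ?_
          refine ContinuousOn.mul (Continuous.continuousOn (by fun_prop)) (hρc.mono fun t ht => ?_)
          rw [Set.uIcc_of_le (by linarith)] at ht
          exact hx.trans ht.1
      have e2 : ∫ s in (0 : ℝ)..δ, C * Complex.exp (-(ω * s)) * ρ (x + s)
          = Complex.exp (ω * x) * (y (x + δ) - y x) := by
        rw [← e, ← intervalIntegral.integral_const_mul]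
        have := intervalIntegral.integral_comp_add_left (a := 0) (b := δ) (fun t : ℝ =>
          Complex.exp (ω * x) * (C * Complex.exp (-(ω * t)) * ρ t)) x
        rw [add_zero] at this
        rw [← this]
        congr 1 with s
        have e3 : Complex.exp (-(ω * s))
            = Complex.exp (ω * x) * Complex.exp (-(ω * ((x + s : ℝ) : ℂ))) := by
          rw [← Complex.exp_add]
          congr 1
          push_cast
          ring
        rw [e3]
        ring
      rw [e2, norm_mul]
      exact mul_le_of_le_one_left (norm_nonneg _) (norm_exp_le_one hκ hx0)
    exact tendsto_nhds_unique h1 h2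
  have hd1 : HasDerivAt (fun δ : ℝ => ∫ s in (0 : ℝ)..δ, C * Complex.exp (-(ω * s)))
      (C * Complex.exp (-(ω * (1 : ℝ)))) 1 := by
    have hc : Continuous fun s : ℝ => C * Complex.exp (-(ω * s)) := by fun_prop
    exact intervalIntegral.integral_hasDerivAt_right (hc.intervalIntegrable _ _)
      (hc.stronglyMeasurableAtFilter _ _) hc.continuousAt
  have hd2 : HasDerivAt (fun δ : ℝ => ∫ s in (0 : ℝ)..δ, C * Complex.exp (-(ω * s))) 0 1 := by
    refine (hasDerivAt_const (1 : ℝ) (0 : ℂ)).congr_of_eventuallyEq ?_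
    filter_upwards [lt_mem_nhds one_pos] with δ hδ using hint δ hδ
  have := hd1.unique hd2
  simpa [Complex.exp_ne_zero] using this

/-- Uniqueness of the Jost solution at `+∞`: the quotient of two of them has derivative `W / f²`,
where the Wronskian `W` is constant, hence zero. -/
lemma IsAmplitude.eq_of_isJost {q : ℝ → ℝ} {κ : ℂ} {m n g : ℝ → ℂ} (hκ : κ ∈ uhp)
    (hq : LocallyIntegrable q volume) (h : IsAmplitude q κ m n) (hg : IsJost q κ atTop g) :
    g = fun x : ℝ => Complex.exp (Complex.I * κ * x) * m x := by
  have hF := h.isJost hq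
  set F : ℝ → ℂ := fun x : ℝ => Complex.exp (Complex.I * κ * x) * m x with hFdef
  have hmc : Continuous m := continuous_iff_continuousAt.2 fun x => (h.hasDerivAt x).continuousAt
  obtain ⟨X, hX⟩ := eventually_atTop.1
    (h.tendsto_one.eventually (isOpen_ne.mem_nhds (one_ne_zero (α := ℂ))))
  have hF0 : ∀ x ≥ X, F x ≠ 0 := fun x hx => mul_ne_zero (Complex.exp_ne_zero _) (hX x hx)
  have hW := fun x => hF.1.wronskian_const hq hg.1 0 x
  set C := F 0 * deriv g 0 - deriv F 0 * g 0 with hC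
  have hy : Tendsto (fun x => g x / F x) atTop (𝓝 1) := by
    have := hg.2.div hF.2 one_ne_zero
    rw [div_one] at this
    refine this.congr fun x => ?_
    exact mul_div_mul_right _ _ (Complex.exp_ne_zero _)
  have hderiv : ∀ x ≥ X, HasDerivAt (fun x => g x / F x)
      (C * Complex.exp (-(2 * Complex.I * κ * x)) * (m x ^ 2)⁻¹) x := fun x hx => by
    refine ((hg.1.1 x).hasDerivAt.div (hF.1.1 x).hasDerivAt (hF0 x hx)).congr_deriv ?_
    have e : deriv g x * F x - g x * deriv F x = C := by rw [← hW x]; ring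
    have e2 : F x ^ 2 = (Complex.exp (-(2 * Complex.I * κ * x)))⁻¹ * m x ^ 2 := by
      rw [hFdef]
      simp only
      rw [mul_pow, ← Complex.exp_nat_mul, ← Complex.exp_neg]
      congr 2
      push_cast
      ring
    rw [e, e2, div_eq_mul_inv, mul_inv, inv_inv, ← mul_assoc]
  have hC0 : C = 0 := by
    refine eq_zero_of_tendsto_of_deriv hκ hy (ρ := fun x => (m x ^ 2)⁻¹) (X := X) ?_ ?_ hderiv
    · simpa using (h.tendsto_one.pow 2).inv₀ (by norm_num)
    · exact ContinuousOn.inv₀ (Continuous.continuousOn (by fun_prop))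
        fun x hx => pow_ne_zero 2 (hX x hx)
  have hconst : ∀ x ≥ X, g x = F x := by
    have hc : ∀ x ≥ X, g x / F x = g X / F X := fun x hx => by
      refine (convex_Ici X).is_const_of_fderivWithin_eq_zero (𝕜 := ℝ) (f := fun x => g x / F x)
        (fun z hz => (hderiv z hz).differentiableAt.differentiableWithinAt) (fun z hz => ?_) hx
        (Set.mem_Ici.2 le_rfl)
      have h1 := (hderiv z hz).hasDerivWithinAt (s := Set.Ici X)
      rw [hC0, zero_mul, zero_mul] at h1
      rw [h1.hasFDerivWithinAt.fderivWithin (uniqueDiffOn_Ici X z hz)]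
      ext
      simp
    have h1 : g X / F X = 1 := by
      refine tendsto_nhds_unique (tendsto_const_nhds.congr' ?_) hy
      filter_upwards [eventually_ge_atTop X] with x hx using (hc x hx).symm
    intro x hx
    have := hc x hx
    rw [h1, div_eq_one_iff_eq (hF0 x hx)] at this
    exact this
  have hsub := hg.1.sub hq hF.1
  ext x
  rcases le_total X x with hx | hx
  · exact hconst x hx
  · refine sub_eq_zero.1 (hsub.eq_zero_of_cauchy hq (X := X + 1) ?_ ?_ (by linarith))
    · exact sub_eq_zero.2 (hconst _ (by linarith))
    · have : (fun x => g x - F x) =ᶠ[𝓝 (X + 1)] fun _ => 0 := by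
        filter_upwards [lt_mem_nhds (show X < X + 1 by linarith)] with z hz
        exact sub_eq_zero.2 (hconst z hz.le)
      rw [this.deriv_eq, deriv_const]

namespace IsJostPotential

variable {k : ℕ} {q : ℝ → ℝ} {κ : ℂ}

lemma isJost_jost (hq : IsJostPotential k q) (hκ : κ ∈ uhp) :
    IsJost q κ atTop (jost q κ atTop) := by
  obtain ⟨M, N, -, -, h⟩ := hq.exists_amplitude
  obtain ⟨m, n, hmn, -⟩ := h κ hκ
  exact Classical.epsilon_spec ⟨_, hmn.isJost hq.locallyIntegrable⟩

lemma jost_unique (hq : IsJostPotential k q) (hκ : κ ∈ uhp) {g : ℝ → ℂ}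
    (hg : IsJost q κ atTop g) : g = jost q κ atTop := by
  obtain ⟨M, N, -, -, h⟩ := hq.exists_amplitude
  obtain ⟨m, n, hmn, -⟩ := h κ hκ
  rw [hmn.eq_of_isJost hκ hq.locallyIntegrable hg,
    hmn.eq_of_isJost hκ hq.locallyIntegrable (hq.isJost_jost hκ)]

/-- The Cauchy data at the origin of the Jost solution are `C^k` in the spectral parameter, on the
closed upper half-plane. -/
theorem contDiffOn_jost (hq : IsJostPotential k q) :
    ContDiffOn ℂ k (fun κ => jost q κ atTop 0) uhp ∧
    ContDiffOn ℂ k (fun κ => deriv (jost q κ atTop) 0) uhp := by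
  obtain ⟨M, N, hM, hN, h⟩ := hq.exists_amplitude
  have hκ : ContDiffOn ℂ k (fun κ : ℂ => Complex.I * κ) uhp :=
    (contDiff_const.mul contDiff_id).contDiffOn
  refine ⟨hM.congr fun κ hκ => ?_, ((hκ.mul hM).add hN).congr fun κ hκ => ?_⟩
  · obtain ⟨m, n, hmn, h0, -⟩ := h κ hκ
    rw [hmn.eq_of_isJost hκ hq.locallyIntegrable (hq.isJost_jost hκ)]
    simp [h0]
  · obtain ⟨m, n, hmn, h0, h1⟩ := h κ hκ
    rw [hmn.eq_of_isJost hκ hq.locallyIntegrable (hq.isJost_jost hκ),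
      (hmn.hasDerivAt_exp_mul 0).deriv]
    simp [h0, h1]

end IsJostPotential

lemma hasDerivAt_conj {f : ℝ → ℂ} {f' : ℂ} {x : ℝ} (hf : HasDerivAt f f' x) :
    HasDerivAt (fun x => conj (f x)) (conj f') x :=
  (Complex.conjCLE : ℂ ≃L[ℝ] ℂ).hasFDerivAt.comp_hasDerivAt x hf

lemma neg_conj_mem_uhp {κ : ℂ} (hκ : κ ∈ uhp) : -conj κ ∈ uhp := by
  have : 0 ≤ κ.im := hκ
  change 0 ≤ (-conj κ).im
  simpa

lemma SolvesSchrodinger.conj {q : ℝ → ℝ} {E : ℂ} {f : ℝ → ℂ} (hf : SolvesSchrodinger q E f) :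
    SolvesSchrodinger q (conj E) (fun x => conj (f x)) := by
  have hd (x : ℝ) := hasDerivAt_conj (hf.1 x).hasDerivAt
  refine ⟨fun x => (hd x).differentiableAt, fun x y => ?_⟩
  rw [(hd x).deriv, (hd y).deriv, ← map_sub, hf.2, ← intervalIntegral.intervalIntegral_conj]
  simp

lemma IsJost.conj {q : ℝ → ℝ} {κ : ℂ} {l : Filter ℝ} {f : ℝ → ℂ} (hf : IsJost q κ l f) :
    IsJost q (-conj κ) l (fun x => conj (f x)) := by
  refine ⟨by simpa using hf.1.conj, ?_⟩
  have := (Complex.continuous_conj.tendsto _).comp hf.2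
  rw [map_one] at this
  refine this.congr fun x => ?_
  simp [← Complex.exp_conj]

namespace IsJostPotential

variable {k : ℕ} {q : ℝ → ℝ} {κ : ℂ}

lemma jost_neg_conj (hq : IsJostPotential k q) (hκ : κ ∈ uhp) :
    jost q (-conj κ) atTop = fun x => conj (jost q κ atTop x) :=
  (hq.jost_unique (neg_conj_mem_uhp hκ) (hq.isJost_jost hκ).conj).symm

lemma deriv_jost_neg_conj (hq : IsJostPotential k q) (hκ : κ ∈ uhp) :
    deriv (jost q (-conj κ) atTop) 0 = conj (deriv (jost q κ atTop) 0) := by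
  rw [hq.jost_neg_conj hκ]
  exact (hasDerivAt_conj ((hq.isJost_jost hκ).1.1 0).hasDerivAt).deriv

/-- The Wronskian of a Jost solution with real spectral parameter and its complex conjugate,
computed from the asymptotics at `+∞`. -/
theorem wronskian_conj (hq : IsJostPotential k q) (s : ℝ) :
    jost q s atTop 0 * conj (deriv (jost q s atTop) 0)
      - deriv (jost q s atTop) 0 * conj (jost q s atTop 0) = -(2 * Complex.I * s) := by
  have hs : (s : ℂ) ∈ uhp := by change 0 ≤ (s : ℂ).im; simp
  have hql := hq.locallyIntegrable
  obtain ⟨M, N, -, -, h⟩ := hq.exists_amplitude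
  obtain ⟨m, n, hmn, -⟩ := h s hs
  have hJ := hq.isJost_jost hs
  have hJc : SolvesSchrodinger q ((s : ℂ) ^ 2) (fun x => conj (jost q s atTop x)) := by
    simpa using hJ.1.conj
  have hd (x : ℝ) : deriv (fun x => conj (jost q s atTop x)) x = conj (deriv (jost q s atTop) x) :=
    (hasDerivAt_conj (hJ.1.1 x).hasDerivAt).deriv
  have hW (x : ℝ) := hJ.1.wronskian_const hql hJc 0 x
  simp only [hd] at hW
  rw [hmn.eq_of_isJost hs hql hJ] at hW ⊢
  have hlim : Tendsto (fun x => m x * conj (Complex.I * s * m x + n x)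
      - (Complex.I * s * m x + n x) * conj (m x)) atTop
      (𝓝 (1 * conj (Complex.I * s * 1 + 0) - (Complex.I * s * 1 + 0) * conj 1)) := by
    have h1 := (hmn.tendsto_one.const_mul (Complex.I * s)).add hmn.tendsto_zero
    exact (hmn.tendsto_one.mul ((Complex.continuous_conj.tendsto _).comp h1)).sub
      (h1.mul ((Complex.continuous_conj.tendsto _).comp hmn.tendsto_one))
  refine (tendsto_nhds_unique (tendsto_const_nhds.congr fun x => ?_) hlim).trans ?_
  · rw [← hW x, (hmn.hasDerivAt_exp_mul x).deriv]
    have e : Complex.exp (Complex.I * s * x) * conj (Complex.exp (Complex.I * s * x)) = 1 := by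
      rw [← Complex.exp_conj, ← Complex.exp_add]
      simp
    simp only [map_mul, map_add]
    linear_combination (m x * (conj Complex.I * conj (s : ℂ) * conj (m x) + conj (n x)) -
      (Complex.I * s * m x + n x) * conj (m x)) * e
  · simp
    ring

end IsJostPotential

/-- Reflection `x ↦ -x` exchanges the two ends of the line. -/
lemma IsJost.comp_neg {q : ℝ → ℝ} {κ : ℂ} {l : Filter ℝ} {f : ℝ → ℂ} (hf : IsJost q κ l f) :
    IsJost (fun x => q (-x)) (-κ) (map Neg.neg l) (fun x => f (-x)) := by
  have hd (x : ℝ) : HasDerivAt (fun x => f (-x)) (-deriv f (-x)) x := by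
    exact ((hf.1.1 (-x)).hasDerivAt.scomp x (hasDerivAt_neg x)).congr_deriv (by simp)
  refine ⟨⟨fun x => (hd x).differentiableAt, fun x y => ?_⟩, ?_⟩
  · have := hf.1.2 (-y) (-x)
    rw [(hd x).deriv, (hd y).deriv, intervalIntegral.integral_comp_neg
      (fun t => -((q t : ℂ) + (-κ) ^ 2) * f t), neg_sq, ← this]
    ring
  · rw [tendsto_map'_iff]
    refine hf.2.congr fun x => ?_
    simp

/-- The Jost solution at `-∞` is the reflection of one at `+∞`. -/
lemma IsJostPotential.jost_atBot {k : ℕ} {q : ℝ → ℝ} {κ : ℂ}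
    (hq : IsJostPotential k fun x => q (-x)) (hκ : -κ ∈ uhp) :
    jost q κ atBot = fun x => jost (fun x => q (-x)) (-κ) atTop (-x) := by
  have hex := (hq.isJost_jost hκ).comp_neg
  simp only [neg_neg] at hex
  rw [show map (Neg.neg : ℝ → ℝ) atTop = atBot from map_neg_atTop] at hex
  have hJ : IsJost q κ atBot (jost q κ atBot) := Classical.epsilon_spec ⟨_, hex⟩
  have h1 := hJ.comp_neg
  rw [show map (Neg.neg : ℝ → ℝ) atBot = atTop from map_neg_atBot] at h1
  rw [← hq.jost_unique hκ h1]
  simp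

lemma IsJostPotential.deriv_jost_atBot {k : ℕ} {q : ℝ → ℝ} {κ : ℂ}
    (hq : IsJostPotential k fun x => q (-x)) (hκ : -κ ∈ uhp) :
    deriv (jost q κ atBot) 0 = -deriv (jost (fun x => q (-x)) (-κ) atTop) 0 := by
  rw [hq.jost_atBot hκ, deriv_comp_neg, neg_zero]

/-! ### The function `λ` on the real line, and expansions in powers of a function -/

lemma ofReal_mem_uhp (s : ℝ) : (s : ℂ) ∈ uhp := by
  change 0 ≤ (s : ℂ).im
  simp

/-- The boundary value on the real line, from the upper half-plane, of the square root. -/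
def upperSqrt (x : ℝ) : ℂ := (x : ℂ) ^ (1 / 2 : ℂ)

lemma upperSqrt_of_nonneg {x : ℝ} (hx : 0 ≤ x) : upperSqrt x = Real.sqrt x := by
  rw [upperSqrt, Real.sqrt_eq_rpow, Complex.ofReal_cpow hx]
  norm_num

lemma upperSqrt_of_nonpos {x : ℝ} (hx : x ≤ 0) : upperSqrt x = Complex.I * Real.sqrt (-x) := by
  have h := upperSqrt_of_nonneg (neg_nonneg.2 hx)
  have e : (Real.pi : ℂ) * Complex.I * (1 / 2) = Real.pi / 2 * Complex.I := by ring
  rw [upperSqrt, Complex.ofReal_cpow_of_nonpos hx, e, Complex.exp_pi_div_two_mul_I, ← h, upperSqrt]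
  push_cast
  ring

lemma norm_upperSqrt (x : ℝ) : ‖upperSqrt x‖ = Real.sqrt |x| := by
  rcases le_total 0 x with h | h
  · rw [upperSqrt_of_nonneg h, Complex.norm_real, Real.norm_of_nonneg (Real.sqrt_nonneg _),
      abs_of_nonneg h]
  · rw [upperSqrt_of_nonpos h, norm_mul, Complex.norm_I, one_mul, Complex.norm_real,
      Real.norm_of_nonneg (Real.sqrt_nonneg _), abs_of_nonpos h]

lemma upperSqrt_sq (x : ℝ) : upperSqrt x ^ 2 = x := by
  rw [upperSqrt, ← Complex.cpow_nat_mul]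
  simp

lemma continuous_upperSqrt : Continuous upperSqrt :=
  Complex.continuous_ofReal_cpow_const (by norm_num)

lemma contDiffAt_upperSqrt {n : WithTop ℕ∞} {x : ℝ} (hx : x ≠ 0) : ContDiffAt ℝ n upperSqrt x := by
  rcases lt_or_gt_of_ne hx with h | h
  · have h1 : ContDiffAt ℝ n (fun x : ℝ => Complex.I * (Real.sqrt (-x) : ℂ)) x := by
      refine contDiffAt_const.mul (Complex.ofRealCLM.contDiff.contDiffAt.comp x ?_)
      exact contDiffAt_id.neg.sqrt (by simpa using hx)
    refine h1.congr_of_eventuallyEq ?_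
    filter_upwards [gt_mem_nhds h] with y hy using upperSqrt_of_nonpos hy.le
  · have h1 : ContDiffAt ℝ n (fun x : ℝ => (Real.sqrt x : ℂ)) x :=
      Complex.ofRealCLM.contDiff.contDiffAt.comp x (contDiffAt_id.sqrt hx)
    refine h1.congr_of_eventuallyEq ?_
    filter_upwards [lt_mem_nhds h] with y hy using upperSqrt_of_nonneg hy.le

lemma cpow_half_mem_quadrant {z : ℂ} (hz : z ∈ uhp) :
    0 ≤ (z ^ (1 / 2 : ℂ)).re ∧ 0 ≤ (z ^ (1 / 2 : ℂ)).im := by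
  rcases eq_or_ne z 0 with rfl | h0
  · simp
  have h1 : 0 ≤ Complex.arg z := Complex.arg_nonneg_iff.2 hz
  have h2 := Complex.arg_le_pi z
  have e : (Complex.log z * (1 / 2)).im = Complex.arg z / 2 := by
    rw [show (1 / 2 : ℂ) = ((1 / 2 : ℝ) : ℂ) by norm_num, Complex.im_mul_ofReal, Complex.log_im]
    ring
  rw [Complex.cpow_def_of_ne_zero h0, Complex.exp_re, Complex.exp_im, e]
  refine ⟨mul_nonneg (Real.exp_pos _).le (Real.cos_nonneg_of_mem_Icc ⟨?_, ?_⟩),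
    mul_nonneg (Real.exp_pos _).le (Real.sin_nonneg_of_nonneg_of_le_pi ?_ ?_)⟩ <;>
  linarith [Real.pi_pos]

lemma continuousOn_cpow_half : ContinuousOn (fun z : ℂ => z ^ (1 / 2 : ℂ)) uhp := by
  intro z hz
  rcases eq_or_ne z 0 with rfl | h0
  · exact (Complex.continuousAt_cpow_const_of_re_pos (by simp) (by norm_num)).continuousWithinAt
  by_cases hs : z ∈ Complex.slitPlane
  · exact (continuousAt_cpow_const hs).continuousWithinAt
  rw [Complex.mem_slitPlane_iff, not_or, not_lt, not_not] at hs
  have hre : z.re < 0 := lt_of_le_of_ne hs.1 fun h => h0 (Complex.ext h hs.2)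
  have h1 := Complex.continuousWithinAt_log_of_re_neg_of_im_zero hre hs.2
  have h2 : ContinuousWithinAt (fun z => Complex.exp (Complex.log z * (1 / 2))) uhp z :=
    (h1.mul_const _).cexp
  refine h2.congr_of_eventuallyEq ?_ (Complex.cpow_def_of_ne_zero h0 _)
  filter_upwards [mem_nhdsWithin_of_mem_nhds (isOpen_ne.mem_nhds h0)] with w hw
  exact Complex.cpow_def_of_ne_zero hw _

lemma sub_ofReal_mem_uhp {z : ℂ} (hz : z ∈ uhp) (c : ℝ) : z - c ∈ uhp := by
  have : 0 ≤ z.im := hz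
  change 0 ≤ (z - c).im
  simpa

lemma add_ofReal_mem_uhp {z : ℂ} (hz : z ∈ uhp) (c : ℝ) : z + c ∈ uhp := by
  have : 0 ≤ z.im := hz
  change 0 ≤ (z + c).im
  simpa

lemma lam_mem_uhp (c : ℝ) {z : ℂ} (hz : z ∈ uhp) : lam c z ∈ uhp := by
  obtain ⟨h1, h2⟩ := cpow_half_mem_quadrant (sub_ofReal_mem_uhp hz c)
  obtain ⟨h3, h4⟩ := cpow_half_mem_quadrant (add_ofReal_mem_uhp hz c)
  change 0 ≤ (lam c z).im
  rw [lam, Complex.mul_im]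
  positivity

lemma continuousOn_lam (c : ℝ) : ContinuousOn (lam c) uhp :=
  (continuousOn_cpow_half.comp (by fun_prop) fun _ hz => sub_ofReal_mem_uhp hz c).mul
    (continuousOn_cpow_half.comp (by fun_prop) fun _ hz => add_ofReal_mem_uhp hz c)

lemma lam_ofReal (c s : ℝ) : lam c s = upperSqrt (s - c) * upperSqrt (s + c) := by
  simp [lam, upperSqrt]

lemma continuous_lam_ofReal (c : ℝ) : Continuous fun s : ℝ => lam c s := by
  simp only [lam_ofReal]
  have := continuous_upperSqrt
  fun_prop

lemma contDiffAt_lam_ofReal {n : WithTop ℕ∞} {c s : ℝ} (h1 : s ≠ c) (h2 : s ≠ -c) :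
    ContDiffAt ℝ n (fun s : ℝ => lam c s) s := by
  simp only [lam_ofReal]
  refine ContDiffAt.mul ?_ ?_
  · exact (contDiffAt_upperSqrt (sub_ne_zero.2 h1)).comp s (contDiffAt_id.sub contDiffAt_const)
  · refine (contDiffAt_upperSqrt ?_).comp s (contDiffAt_id.add contDiffAt_const)
    exact fun h => h2 (eq_neg_of_add_eq_zero_left h)

lemma lam_sq_ofReal (c s : ℝ) : lam c s ^ 2 = ((s ^ 2 - c ^ 2 : ℝ) : ℂ) := by
  rw [lam_ofReal, mul_pow, upperSqrt_sq, upperSqrt_sq]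
  push_cast
  ring

lemma lam_of_abs_le {c s : ℝ} (h : |s| ≤ c) : lam c s = Complex.I * Real.sqrt (c ^ 2 - s ^ 2) := by
  obtain ⟨h1, h2⟩ := abs_le.1 h
  rw [lam_ofReal, upperSqrt_of_nonpos (by linarith), upperSqrt_of_nonneg (by linarith), mul_assoc,
    ← Complex.ofReal_mul, ← Real.sqrt_mul (by linarith)]
  congr 3
  ring

lemma lam_of_lt {c s : ℝ} (hc : 0 < c) (h : c < s) : lam c s = Real.sqrt (s ^ 2 - c ^ 2) := by
  rw [lam_ofReal, upperSqrt_of_nonneg (by linarith), upperSqrt_of_nonneg (by linarith),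
    ← Complex.ofReal_mul, ← Real.sqrt_mul (by linarith)]
  congr 2
  ring

lemma lam_of_lt_neg {c s : ℝ} (hc : 0 < c) (h : s < -c) :
    lam c s = -(Real.sqrt (s ^ 2 - c ^ 2) : ℂ) := by
  have e : s ^ 2 - c ^ 2 = -(s - c) * -(s + c) := by ring
  rw [lam_ofReal, upperSqrt_of_nonpos (by linarith), upperSqrt_of_nonpos (by linarith), e,
    Real.sqrt_mul (by linarith)]
  push_cast
  linear_combination (Real.sqrt (-(s - c)) : ℂ) * Real.sqrt (-(s + c)) * Complex.I_mul_I

/-- Off the cut, `λ(s)` is real, with the sign of `s`. -/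
lemma exists_lam_eq_ofReal {c s : ℝ} (hc : 0 < c) (h : c ≤ |s|) :
    ∃ l : ℝ, lam c s = l ∧ 0 ≤ l * s := by
  rcases h.eq_or_lt with h | h
  · exact ⟨0, by rw [lam_of_abs_le h.ge, ← sq_abs s, ← h]; simp, by simp⟩
  rcases lt_abs.1 h with h | h
  · exact ⟨_, lam_of_lt hc h, mul_nonneg (Real.sqrt_nonneg _) (by linarith)⟩
  · refine ⟨-Real.sqrt (s ^ 2 - c ^ 2), by rw [lam_of_lt_neg hc (by linarith)]; simp, ?_⟩
    nlinarith [Real.sqrt_nonneg (s ^ 2 - c ^ 2)]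

lemma lam_neg_ofReal {c : ℝ} (hc : 0 < c) (s : ℝ) : lam c ((-s : ℝ) : ℂ) = -conj (lam c s) := by
  rcases le_or_gt |s| c with h | h
  · rw [lam_of_abs_le h, lam_of_abs_le (by rwa [abs_neg])]
    simp
  · rcases lt_abs.1 h with h | h
    · rw [lam_of_lt hc h, lam_of_lt_neg hc (by linarith)]
      simp
    · rw [lam_of_lt_neg hc (by linarith : s < -c), lam_of_lt hc h]
      simp

lemma lam_ne_zero {c s : ℝ} (hc : 0 < c) (h : |s| ≠ c) : lam c s ≠ 0 := by
  intro h0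
  have := lam_sq_ofReal c s
  rw [h0, zero_pow two_ne_zero, eq_comm, Complex.ofReal_eq_zero, sub_eq_zero, sq_eq_sq_iff_abs_eq_abs,
    abs_of_pos hc] at this
  exact h this

open Polynomial

/-- Taylor's formula with Peano remainder, for a function of a complex variable in a convex set. -/
lemma exists_polynomial_isLittleO {s : Set ℂ} (hs : Convex ℝ s) (hu : UniqueDiffOn ℂ s) {z₀ : ℂ}
    (hz₀ : z₀ ∈ s) (k : ℕ) :
    ∀ F : ℂ → ℂ, ContDiffOn ℂ k F s →
      ∃ p : ℂ[X], (fun z => F z - p.eval (z - z₀)) =o[𝓝[s] z₀] fun z => ‖z - z₀‖ ^ k := by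
  have hprim : ∀ p : ℂ[X], ∃ P : ℂ[X], derivative P = p ∧ P.eval 0 = 0 := by
    intro p
    induction p using Polynomial.induction_on' with
    | add p r hp hr =>
      obtain ⟨P, h1, h2⟩ := hp
      obtain ⟨R, h3, h4⟩ := hr
      exact ⟨P + R, by simp [h1, h3], by simp [h2, h4]⟩
    | monomial n a =>
      refine ⟨monomial (n + 1) (a / (n + 1)), ?_, by simp [eval_monomial]⟩
      rw [derivative_monomial]
      have : (n : ℂ) + 1 ≠ 0 := by exact_mod_cast n.succ_ne_zero
      congr 1
      push_cast
      field_simp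
  induction k with
  | zero =>
    intro F hF
    refine ⟨C (F z₀), ?_⟩
    have h := (hF.continuousOn z₀ hz₀).tendsto.sub_const (F z₀)
    simpa [isLittleO_one_iff] using h
  | succ k ih =>
    intro F hF
    have e : ((k + 1 : ℕ) : WithTop ℕ∞) = (k : WithTop ℕ∞) + 1 := by norm_cast
    rw [e, contDiffOn_succ_iff_derivWithin hu] at hF
    obtain ⟨p, hp⟩ := ih _ hF.2.2
    obtain ⟨P, hP, hP0⟩ := hprim p
    refine ⟨P + C (F z₀), ?_⟩
    have hd : ∀ z ∈ s, HasDerivWithinAt (fun z => F z - P.eval (z - z₀))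
        (derivWithin F s z - p.eval (z - z₀)) s z := fun z hz => by
      have h1 : HasDerivAt (fun z => P.eval (z - z₀)) (p.eval (z - z₀)) z := by
        rw [← hP]
        have h := (P.hasDerivAt (z - z₀)).comp z ((hasDerivAt_id z).sub_const z₀)
        rw [mul_one] at h
        exact h
      exact (hF.1 z hz).hasDerivWithinAt.sub h1.hasDerivWithinAt
    have := hs.isLittleO_pow_succ (n := k) hz₀
      (fun z hz => ((hd z hz).hasFDerivWithinAt).restrictScalars ℝ) ?_
    · refine this.congr_left fun z => ?_
      simp [hP0]
      ring
    · refine hp.norm_left.congr_left (fun z => ?_) |>.of_norm_left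
      simp

/-- `f` has an expansion in powers of `μ`, along the filter `l`, up to `o(μ ^ k)`. -/
def HasExpansion (l : Filter ℝ) (μ : ℝ → ℂ) (k : ℕ) (f : ℝ → ℂ) : Prop :=
  ∃ p : ℂ[X], (fun s => f s - p.eval (μ s)) =o[l] fun s => μ s ^ k

namespace HasExpansion

variable {l : Filter ℝ} {μ f g : ℝ → ℂ} {k : ℕ}

lemma polynomial (p : ℂ[X]) : HasExpansion l μ k fun s => p.eval (μ s) :=
  ⟨p, by simp⟩

lemma congr (hf : HasExpansion l μ k f) (h : ∀ᶠ s in l, f s = g s) : HasExpansion l μ k g := by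
  obtain ⟨p, hp⟩ := hf
  refine ⟨p, hp.congr' ?_ EventuallyEq.rfl⟩
  filter_upwards [h] with s hs
  rw [hs]

lemma add (hf : HasExpansion l μ k f) (hg : HasExpansion l μ k g) :
    HasExpansion l μ k fun s => f s + g s := by
  obtain ⟨p, hp⟩ := hf
  obtain ⟨r, hr⟩ := hg
  exact ⟨p + r, (hp.add hr).congr_left fun s => by rw [eval_add]; ring⟩

lemma tendsto_eval (hμ : Tendsto μ l (𝓝 0)) (p : ℂ[X]) :
    Tendsto (fun s => p.eval (μ s)) l (𝓝 (p.eval 0)) :=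
  (p.continuous.tendsto 0).comp hμ

lemma pow_isBigO_one (hμ : Tendsto μ l (𝓝 0)) :
    (fun s => μ s ^ k) =O[l] fun _ => (1 : ℂ) :=
  (hμ.pow k).isBigO_one ℂ

lemma isBigO_one (hμ : Tendsto μ l (𝓝 0)) (hf : HasExpansion l μ k f) :
    f =O[l] fun _ => (1 : ℂ) := by
  obtain ⟨p, hp⟩ := hf
  have h1 : (fun s => f s - p.eval (μ s)) =O[l] fun _ => (1 : ℂ) :=
    hp.isBigO.trans (pow_isBigO_one hμ)
  have h2 := h1.add ((tendsto_eval hμ p).isBigO_one ℂ)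
  exact h2.congr_left fun s => by ring

lemma mul (hμ : Tendsto μ l (𝓝 0)) (hf : HasExpansion l μ k f) (hg : HasExpansion l μ k g) :
    HasExpansion l μ k fun s => f s * g s := by
  have hgO := hg.isBigO_one hμ
  obtain ⟨p, hp⟩ := hf
  obtain ⟨r, hr⟩ := hg
  refine ⟨p * r, ?_⟩
  have h1 := hp.mul_isBigO hgO
  have h2 := ((tendsto_eval hμ p).isBigO_one ℂ).mul_isLittleO hr
  refine ((h1.congr_right fun s => mul_one _).add (h2.congr_right fun s => one_mul _)).congr_left
    fun s => ?_
  rw [eval_mul]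
  ring

lemma neg (hf : HasExpansion l μ k f) : HasExpansion l μ k fun s => -f s := by
  obtain ⟨p, hp⟩ := hf
  exact ⟨-p, hp.neg_left.congr_left fun s => by rw [eval_neg]; ring⟩

/-- The reciprocal: the polynomial of `1 / f` inverts that of `f` modulo `X ^ (k + 1)`. -/
lemma inv (hμ : Tendsto μ l (𝓝 0)) (hf : HasExpansion l μ k f) {L : ℂ} (hfL : Tendsto f l (𝓝 L))
    (hL : L ≠ 0) (hl : l.NeBot) : HasExpansion l μ k fun s => (f s)⁻¹ := by
  obtain ⟨p, hp⟩ := hf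
  have hp0 : p.eval 0 ≠ 0 ∨ k = 0 := by
    by_contra! h
    obtain ⟨h1, h2⟩ := h
    have h3 : Tendsto (fun s => f s - p.eval (μ s)) l (𝓝 0) := by
      refine hp.trans_tendsto ?_
      simpa [h2] using hμ.pow k
    have h4 := hfL.sub (tendsto_eval hμ p)
    rw [h1, sub_zero] at h4
    exact hL (tendsto_nhds_unique h4 h3)
  rcases hp0 with hp0 | rfl
  · have hcop : IsCoprime p ((X : ℂ[X]) ^ (k + 1)) := by
      refine IsCoprime.pow_right (IsCoprime.symm ?_)
      rw [Polynomial.prime_X.coprime_iff_not_dvd, X_dvd_iff, coeff_zero_eq_eval_zero]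
      exact hp0
    obtain ⟨u, v, huv⟩ := hcop
    refine ⟨u, ?_⟩
    have hO : (fun s => (f s)⁻¹) =O[l] fun _ => (1 : ℂ) := (hfL.inv₀ hL).isBigO_one ℂ
    have h1 : (fun s => v.eval (μ s) * μ s * μ s ^ k) =o[l] fun s => μ s ^ k := by
      have : (fun s => v.eval (μ s) * μ s) =o[l] fun _ => (1 : ℂ) := by
        rw [isLittleO_one_iff]
        simpa using (tendsto_eval hμ v).mul hμ
      simpa using this.mul_isBigO (isBigO_refl (fun s => μ s ^ k) l)
    have h2 : (fun s => u.eval (μ s) * (f s - p.eval (μ s))) =o[l] fun s => μ s ^ k := by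
      simpa using ((tendsto_eval hμ u).isBigO_one ℂ).mul_isLittleO hp
    have h3 := (h1.sub h2).mul_isBigO hO
    refine (h3.congr_right fun s => mul_one _).congr' ?_ EventuallyEq.rfl
    filter_upwards [hfL.eventually (isOpen_ne.mem_nhds hL)] with s hs
    have := congrArg (eval (μ s)) huv
    simp only [eval_add, eval_mul, eval_pow, eval_X, eval_one] at this
    field_simp
    linear_combination this
  · refine ⟨C L⁻¹, ?_⟩
    have := (hfL.inv₀ hL).sub_const L⁻¹
    simpa [isLittleO_one_iff] using this

/-- Composition with a function that has a Taylor expansion at `z₀`. -/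
lemma comp (hμ : Tendsto μ l (𝓝 0)) {s : Set ℂ} (hs : Convex ℝ s) (hu : UniqueDiffOn ℂ s) {z₀ : ℂ}
    (hz₀ : z₀ ∈ s) {F : ℂ → ℂ} (hF : ContDiffOn ℂ k F s) {z : ℝ → ℂ} (hzs : ∀ᶠ t in l, z t ∈ s)
    (hz : HasExpansion l μ k fun t => z t - z₀) (hO : (fun t => z t - z₀) =O[l] μ) :
    HasExpansion l μ k fun t => F (z t) := by
  obtain ⟨p, hp⟩ := exists_polynomial_isLittleO hs hu hz₀ k F hF
  have hz0 : Tendsto z l (𝓝[s] z₀) := by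
    refine tendsto_nhdsWithin_iff.2 ⟨?_, hzs⟩
    simpa using (hO.trans_tendsto hμ).add_const z₀
  have h1 : HasExpansion l μ k fun t => p.eval (z t - z₀) := by
    clear hp
    induction p using Polynomial.induction_on with
    | C a => simpa using polynomial (l := l) (μ := μ) (k := k) (C a)
    | add p r hp hr => simpa using hp.add hr
    | monomial n a h =>
      refine (h.mul hμ hz).congr (.of_forall fun t => ?_)
      simp [pow_succ, mul_assoc]
  have h2 : HasExpansion l μ k fun t => F (z t) - p.eval (z t - z₀) := by
    refine ⟨0, ?_⟩
    have h3 := hp.comp_tendsto hz0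
    have h4 := h3.trans_isBigO ((hO.norm_left.pow k))
    simpa [Function.comp_def] using h4
  exact (h2.add h1).congr (.of_forall fun t => by ring)

/-- The expansion with exactly the powers `0, …, k`. -/
lemma exists_coeff (hμ : Tendsto μ l (𝓝 0)) (hf : HasExpansion l μ k f) :
    ∃ a : ℕ → ℂ, (fun s => f s - ∑ j ∈ Finset.range (k + 1), a j * μ s ^ j) =o[l]
      fun s => μ s ^ k := by
  obtain ⟨p, hp⟩ := hf
  refine ⟨p.coeff, ?_⟩
  have h1 : (fun s => ∑ j ∈ Finset.Ico (k + 1) (p.natDegree + (k + 2)), p.coeff j * μ s ^ j) =o[l]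
      fun s => μ s ^ k := by
    refine IsLittleO.fun_sum fun j hj => ?_
    obtain ⟨i, rfl⟩ := Nat.exists_eq_add_of_le (Finset.mem_Ico.1 hj).1
    have : (fun s => p.coeff (k + 1 + i) * μ s ^ (i + 1)) =o[l] fun _ => (1 : ℂ) := by
      rw [isLittleO_one_iff]
      simpa using (hμ.pow (i + 1)).const_mul (p.coeff (k + 1 + i))
    have h2 := this.mul_isBigO (isBigO_refl (fun s => μ s ^ k) l)
    refine (h2.congr_right fun s => one_mul _).congr_left fun s => ?_
    ring
  refine (hp.add h1).congr_left fun s => ?_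
  rw [eval_eq_sum_range' (n := p.natDegree + (k + 2)) (by omega),
    ← Finset.sum_range_add_sum_Ico _ (show k + 1 ≤ p.natDegree + (k + 2) by omega)]
  ring

end HasExpansion

/-! ### The Wronskian of the two Jost solutions -/

/-- A potential that agrees with `v` on the right half-line, and with `v` up to a constant on the left
half-line, where `v` has `k + 1` moments. -/
lemma isJostPotential_of_step {k : ℕ} {v q : ℝ → ℝ} {a : ℝ}
    (hv : Integrable fun x : ℝ => (1 + |x|) ^ (k + 1) * v x)
    (hpos : ∀ x, 0 < x → q x = v x) (hneg : ∀ x, x < 0 → q x = v x + a) :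
    IsJostPotential k q := by
  have hvm : AEStronglyMeasurable v volume := by
    have h : Continuous fun x : ℝ => ((1 + |x|) ^ (k + 1))⁻¹ :=
      Continuous.inv₀ (by fun_prop) fun x => by positivity
    refine (h.aestronglyMeasurable.mul hv.aestronglyMeasurable).congr (.of_forall fun x => ?_)
    have : (1 + |x|) ^ (k + 1) ≠ 0 := by positivity
    simp [this]
  have hc : Continuous fun x : ℝ => (1 + x ^ 2)⁻¹ :=
    Continuous.inv₀ (by fun_prop) fun x => by positivity
  refine ⟨?_, ?_⟩
  · have h1 : Integrable fun x : ℝ => v x / (1 + x ^ 2) := by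
      refine hv.norm.mono' (hvm.mul hc.aestronglyMeasurable) (.of_forall fun x => ?_)
      rw [norm_div, norm_mul, norm_pow]
      rw [Real.norm_of_nonneg (by positivity : 0 ≤ 1 + x ^ 2),
        Real.norm_of_nonneg (by positivity : 0 ≤ 1 + |x|)]
      refine (div_le_self (norm_nonneg _) (by nlinarith [sq_nonneg x])).trans
        (le_mul_of_one_le_left (norm_nonneg _) (one_le_pow₀ (by linarith [abs_nonneg x])))
    have h2 : Integrable fun x : ℝ => (Set.Iio (0 : ℝ)).indicator (fun x => a * (1 + x ^ 2)⁻¹) x :=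
      (integrable_inv_one_add_sq.const_mul a).indicator measurableSet_Iio
    refine (h1.add h2).congr ?_
    filter_upwards [compl_mem_ae_iff.2 (measure_singleton (0 : ℝ))] with x hx
    rcases lt_or_gt_of_ne (show x ≠ 0 from hx) with h | h
    · simp only [Pi.add_apply, Set.indicator_of_mem (show x ∈ Set.Iio 0 from h), hneg x h]
      ring
    · simp only [Pi.add_apply, Set.indicator_of_notMem (show x ∉ Set.Iio 0 from not_lt.2 h.le),
        hpos x h, add_zero]
  · exact hv.integrableOn.congr_fun (fun x hx => by simp only [hpos x hx]) measurableSet_Ioi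

/-- The properties of the Cauchy data `f κ`, `g κ` at the origin of the Jost solutions at `+∞` of a
real potential that the scattering problem uses. -/
structure IsJostData (k : ℕ) (f g : ℂ → ℂ) : Prop where
  contDiffOn_value : ContDiffOn ℂ k f uhp
  contDiffOn_slope : ContDiffOn ℂ k g uhp
  value_neg_conj : ∀ κ ∈ uhp, f (-conj κ) = conj (f κ)
  slope_neg_conj : ∀ κ ∈ uhp, g (-conj κ) = conj (g κ)
  wronskian_conj : ∀ s : ℝ, f s * conj (g s) - g s * conj (f s) = -(2 * Complex.I * s)
  nontrivial : ∀ κ ∈ uhp, f κ = 0 → g κ ≠ 0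

/-- The Jost solution has nonvanishing Cauchy data: otherwise it would vanish on the right
half-line. -/
lemma IsJostPotential.jost_nontrivial {k : ℕ} {q : ℝ → ℝ} (hq : IsJostPotential k q) {κ : ℂ}
    (hκ : κ ∈ uhp) (h0 : jost q κ atTop 0 = 0) : deriv (jost q κ atTop) 0 ≠ 0 := by
  intro h1
  have hJ := hq.isJost_jost hκ
  have hneg := hJ.comp_neg.1
  rw [neg_sq] at hneg
  have hl : LocallyIntegrable (fun x => q (-x)) volume := by
    rw [locallyIntegrable_iff]
    intro K hK
    have h2 := hq.locallyIntegrable.integrableOn_isCompact hK.neg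
    have := (Measure.measurePreserving_neg (volume : Measure ℝ)).integrableOn_comp_preimage
      (Homeomorph.neg ℝ).measurableEmbedding (f := q) (s := -K)
    have h3 := this.2 h2
    rwa [Set.neg_preimage, neg_neg] at h3
  have hzero : ∀ x, 0 ≤ x → jost q κ atTop x = 0 := fun x hx => by
    have := hneg.eq_zero_of_cauchy hl (X := 0) (a := -x) (by simpa using h0)
      (by rw [deriv_comp_neg, neg_zero, h1, neg_zero]) (by linarith)
    simpa using this
  refine zero_ne_one (tendsto_nhds_unique (tendsto_const_nhds.congr' ?_) hJ.2)
  filter_upwards [eventually_ge_atTop 0] with x hx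
  rw [hzero x hx, zero_mul]

lemma IsJostPotential.isJostData {k : ℕ} {q : ℝ → ℝ} (hq : IsJostPotential k q) :
    IsJostData k (fun κ => jost q κ atTop 0) (fun κ => deriv (jost q κ atTop) 0) where
  contDiffOn_value := hq.contDiffOn_jost.1
  contDiffOn_slope := hq.contDiffOn_jost.2
  value_neg_conj κ hκ := by rw [hq.jost_neg_conj hκ]
  slope_neg_conj κ hκ := hq.deriv_jost_neg_conj hκ
  wronskian_conj s := hq.wronskian_conj s
  nontrivial κ hκ := hq.jost_nontrivial hκ

/-- Value at `0` of the Jost solution at `-∞`, as a function of the spectral parameter of its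
reflection. -/
def leftValue (c : ℝ) (u₀ : ℝ → ℝ) (κ : ℂ) : ℂ := jost (fun x => potL c u₀ (-x)) κ atTop 0

/-- Slope at `0` of the reflection of the Jost solution at `-∞`. -/
def leftSlope (c : ℝ) (u₀ : ℝ → ℝ) (κ : ℂ) : ℂ := deriv (jost (fun x => potL c u₀ (-x)) κ atTop) 0

/-- Value at `0` of the Jost solution at `+∞` with spectral parameter `κ`. -/
def rightValue (c : ℝ) (u₀ : ℝ → ℝ) (κ : ℂ) : ℂ := jost (potR c u₀) κ atTop 0

/-- Slope at `0` of the Jost solution at `+∞` with spectral parameter `κ`. -/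
def rightSlope (c : ℝ) (u₀ : ℝ → ℝ) (κ : ℂ) : ℂ := deriv (jost (potR c u₀) κ atTop) 0

/-- The Wronskian of `φᵐ` and `ψᵖ`, whose zeros are the poles of the reflection coefficients. -/
def jostW (c : ℝ) (u₀ : ℝ → ℝ) (z : ℂ) : ℂ := wronskian (phiM c u₀ z) (psiP c u₀ z)

/-- The Wronskian of `φᵖ` and `ψᵖ`. -/
def jostV (c : ℝ) (u₀ : ℝ → ℝ) (z : ℂ) : ℂ := wronskian (phiP c u₀ z) (psiP c u₀ z)

section scattering

variable {c : ℝ} {k : ℕ} {u₀ : ℝ → ℝ}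

lemma isJostPotential_left
    (hu : Integrable (fun x : ℝ => (1 + |x|) ^ (k + 1) * u₀ x) volume) :
    IsJostPotential k fun x => potL c u₀ (-x) := by
  refine isJostPotential_of_step (v := fun x => u₀ (-x)) (a := -c ^ 2) ?_ (fun x hx => ?_)
    fun x hx => ?_
  · simpa using hu.comp_neg
  · simp only [potL, if_pos (by linarith : -x ≤ 0)]
  · simp only [potL, if_neg (by linarith : ¬ -x ≤ 0)]
    ring

lemma isJostPotential_right
    (hu : Integrable (fun x : ℝ => (1 + |x|) ^ (k + 1) * u₀ x) volume) :
    IsJostPotential k (potR c u₀) := by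
  refine isJostPotential_of_step (v := u₀) (a := c ^ 2) hu (fun x hx => ?_) fun x hx => ?_
  · simp only [potR, if_pos hx.le]
  · simp only [potR, if_neg (not_le.2 hx)]

lemma isJostData_left
    (hu : Integrable (fun x : ℝ => (1 + |x|) ^ (k + 1) * u₀ x) volume) :
    IsJostData k (leftValue c u₀) (leftSlope c u₀) := (isJostPotential_left hu).isJostData

lemma isJostData_right
    (hu : Integrable (fun x : ℝ => (1 + |x|) ^ (k + 1) * u₀ x) volume) :
    IsJostData k (rightValue c u₀) (rightSlope c u₀) := (isJostPotential_right hu).isJostData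

lemma phiM_zero (hu : Integrable (fun x : ℝ => (1 + |x|) ^ (k + 1) * u₀ x) volume) {z : ℂ}
    (hz : z ∈ uhp) :
    phiM c u₀ z 0 = leftValue c u₀ z ∧ deriv (phiM c u₀ z) 0 = -leftSlope c u₀ z := by
  have hz' : -(-z) ∈ uhp := by rwa [neg_neg]
  rw [phiM, (isJostPotential_left hu).deriv_jost_atBot hz',
    (isJostPotential_left hu).jost_atBot hz', neg_neg]
  simp [leftValue, leftSlope]

lemma phiP_zero (hu : Integrable (fun x : ℝ => (1 + |x|) ^ (k + 1) * u₀ x) volume) (s : ℝ) :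
    phiP c u₀ s 0 = leftValue c u₀ (-s) ∧ deriv (phiP c u₀ s) 0 = -leftSlope c u₀ (-s) := by
  have hs : -(s : ℂ) ∈ uhp := by exact_mod_cast ofReal_mem_uhp (-s)
  rw [phiP, (isJostPotential_left hu).deriv_jost_atBot hs,
    (isJostPotential_left hu).jost_atBot hs]
  simp [leftValue, leftSlope]

lemma jostW_eq (hu : Integrable (fun x : ℝ => (1 + |x|) ^ (k + 1) * u₀ x) volume) {z : ℂ}
    (hz : z ∈ uhp) :
    jostW c u₀ z = leftValue c u₀ z * rightSlope c u₀ (lam c z)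
      + leftSlope c u₀ z * rightValue c u₀ (lam c z) := by
  rw [jostW, wronskian, (phiM_zero hu hz).1, (phiM_zero hu hz).2, psiP, rightSlope, rightValue]
  ring

lemma jostV_eq (hu : Integrable (fun x : ℝ => (1 + |x|) ^ (k + 1) * u₀ x) volume) (s : ℝ) :
    jostV c u₀ s = leftValue c u₀ (-s) * rightSlope c u₀ (lam c s)
      + leftSlope c u₀ (-s) * rightValue c u₀ (lam c s) := by
  rw [jostV, wronskian, (phiP_zero hu s).1, (phiP_zero hu s).2, psiP, rightSlope, rightValue]
  ring

lemma wronskian_psiM_phiM (hu : Integrable (fun x : ℝ => (1 + |x|) ^ (k + 1) * u₀ x) volume)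
    (s : ℝ) :
    wronskian (psiM c u₀ s) (phiM c u₀ s) = -(leftValue c u₀ s * rightSlope c u₀ (-lam c s)
      + leftSlope c u₀ s * rightValue c u₀ (-lam c s)) := by
  have hs := phiM_zero (c := c) hu (ofReal_mem_uhp s)
  rw [wronskian, hs.1, hs.2, psiM, rightSlope, rightValue]
  ring

lemma IsJostData.neg_ofReal {f g : ℂ → ℂ} (h : IsJostData k f g) (s : ℝ) :
    f ((-s : ℝ) : ℂ) = conj (f s) ∧ g ((-s : ℝ) : ℂ) = conj (g s) := by
  have h1 := h.value_neg_conj s (ofReal_mem_uhp s)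
  have h2 := h.slope_neg_conj s (ofReal_mem_uhp s)
  rw [Complex.conj_ofReal] at h1 h2
  push_cast
  exact ⟨h1, h2⟩

lemma jostW_neg (hc : 0 < c) (hu : Integrable (fun x : ℝ => (1 + |x|) ^ (k + 1) * u₀ x) volume)
    (s : ℝ) : jostW c u₀ ((-s : ℝ) : ℂ) = conj (jostW c u₀ s) := by
  have hL := isJostData_left (c := c) hu
  have hR := isJostData_right (c := c) hu
  have hl := lam_mem_uhp c (ofReal_mem_uhp s)
  rw [jostW_eq hu (ofReal_mem_uhp _), jostW_eq hu (ofReal_mem_uhp _), lam_neg_ofReal hc,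
    hR.value_neg_conj _ hl, hR.slope_neg_conj _ hl, (hL.neg_ofReal s).1, (hL.neg_ofReal s).2]
  simp

lemma jostV_neg (hc : 0 < c) (hu : Integrable (fun x : ℝ => (1 + |x|) ^ (k + 1) * u₀ x) volume)
    (s : ℝ) : jostV c u₀ ((-s : ℝ) : ℂ) = conj (jostV c u₀ s) := by
  have hL := isJostData_left (c := c) hu
  have hR := isJostData_right (c := c) hu
  have hl := lam_mem_uhp c (ofReal_mem_uhp s)
  have h1 := hL.neg_ofReal (-s)
  rw [neg_neg] at h1
  push_cast at h1
  rw [jostV_eq hu, jostV_eq hu, lam_neg_ofReal hc, hR.value_neg_conj _ hl, hR.slope_neg_conj _ hl]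
  push_cast
  rw [neg_neg, h1.1, h1.2]
  simp

/-- On the cut, `φᵐ(-s) = φᵖ(s)` and `λ(-s) = λ(s)`. -/
lemma jostV_of_abs_le (hu : Integrable (fun x : ℝ => (1 + |x|) ^ (k + 1) * u₀ x) volume) {s : ℝ}
    (hs : |s| ≤ c) : jostV c u₀ s = jostW c u₀ ((-s : ℝ) : ℂ) := by
  rw [jostV_eq hu, jostW_eq hu (ofReal_mem_uhp _), lam_of_abs_le hs,
    lam_of_abs_le (s := -s) (by rwa [abs_neg])]
  simp

/-- The Wronskian of `φᵐ` and `ψᵖ` does not vanish on the real line: at `s ≠ 0` it would force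
`s ‖ψᵖ‖² + μ ‖φᵐ‖² = 0`, where `μ` is `λ(s)` off the cut and `0` on it, and has the sign of `s`. -/
theorem jostW_ne_zero (hc : 0 < c)
    (hu : Integrable (fun x : ℝ => (1 + |x|) ^ (k + 1) * u₀ x) volume) (hgen : IsGeneric c u₀)
    (s : ℝ) : jostW c u₀ s ≠ 0 := by
  rcases eq_or_ne s 0 with rfl | hs0
  · intro h
    refine hgen.2 ?_
    have e : phiP c u₀ 0 = phiM c u₀ 0 := by simp [phiP, phiM]
    rw [jostW, Complex.ofReal_zero, wronskian] at h
    rw [e, wronskian]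
    linear_combination -h
  intro h
  have hL := isJostData_left (c := c) hu
  have hR := isJostData_right (c := c) hu
  have hl := lam_mem_uhp c (ofReal_mem_uhp s)
  rw [jostW_eq hu (ofReal_mem_uhp _)] at h
  have hP := hL.wronskian_conj s
  obtain ⟨μ, hμ, hμs⟩ : ∃ μ : ℝ, rightValue c u₀ (lam c s) * conj (rightSlope c u₀ (lam c s))
      - rightSlope c u₀ (lam c s) * conj (rightValue c u₀ (lam c s)) = -(2 * Complex.I * μ)
      ∧ 0 ≤ μ * s := by
    rcases le_or_gt c |s| with h | h
    · obtain ⟨l, h1, h2⟩ := exists_lam_eq_ofReal hc h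
      refine ⟨l, ?_, h2⟩
      rw [h1]
      exact hR.wronskian_conj l
    · refine ⟨0, ?_, by simp⟩
      have e : -conj (lam c s) = lam c s := by
        rw [lam_of_abs_le h.le]
        simp
      rw [← hR.value_neg_conj _ hl, ← hR.slope_neg_conj _ hl, e]
      simp
      ring
  have hnt := hR.nontrivial _ hl
  set P0 := leftValue c u₀ s
  set P1 := leftSlope c u₀ s
  set Q0 := rightValue c u₀ (lam c s)
  set Q1 := rightSlope c u₀ (lam c s)
  have hconj := congrArg conj h
  simp only [map_add, map_mul, map_zero] at hconj
  have hs2 : 0 < s ^ 2 := by positivity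
  have key : ∀ {x y : ℂ}, s * (x * conj x) + μ * (y * conj y) = 0 → x = 0 := fun {x y} hxy => by
    rw [Complex.mul_conj, Complex.mul_conj] at hxy
    norm_cast at hxy
    have h1 : s ^ 2 * Complex.normSq x + μ * s * Complex.normSq y = 0 := by
      linear_combination s * hxy
    have h2 := mul_nonneg hμs (Complex.normSq_nonneg y)
    have h3 := mul_nonneg hs2.le (Complex.normSq_nonneg x)
    have h4 : s ^ 2 * Complex.normSq x = 0 := by linarith
    exact Complex.normSq_eq_zero.1 ((mul_eq_zero.1 h4).resolve_left hs2.ne')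
  have hI : (2 * Complex.I) ≠ 0 := by simp
  have hQ0 : Q0 = 0 := by
    refine key (y := P0) (mul_left_cancel₀ hI ?_)
    linear_combination Q0 * conj Q0 * hP + P0 * conj P0 * hμ - P0 * Q0 * hconj
      + conj P0 * conj Q0 * h
  have hQ1 : Q1 = 0 := by
    refine key (y := P1) (mul_left_cancel₀ hI ?_)
    linear_combination Q1 * conj Q1 * hP + P1 * conj P1 * hμ + P1 * Q1 * hconj
      - conj P1 * conj Q1 * h
  exact hnt hQ0 hQ1

end scattering

/-! ### The left reflection coefficient -/

section scattering

variable {c : ℝ} {k : ℕ} {u₀ : ℝ → ℝ}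

lemma continuousOn_jostW (hu : Integrable (fun x : ℝ => (1 + |x|) ^ (k + 1) * u₀ x) volume) :
    ContinuousOn (jostW c u₀) uhp := by
  have hL := isJostData_left (c := c) hu
  have hR := isJostData_right (c := c) hu
  have hm : Set.MapsTo (lam c) uhp uhp := fun z hz => lam_mem_uhp c hz
  refine ContinuousOn.congr ?_ fun z hz => jostW_eq hu hz
  exact (hL.contDiffOn_value.continuousOn.mul
      (hR.contDiffOn_slope.continuousOn.comp (continuousOn_lam c) hm)).add
    (hL.contDiffOn_slope.continuousOn.mul
      (hR.contDiffOn_value.continuousOn.comp (continuousOn_lam c) hm))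

lemma continuous_jostW_ofReal
    (hu : Integrable (fun x : ℝ => (1 + |x|) ^ (k + 1) * u₀ x) volume) :
    Continuous fun s : ℝ => jostW c u₀ s :=
  (continuousOn_jostW hu).comp_continuous Complex.continuous_ofReal ofReal_mem_uhp

lemma contDiffAt_comp_of_mapsTo {F : ℂ → ℂ} (hF : ContDiffOn ℂ k F uhp) {z : ℝ → ℂ} {s : ℝ}
    {U : Set ℝ} (hU : U ∈ 𝓝 s) (hz : ContDiffAt ℝ k z s) (hm : Set.MapsTo z U uhp) :
    ContDiffAt ℝ k (fun t => F (z t)) s :=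
  (((hF (z s) (hm (mem_of_mem_nhds hU))).restrict_scalars ℝ).comp s hz.contDiffWithinAt
    hm).contDiffAt hU

lemma contDiffAt_ofReal (s : ℝ) : ContDiffAt ℝ k (fun t : ℝ => (t : ℂ)) s :=
  Complex.ofRealCLM.contDiff.contDiffAt

lemma contDiffAt_jostW (hu : Integrable (fun x : ℝ => (1 + |x|) ^ (k + 1) * u₀ x) volume) {s : ℝ}
    (h1 : s ≠ c) (h2 : s ≠ -c) : ContDiffAt ℝ k (fun s : ℝ => jostW c u₀ s) s := by
  have hL := isJostData_left (c := c) hu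
  have hR := isJostData_right (c := c) hu
  have hl := contDiffAt_lam_ofReal (n := k) h1 h2
  have hm : Set.MapsTo (fun s : ℝ => lam c s) Set.univ uhp :=
    fun s _ => lam_mem_uhp c (ofReal_mem_uhp s)
  have hm' : Set.MapsTo (fun s : ℝ => (s : ℂ)) Set.univ uhp := fun s _ => ofReal_mem_uhp s
  refine ContDiffAt.congr_of_eventuallyEq ?_
    (.of_forall fun t => jostW_eq (c := c) hu (ofReal_mem_uhp t))
  exact ((contDiffAt_comp_of_mapsTo hL.contDiffOn_value univ_mem (contDiffAt_ofReal s) hm').mul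
      (contDiffAt_comp_of_mapsTo hR.contDiffOn_slope univ_mem hl hm)).add
    ((contDiffAt_comp_of_mapsTo hL.contDiffOn_slope univ_mem (contDiffAt_ofReal s) hm').mul
      (contDiffAt_comp_of_mapsTo hR.contDiffOn_value univ_mem hl hm))

lemma contDiffAt_jostV (hu : Integrable (fun x : ℝ => (1 + |x|) ^ (k + 1) * u₀ x) volume) {s : ℝ}
    (h1 : s ≠ c) (h2 : s ≠ -c) : ContDiffAt ℝ k (fun s : ℝ => jostV c u₀ s) s := by
  have hL := isJostData_left (c := c) hu
  have hR := isJostData_right (c := c) hu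
  have hl := contDiffAt_lam_ofReal (n := k) h1 h2
  have hm : Set.MapsTo (fun s : ℝ => lam c s) Set.univ uhp :=
    fun s _ => lam_mem_uhp c (ofReal_mem_uhp s)
  have hm' : Set.MapsTo (fun s : ℝ => -(s : ℂ)) Set.univ uhp :=
    fun s _ => by exact_mod_cast ofReal_mem_uhp (-s)
  refine ContDiffAt.congr_of_eventuallyEq ?_ (.of_forall fun t => jostV_eq (c := c) hu t)
  exact ((contDiffAt_comp_of_mapsTo hL.contDiffOn_value univ_mem (contDiffAt_ofReal s).neg hm').mul
      (contDiffAt_comp_of_mapsTo hR.contDiffOn_slope univ_mem hl hm)).add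
    ((contDiffAt_comp_of_mapsTo hL.contDiffOn_slope univ_mem (contDiffAt_ofReal s).neg hm').mul
      (contDiffAt_comp_of_mapsTo hR.contDiffOn_value univ_mem hl hm))

lemma bdryPlus_eq {f : ℂ → ℂ} {s : ℝ} (hf : ContinuousWithinAt f uhp s) : bdryPlus f s = f s := by
  have hne : (𝓝[{z : ℂ | 0 < z.im}] (s : ℂ)).NeBot := by
    rw [← mem_closure_iff_nhdsWithin_neBot, Complex.closure_setOfPred_lt_im]
    exact ofReal_mem_uhp s
  have h : ContinuousWithinAt f {z : ℂ | 0 < z.im} s :=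
    hf.mono fun z (hz : 0 < z.im) => (hz.le : 0 ≤ z.im)
  exact h.tendsto.limUnder_eq

lemma aPlus_eq (hu : Integrable (fun x : ℝ => (1 + |x|) ^ (k + 1) * u₀ x) volume) {s : ℝ}
    (hs : s ≠ 0) : aPlus c u₀ s = jostW c u₀ s / (2 * Complex.I * s) := by
  refine bdryPlus_eq (f := fun z => jostW c u₀ z / (2 * Complex.I * z)) ?_
  refine ((continuousOn_jostW hu) s (ofReal_mem_uhp s)).div
    (Continuous.continuousWithinAt (by fun_prop)) ?_
  simpa using hs

lemma APlus_eq (hc : 0 < c) (hu : Integrable (fun x : ℝ => (1 + |x|) ^ (k + 1) * u₀ x) volume)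
    {s : ℝ} (hs : |s| ≠ c) : APlus c u₀ s = jostW c u₀ s / (2 * Complex.I * lam c s) := by
  refine bdryPlus_eq (f := fun z => jostW c u₀ z / (2 * Complex.I * lam c z)) ?_
  refine ((continuousOn_jostW hu) s (ofReal_mem_uhp s)).div
    (((continuousOn_lam c) s (ofReal_mem_uhp s)).const_mul _) ?_
  simpa using lam_ne_zero hc hs

/-- The quotient that defines the left reflection coefficient on the cut. -/
lemma aPlus_div_aPlus (hu : Integrable (fun x : ℝ => (1 + |x|) ^ (k + 1) * u₀ x) volume) {s : ℝ}
    (hs : s ≠ 0) (h : |s| ≤ c) :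
    aPlus c u₀ (-s) / aPlus c u₀ s = -jostV c u₀ s / jostW c u₀ s := by
  have hs' : (2 * Complex.I * (s : ℂ)) ≠ 0 := by simpa using hs
  rw [aPlus_eq hu hs, aPlus_eq hu (neg_ne_zero.2 hs), jostV_of_abs_le hu h, div_div_eq_mul_div]
  push_cast
  rw [mul_neg, div_neg, neg_mul, div_mul_cancel₀ _ hs']

/-- The left reflection coefficient is given by one formula on the whole real line. -/
theorem Rl_eq (hc : 0 < c) (hu : Integrable (fun x : ℝ => (1 + |x|) ^ (k + 1) * u₀ x) volume)
    (hgen : IsGeneric c u₀) (s : ℝ) : Rl c u₀ s = -jostV c u₀ s / jostW c u₀ s := by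
  rw [Rl]
  split_ifs with h1 h2
  · have hs : s ≠ 0 := by
      rintro rfl
      rw [abs_zero] at h1
      linarith
    have hs' : (2 * Complex.I * (s : ℂ)) ≠ 0 := by simpa using hs
    exact div_div_div_cancel_right₀ hs' _ _
  · subst h2
    refine Tendsto.limUnder_eq ?_
    have hV : ContinuousAt (fun s : ℝ => jostV c u₀ s) 0 :=
      (contDiffAt_jostV hu (by linarith) (by linarith)).continuousAt
    have hW := (continuous_jostW_ofReal (c := c) hu).continuousAt (x := 0)
    have := hV.neg.div hW (jostW_ne_zero hc hu hgen 0)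
    refine (this.tendsto.mono_left nhdsWithin_le_nhds).congr' ?_
    filter_upwards [self_mem_nhdsWithin, mem_nhdsWithin_of_mem_nhds
      (Metric.ball_mem_nhds (0 : ℝ) hc)] with t ht htc
    rw [mem_ball_zero_iff, Real.norm_eq_abs] at htc
    exact (aPlus_div_aPlus hu ht htc.le).symm
  · exact aPlus_div_aPlus hu h2 (not_lt.1 h1)

lemma Rl_neg (hc : 0 < c) (hu : Integrable (fun x : ℝ => (1 + |x|) ^ (k + 1) * u₀ x) volume)
    (hgen : IsGeneric c u₀) (s : ℝ) : Rl c u₀ (-s) = conj (Rl c u₀ s) := by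
  rw [Rl_eq hc hu hgen, Rl_eq hc hu hgen, jostW_neg hc hu, jostV_neg hc hu]
  simp

lemma Rl_zero (hc : 0 < c) (hu : Integrable (fun x : ℝ => (1 + |x|) ^ (k + 1) * u₀ x) volume)
    (hgen : IsGeneric c u₀) : Rl c u₀ 0 = -1 := by
  have h := jostW_ne_zero hc hu hgen 0
  rw [Rl_eq hc hu hgen, jostV_of_abs_le hu (by simpa using hc.le), neg_zero, neg_div, div_self h]

lemma contDiffOn_Rl (hc : 0 < c)
    (hu : Integrable (fun x : ℝ => (1 + |x|) ^ (k + 1) * u₀ x) volume)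
    (hgen : IsGeneric c u₀) : ContDiffOn ℝ k (Rl c u₀) ({c, -c} : Set ℝ)ᶜ := by
  intro s hs
  simp only [Set.mem_compl_iff, Set.mem_insert_iff, Set.mem_singleton_iff, not_or] at hs
  refine ContDiffAt.contDiffWithinAt (ContDiffAt.congr_of_eventuallyEq ?_
    (.of_forall fun t => (Rl_eq hc hu hgen t).trans (div_eq_mul_inv _ _)))
  exact (contDiffAt_jostV hu hs.1 hs.2).neg.mul ((contDiffAt_jostW hu hs.1 hs.2).inv
    (jostW_ne_zero hc hu hgen s))

/-- Near `c`, the left reflection coefficient is expanded in powers of one function on both sides,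
the boundary value of `√(z - c)` from the upper half-plane. -/
theorem hasExpansion_Rl (hc : 0 < c)
    (hu : Integrable (fun x : ℝ => (1 + |x|) ^ (k + 1) * u₀ x) volume) (hgen : IsGeneric c u₀) :
    HasExpansion (𝓝[≠] c) (fun s => upperSqrt (s - c)) k (Rl c u₀) := by
  have hL := isJostData_left (c := c) hu
  have hR := isJostData_right (c := c) hu
  have hμc : Continuous fun s => upperSqrt (s - c) := by
    have := continuous_upperSqrt
    fun_prop
  have hle : 𝓝[≠] c ≤ 𝓝 c := nhdsWithin_le_nhds
  have hμ : Tendsto (fun s => upperSqrt (s - c)) (𝓝[≠] c) (𝓝 0) := by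
    have := hμc.tendsto c
    rw [sub_self, upperSqrt_of_nonneg le_rfl, Real.sqrt_zero, Complex.ofReal_zero] at this
    exact this.mono_left hle
  -- `s - c` and `-s + c` are `± μ²`
  have hsq : HasExpansion (𝓝[≠] c) (fun s => upperSqrt (s - c)) k (fun s => (s : ℂ) - c) := by
    refine (HasExpansion.polynomial (Polynomial.X ^ 2)).congr (.of_forall fun s => ?_)
    simp [upperSqrt_sq]
  have hsqO : (fun s : ℝ => (s : ℂ) - c) =O[𝓝[≠] c] fun s => upperSqrt (s - c) := by
    have := (hμ.isBigO_one ℂ).mul (isBigO_refl (fun s => upperSqrt (s - c)) (𝓝[≠] c))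
    refine (this.congr_right fun s => one_mul _).congr_left fun s => ?_
    rw [← sq, upperSqrt_sq]
    push_cast
    ring
  have hsq' : HasExpansion (𝓝[≠] c) (fun s => upperSqrt (s - c)) k
      (fun s : ℝ => -(s : ℂ) - -c) := hsq.neg.congr (.of_forall fun s => by ring)
  have hsqO' : (fun s : ℝ => -(s : ℂ) - -c) =O[𝓝[≠] c] fun s => upperSqrt (s - c) :=
    hsqO.neg_left.congr_left fun s => by ring
  have hmem : ∀ s : ℝ, -(s : ℂ) ∈ uhp := fun s => by exact_mod_cast ofReal_mem_uhp (-s)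
  have hleft {F : ℂ → ℂ} (hF : ContDiffOn ℂ k F uhp) : HasExpansion (𝓝[≠] c)
      (fun s => upperSqrt (s - c)) k (fun s => F s) :=
    HasExpansion.comp hμ convex_uhp uniqueDiffOn_uhp (ofReal_mem_uhp c) hF
      (.of_forall ofReal_mem_uhp) hsq hsqO
  have hleft' {F : ℂ → ℂ} (hF : ContDiffOn ℂ k F uhp) : HasExpansion (𝓝[≠] c)
      (fun s => upperSqrt (s - c)) k (fun s => F (-s)) :=
    HasExpansion.comp hμ convex_uhp uniqueDiffOn_uhp (hmem c) hF
      (.of_forall hmem) hsq' hsqO'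
  -- `λ = μ ν`, where `ν = √(s + c)` is smooth near `c`
  have hν : HasExpansion (𝓝[≠] c) (fun s => upperSqrt (s - c)) k (fun s => upperSqrt (s + c)) := by
    have hF : ContDiffOn ℂ k (fun z : ℂ => (z + c) ^ (1 / 2 : ℂ)) (Metric.ball (c : ℂ) c) := by
      have hd : DifferentiableOn ℂ (fun z : ℂ => (z + c) ^ (1 / 2 : ℂ)) (Metric.ball (c : ℂ) c) := by
        intro z hz
        refine DifferentiableAt.differentiableWithinAt (DifferentiableAt.cpow_const
          (differentiableAt_id.add_const _) (Or.inl ?_))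
        have h1 := (Complex.abs_re_le_norm (z - c)).trans_lt (mem_ball_iff_norm.1 hz)
        rw [Complex.sub_re, Complex.ofReal_re, abs_lt] at h1
        simp only [Complex.add_re, Complex.ofReal_re]
        linarith
      exact hd.contDiffOn Metric.isOpen_ball
    refine (HasExpansion.comp hμ (convex_ball (c : ℂ) c) Metric.isOpen_ball.uniqueDiffOn
      (Metric.mem_ball_self hc) hF (z := fun s : ℝ => (s : ℂ)) ?_ hsq hsqO).congr
      (.of_forall fun s => by simp [upperSqrt])
    exact hle (Complex.continuous_ofReal.continuousAt (Metric.ball_mem_nhds _ hc))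
  have hlam : HasExpansion (𝓝[≠] c) (fun s => upperSqrt (s - c)) k (fun s => lam c s - 0) := by
    refine (HasExpansion.mul hμ (HasExpansion.polynomial Polynomial.X) hν).congr
      (.of_forall fun s => ?_)
    rw [Polynomial.eval_X, lam_ofReal, sub_zero]
  have hlamO : (fun s : ℝ => lam c s - 0) =O[𝓝[≠] c] fun s => upperSqrt (s - c) := by
    have := (isBigO_refl (fun s => upperSqrt (s - c)) (𝓝[≠] c)).mul (hν.isBigO_one hμ)
    refine (this.congr_right fun s => mul_one _).congr_left fun s => ?_
    rw [lam_ofReal, sub_zero]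
  have hright {F : ℂ → ℂ} (hF : ContDiffOn ℂ k F uhp) : HasExpansion (𝓝[≠] c)
      (fun s => upperSqrt (s - c)) k (fun s => F (lam c s)) :=
    HasExpansion.comp hμ convex_uhp uniqueDiffOn_uhp (by simpa using ofReal_mem_uhp 0) hF
      (.of_forall fun s => lam_mem_uhp c (ofReal_mem_uhp s)) hlam hlamO
  have hW : HasExpansion (𝓝[≠] c) (fun s => upperSqrt (s - c)) k (fun s => jostW c u₀ s) :=
    (((hleft hL.contDiffOn_value).mul hμ (hright hR.contDiffOn_slope)).add
      ((hleft hL.contDiffOn_slope).mul hμ (hright hR.contDiffOn_value))).congr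
      (.of_forall fun s => (jostW_eq hu (ofReal_mem_uhp s)).symm)
  have hV : HasExpansion (𝓝[≠] c) (fun s => upperSqrt (s - c)) k (fun s => jostV c u₀ s) :=
    (((hleft' hL.contDiffOn_value).mul hμ (hright hR.contDiffOn_slope)).add
      ((hleft' hL.contDiffOn_slope).mul hμ (hright hR.contDiffOn_value))).congr
      (.of_forall fun s => (jostV_eq hu s).symm)
  have hWlim : Tendsto (fun s : ℝ => jostW c u₀ s) (𝓝[≠] c) (𝓝 (jostW c u₀ c)) :=
    ((continuous_jostW_ofReal hu).tendsto c).mono_left hle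
  refine (hV.neg.mul hμ (hW.inv hμ hWlim (jostW_ne_zero hc hu hgen c) inferInstance)).congr
    (.of_forall fun s => ?_)
  rw [Rl_eq hc hu hgen, div_eq_mul_inv]

lemma norm_upperSqrt_pow (x : ℝ) (k : ℕ) : ‖upperSqrt x ^ k‖ = |x| ^ ((k : ℝ) / 2) := by
  rw [norm_pow, norm_upperSqrt, Real.sqrt_eq_rpow, ← Real.rpow_natCast, ← Real.rpow_mul
    (abs_nonneg x)]
  congr 1
  ring

/-- The expansion of the left reflection coefficient at `c`, with the same coefficients on the two
sides. -/
theorem exists_expansion_Rl (hc : 0 < c)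
    (hu : Integrable (fun x : ℝ => (1 + |x|) ^ (k + 1) * u₀ x) volume) (hgen : IsGeneric c u₀) :
    ∃ d : ℕ → ℂ,
      (fun s : ℝ => Rl c u₀ s -
          ∑ j ∈ Finset.range (k + 1), d j * (Real.sqrt (s - c) : ℂ) ^ j)
        =o[𝓝[>] c] (fun s : ℝ => |s - c| ^ ((k : ℝ) / 2)) ∧
      (fun s : ℝ => Rl c u₀ s -
          ∑ j ∈ Finset.range (k + 1), d j * (Complex.I * (Real.sqrt (c - s) : ℂ)) ^ j)
        =o[𝓝[<] c] (fun s : ℝ => |s - c| ^ ((k : ℝ) / 2)) := by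
  have hμ : Tendsto (fun s => upperSqrt (s - c)) (𝓝[≠] c) (𝓝 0) := by
    have hμc : Continuous fun s => upperSqrt (s - c) := by
      have := continuous_upperSqrt
      fun_prop
    have := hμc.tendsto c
    rw [sub_self, upperSqrt_of_nonneg le_rfl, Real.sqrt_zero, Complex.ofReal_zero] at this
    exact this.mono_left nhdsWithin_le_nhds
  obtain ⟨d, hd⟩ := (hasExpansion_Rl hc hu hgen).exists_coeff hμ
  have hd' := hd.norm_right.congr_right fun s => norm_upperSqrt_pow (s - c) k
  refine ⟨d, ?_, ?_⟩
  · refine (hd'.mono (nhdsWithin_mono c fun s hs => ne_of_gt hs)).congr' ?_ EventuallyEq.rfl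
    filter_upwards [self_mem_nhdsWithin] with s hs
    rw [upperSqrt_of_nonneg (sub_nonneg.2 (le_of_lt hs))]
  · refine (hd'.mono (nhdsWithin_mono c fun s hs => ne_of_lt hs)).congr' ?_ EventuallyEq.rfl
    filter_upwards [self_mem_nhdsWithin] with s hs
    rw [upperSqrt_of_nonpos (sub_nonpos.2 (le_of_lt hs)), neg_sub]

/-- The expansion at `-c` is the complex conjugate of the one at `c`. -/
theorem exists_expansion_Rl_neg (hc : 0 < c)
    (hu : Integrable (fun x : ℝ => (1 + |x|) ^ (k + 1) * u₀ x) volume) (hgen : IsGeneric c u₀) :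
    ∃ a : ℕ → ℂ,
      (fun s : ℝ => Rl c u₀ s -
          ∑ j ∈ Finset.range (k + 1), a j * (Real.sqrt (-s - c) : ℂ) ^ j)
        =o[𝓝[<] (-c)] (fun s : ℝ => |s + c| ^ ((k : ℝ) / 2)) ∧
      (fun s : ℝ => Rl c u₀ s -
          ∑ j ∈ Finset.range (k + 1), a j * (-Complex.I * (Real.sqrt (s + c) : ℂ)) ^ j)
        =o[𝓝[>] (-c)] (fun s : ℝ => |s + c| ^ ((k : ℝ) / 2)) := by
  obtain ⟨d, h1, h2⟩ := exists_expansion_Rl hc hu hgen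
  have hneg : Tendsto (fun s : ℝ => -s) (𝓝 (-c)) (𝓝 c) := by
    simpa using (continuous_neg (G := ℝ)).tendsto (-c)
  have t1 : Tendsto (fun s : ℝ => -s) (𝓝[<] (-c)) (𝓝[>] c) := by
    refine tendsto_nhdsWithin_iff.2 ⟨hneg.mono_left nhdsWithin_le_nhds, ?_⟩
    filter_upwards [self_mem_nhdsWithin] with s hs
    exact lt_neg.1 (Set.mem_Iio.1 hs)
  have t2 : Tendsto (fun s : ℝ => -s) (𝓝[>] (-c)) (𝓝[<] c) := by
    refine tendsto_nhdsWithin_iff.2 ⟨hneg.mono_left nhdsWithin_le_nhds, ?_⟩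
    filter_upwards [self_mem_nhdsWithin] with s hs
    exact neg_lt.1 (Set.mem_Ioi.1 hs)
  have habs (s : ℝ) : |-s - c| = |s + c| := by
    rw [← abs_neg]
    congr 1
    ring
  have hR (s : ℝ) : Rl c u₀ s = conj (Rl c u₀ (-s)) := by
    rw [Rl_neg hc hu hgen, Complex.conj_conj]
  refine ⟨fun j => conj (d j), ?_, ?_⟩
  · have h := (h1.comp_tendsto t1).norm_left
    refine IsLittleO.of_norm_left ((h.congr_left fun s => ?_).congr_right fun s => ?_)
    · simp only [Function.comp_apply]
      rw [hR s, ← RCLike.norm_conj]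
      simp
    · simp only [Function.comp_apply, habs]
  · have h := (h2.comp_tendsto t2).norm_left
    refine IsLittleO.of_norm_left ((h.congr_left fun s => ?_).congr_right fun s => ?_)
    · simp only [Function.comp_apply]
      rw [hR s, ← RCLike.norm_conj]
      simp [add_comm]
    · simp only [Function.comp_apply, habs]

end scattering

/-! ### The right reflection coefficient -/

section scattering

variable {c : ℝ} {k : ℕ} {u₀ : ℝ → ℝ}

/-- The right reflection coefficient for `|s| ≥ c`, in terms of Cauchy data at the origin. Unlike the
quotient `B / A`, it makes sense at `± c`. -/
def outerR (c : ℝ) (u₀ : ℝ → ℝ) (s : ℝ) : ℂ :=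
  -(leftValue c u₀ s * rightSlope c u₀ (-lam c s)
    + leftSlope c u₀ s * rightValue c u₀ (-lam c s)) * (jostW c u₀ s)⁻¹

/-- The right reflection coefficient for `|s| < c`, as an expression without poles. -/
def innerR (c : ℝ) (u₀ : ℝ → ℝ) (α β : ℂ) (s : ℝ) : ℂ :=
  4 * Complex.I * ((s : ℂ) * (Real.sqrt (c ^ 2 - s ^ 2) : ℂ) * 2⁻¹
    + (α * (s : ℂ) ^ 2 + β * (Real.sqrt (c ^ 2 - s ^ 2) : ℂ)))
    * (jostW c u₀ s * jostW c u₀ ((-s : ℝ) : ℂ))⁻¹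

lemma neg_lam_mem_uhp (hc : 0 < c) {s : ℝ} (h : c ≤ |s|) : -lam c s ∈ uhp := by
  obtain ⟨l, hl, -⟩ := exists_lam_eq_ofReal hc h
  rw [hl]
  exact_mod_cast ofReal_mem_uhp (-l)

lemma lam_eq_zero {s : ℝ} (h : |s| = c) : lam c s = 0 := by
  rw [lam_of_abs_le h.le, ← sq_abs s, h]
  simp

lemma continuousOn_outerR (hc : 0 < c)
    (hu : Integrable (fun x : ℝ => (1 + |x|) ^ (k + 1) * u₀ x) volume) (hgen : IsGeneric c u₀) :
    ContinuousOn (outerR c u₀) {s | c ≤ |s|} := by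
  have hL := isJostData_left (c := c) hu
  have hR := isJostData_right (c := c) hu
  have hm : Set.MapsTo (fun s : ℝ => -lam c s) {s | c ≤ |s|} uhp := fun s hs =>
    neg_lam_mem_uhp hc hs
  have hm' : Set.MapsTo (fun s : ℝ => (s : ℂ)) {s | c ≤ |s|} uhp := fun s _ => ofReal_mem_uhp s
  have hl := (continuous_lam_ofReal c).neg.continuousOn (s := {s | c ≤ |s|})
  have ho := Complex.continuous_ofReal.continuousOn (s := {s | c ≤ |s|})
  refine ContinuousOn.mul (ContinuousOn.neg (ContinuousOn.add (ContinuousOn.mul ?_ ?_)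
    (ContinuousOn.mul ?_ ?_))) ?_
  · exact hL.contDiffOn_value.continuousOn.comp ho hm'
  · exact hR.contDiffOn_slope.continuousOn.comp hl hm
  · exact hL.contDiffOn_slope.continuousOn.comp ho hm'
  · exact hR.contDiffOn_value.continuousOn.comp hl hm
  · exact (continuous_jostW_ofReal hu).continuousOn.inv₀ fun s _ => jostW_ne_zero hc hu hgen s

lemma contDiffAt_outerR (hc : 0 < c)
    (hu : Integrable (fun x : ℝ => (1 + |x|) ^ (k + 1) * u₀ x) volume) (hgen : IsGeneric c u₀)
    {s : ℝ} (hs : c < |s|) : ContDiffAt ℝ k (outerR c u₀) s := by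
  have hL := isJostData_left (c := c) hu
  have hR := isJostData_right (c := c) hu
  have h1 : s ≠ c := by
    rintro rfl
    rw [abs_of_pos hc] at hs
    exact lt_irrefl _ hs
  have h2 : s ≠ -c := by
    rintro rfl
    rw [abs_neg, abs_of_pos hc] at hs
    exact lt_irrefl _ hs
  have hU : {t : ℝ | c < |t|} ∈ 𝓝 s := (isOpen_lt continuous_const continuous_abs).mem_nhds hs
  have hm : Set.MapsTo (fun s : ℝ => -lam c s) {t : ℝ | c < |t|} uhp :=
    fun s hs => neg_lam_mem_uhp hc (le_of_lt hs)
  have hm' : Set.MapsTo (fun s : ℝ => (s : ℂ)) Set.univ uhp := fun s _ => ofReal_mem_uhp s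
  have hl := (contDiffAt_lam_ofReal (n := k) h1 h2).neg
  refine ContDiffAt.mul (ContDiffAt.neg (ContDiffAt.add (ContDiffAt.mul ?_ ?_)
    (ContDiffAt.mul ?_ ?_))) ?_
  · exact contDiffAt_comp_of_mapsTo hL.contDiffOn_value univ_mem (contDiffAt_ofReal s) hm'
  · exact contDiffAt_comp_of_mapsTo hR.contDiffOn_slope hU hl hm
  · exact contDiffAt_comp_of_mapsTo hL.contDiffOn_slope univ_mem (contDiffAt_ofReal s) hm'
  · exact contDiffAt_comp_of_mapsTo hR.contDiffOn_value hU hl hm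
  · exact (contDiffAt_jostW hu h1 h2).inv (jostW_ne_zero hc hu hgen s)

lemma outerR_of_abs_eq (hc : 0 < c)
    (hu : Integrable (fun x : ℝ => (1 + |x|) ^ (k + 1) * u₀ x) volume) (hgen : IsGeneric c u₀)
    {s : ℝ} (hs : |s| = c) : outerR c u₀ s = -1 := by
  have h := jostW_ne_zero hc hu hgen s
  have e := jostW_eq (c := c) hu (ofReal_mem_uhp s)
  rw [lam_eq_zero hs] at e
  rw [outerR, lam_eq_zero hs, neg_zero, ← e, neg_mul, mul_inv_cancel₀ h]

lemma coefB_div_coefA (hc : 0 < c)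
    (hu : Integrable (fun x : ℝ => (1 + |x|) ^ (k + 1) * u₀ x) volume) {s : ℝ} (hs : c < |s|) :
    coefB c u₀ s / coefA c u₀ s = outerR c u₀ s := by
  have hl : 2 * Complex.I * lam c s ≠ 0 := by simpa using lam_ne_zero hc hs.ne'
  rw [coefB, coefA, div_div_div_cancel_right₀ hl, wronskian_psiM_phiM hu, div_eq_mul_inv]
  rfl

lemma Rr_eq_outerR (hc : 0 < c)
    (hu : Integrable (fun x : ℝ => (1 + |x|) ^ (k + 1) * u₀ x) volume) (hgen : IsGeneric c u₀)
    (α β : ℂ) {s : ℝ} (hs : c ≤ |s|) : Rr c u₀ α β s = outerR c u₀ s := by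
  rcases hs.lt_or_eq with h | h
  · rw [Rr, if_pos h, coefB_div_coefA hc hu h]
  · rw [Rr, if_neg (by rw [h]; exact lt_irrefl _), if_pos h.symm]
    have hne : (𝓝[{t : ℝ | c < |t|}] s).NeBot := by
      rw [← mem_closure_iff_nhdsWithin_neBot, mem_closure_iff_seq_limit]
      refine ⟨fun n : ℕ => (1 + 1 / ((n : ℝ) + 1)) * s, fun n => ?_, ?_⟩
      · have h1 : (0 : ℝ) < 1 / ((n : ℝ) + 1) := Nat.one_div_pos_of_nat
        change c < |(1 + 1 / ((n : ℝ) + 1)) * s|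
        rw [abs_mul, ← h, abs_of_pos (by linarith)]
        nlinarith
      · have := (tendsto_one_div_add_atTop_nhds_zero_nat (𝕜 := ℝ)).const_add 1
        simpa using this.mul_const s
    have hsub : {t : ℝ | c < |t|} ⊆ {t | c ≤ |t|} := fun t ht => le_of_lt (show c < |t| from ht)
    refine Tendsto.limUnder_eq ((((continuousOn_outerR hc hu hgen) s hs).mono hsub).tendsto.congr' ?_)
    filter_upwards [self_mem_nhdsWithin] with t ht using (coefB_div_coefA hc hu ht).symm

lemma continuous_innerR (hc : 0 < c)
    (hu : Integrable (fun x : ℝ => (1 + |x|) ^ (k + 1) * u₀ x) volume) (hgen : IsGeneric c u₀)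
    (α β : ℂ) : Continuous (innerR c u₀ α β) := by
  have hW := continuous_jostW_ofReal (c := c) hu
  have hW' : Continuous fun s : ℝ => jostW c u₀ ((-s : ℝ) : ℂ) := hW.comp continuous_neg
  have hi := (hW.mul hW').inv₀ fun s =>
    mul_ne_zero (jostW_ne_zero hc hu hgen s) (jostW_ne_zero hc hu hgen (-s))
  unfold innerR
  exact Continuous.mul (by fun_prop) hi

lemma contDiffAt_innerR (hc : 0 < c)
    (hu : Integrable (fun x : ℝ => (1 + |x|) ^ (k + 1) * u₀ x) volume) (hgen : IsGeneric c u₀)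
    (α β : ℂ) {s : ℝ} (hs : |s| < c) : ContDiffAt ℝ k (innerR c u₀ α β) s := by
  obtain ⟨h1, h2⟩ := abs_lt.1 hs
  have hW := contDiffAt_jostW (c := c) hu h2.ne h1.ne'
  have hW' : ContDiffAt ℝ k (fun s : ℝ => jostW c u₀ ((-s : ℝ) : ℂ)) s :=
    (contDiffAt_jostW (c := c) hu (s := -s) (by linarith) (by linarith)).comp s contDiffAt_id.neg
  have hi := (hW.mul hW').inv
    (mul_ne_zero (jostW_ne_zero hc hu hgen s) (jostW_ne_zero hc hu hgen (-s)))
  have hpos : c ^ 2 - s ^ 2 ≠ 0 := by nlinarith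
  have hsq : ContDiffAt ℝ k (fun s : ℝ => (Real.sqrt (c ^ 2 - s ^ 2) : ℂ)) s :=
    Complex.ofRealCLM.contDiff.contDiffAt.comp s
      ((contDiffAt_const.sub (contDiffAt_id.pow 2)).sqrt hpos)
  have hid := contDiffAt_ofReal (k := k) s
  exact (contDiffAt_const.mul (((hid.mul hsq).mul contDiffAt_const).add
    ((contDiffAt_const.mul (hid.pow 2)).add (contDiffAt_const.mul hsq)))).mul hi

lemma ofReal_sqrt_ne_zero {s : ℝ} (hs : |s| < c) : (Real.sqrt (c ^ 2 - s ^ 2) : ℂ) ≠ 0 := by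
  obtain ⟨h1, h2⟩ := abs_lt.1 hs
  have : 0 < c ^ 2 - s ^ 2 := by nlinarith
  exact Complex.ofReal_ne_zero.2 (Real.sqrt_pos.2 this).ne'

lemma inv_aPlus_mul_APlus (hc : 0 < c)
    (hu : Integrable (fun x : ℝ => (1 + |x|) ^ (k + 1) * u₀ x) volume) {s : ℝ} (h0 : s ≠ 0)
    (hs : |s| < c) : (aPlus c u₀ (-s) * APlus c u₀ s)⁻¹ =
      4 * Complex.I * (s : ℂ) * (Real.sqrt (c ^ 2 - s ^ 2) : ℂ)
        * (jostW c u₀ s * jostW c u₀ ((-s : ℝ) : ℂ))⁻¹ := by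
  rw [aPlus_eq hu (neg_ne_zero.2 h0), APlus_eq hc hu hs.ne, lam_of_abs_le hs.le, div_mul_div_comm,
    inv_div, div_eq_mul_inv, mul_comm (jostW c u₀ s)]
  congr 1
  push_cast
  linear_combination (-4 * Complex.I * s * (Real.sqrt (c ^ 2 - s ^ 2) : ℂ)) * Complex.I_sq

lemma RrInner_eq (hc : 0 < c)
    (hu : Integrable (fun x : ℝ => (1 + |x|) ^ (k + 1) * u₀ x) volume) (α β : ℂ) {s : ℝ}
    (h0 : s ≠ 0) (hs : |s| < c) : RrInner c u₀ α β s = innerR c u₀ α β s := by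
  have h1 := ofReal_sqrt_ne_zero hs
  have h2 : (s : ℂ) ≠ 0 := Complex.ofReal_ne_zero.2 h0
  rw [RrInner, div_eq_mul_inv, inv_aPlus_mul_APlus hc hu h0 hs, innerR, ← mul_assoc]
  congr 1
  field_simp

lemma Rr_eq_innerR (hc : 0 < c)
    (hu : Integrable (fun x : ℝ => (1 + |x|) ^ (k + 1) * u₀ x) volume) (hgen : IsGeneric c u₀)
    (α β : ℂ) {s : ℝ} (hs : |s| < c) : Rr c u₀ α β s = innerR c u₀ α β s := by
  rw [Rr, if_neg (not_lt.2 hs.le), if_neg hs.ne]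
  split_ifs with h0
  · subst h0
    refine Tendsto.limUnder_eq ((((continuous_innerR hc hu hgen α β).tendsto 0).mono_left
      nhdsWithin_le_nhds).congr' ?_)
    filter_upwards [self_mem_nhdsWithin, mem_nhdsWithin_of_mem_nhds
      (Metric.ball_mem_nhds (0 : ℝ) hc)] with t ht htc
    rw [mem_ball_zero_iff, Real.norm_eq_abs] at htc
    exact (RrInner_eq hc hu α β ht htc).symm
  · exact RrInner_eq hc hu α β h0 hs

lemma contDiffOn_Rr (hc : 0 < c)
    (hu : Integrable (fun x : ℝ => (1 + |x|) ^ (k + 1) * u₀ x) volume) (hgen : IsGeneric c u₀)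
    (α β : ℂ) : ContDiffOn ℝ k (Rr c u₀ α β) ({c, -c} : Set ℝ)ᶜ := by
  intro s hs
  simp only [Set.mem_compl_iff, Set.mem_insert_iff, Set.mem_singleton_iff, not_or] at hs
  refine ContDiffAt.contDiffWithinAt ?_
  rcases lt_trichotomy |s| c with h | h | h
  · refine (contDiffAt_innerR hc hu hgen α β h).congr_of_eventuallyEq ?_
    filter_upwards [(isOpen_lt continuous_abs continuous_const).mem_nhds h] with t ht
    exact Rr_eq_innerR hc hu hgen α β ht
  · rcases eq_or_eq_neg_of_abs_eq h with h | h
    · exact absurd h hs.1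
    · exact absurd h hs.2
  · refine (contDiffAt_outerR hc hu hgen h).congr_of_eventuallyEq ?_
    filter_upwards [(isOpen_lt continuous_const continuous_abs).mem_nhds h] with t ht
    exact Rr_eq_outerR hc hu hgen α β (le_of_lt ht)

lemma Rr_of_abs_eq (hc : 0 < c)
    (hu : Integrable (fun x : ℝ => (1 + |x|) ^ (k + 1) * u₀ x) volume) (hgen : IsGeneric c u₀)
    (α β : ℂ) {s : ℝ} (hs : |s| = c) : Rr c u₀ α β s = -1 := by
  rw [Rr_eq_outerR hc hu hgen α β hs.ge, outerR_of_abs_eq hc hu hgen hs]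

lemma continuousWithinAt_Rr (hc : 0 < c)
    (hu : Integrable (fun x : ℝ => (1 + |x|) ^ (k + 1) * u₀ x) volume) (hgen : IsGeneric c u₀)
    (α β : ℂ) {s : ℝ} (hs : |s| = c) : ContinuousWithinAt (Rr c u₀ α β) {s | c ≤ |s|} s :=
  ((continuousOn_outerR hc hu hgen) s hs.ge).congr
    (fun _ ht => Rr_eq_outerR hc hu hgen α β ht) (Rr_eq_outerR hc hu hgen α β hs.ge)

lemma innerR_of_abs_eq (α β : ℂ) {s : ℝ} (hs : |s| = c) :
    innerR c u₀ α β s = 4 * Complex.I * (α * (c : ℂ) ^ 2)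
      * (jostW c u₀ c * jostW c u₀ ((-c : ℝ) : ℂ))⁻¹ := by
  have h0 : c ^ 2 - s ^ 2 = 0 := by rw [← sq_abs s, hs, sub_self]
  rw [innerR, h0]
  rcases eq_or_eq_neg_of_abs_eq hs with rfl | rfl
  · simp
  · simp [mul_comm (jostW c u₀ (-c))]

lemma continuousAt_Rr (hc : 0 < c)
    (hu : Integrable (fun x : ℝ => (1 + |x|) ^ (k + 1) * u₀ x) volume) (hgen : IsGeneric c u₀)
    (α β : ℂ) {s : ℝ} (hs : |s| = c) (h : innerR c u₀ α β s = -1) :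
    ContinuousAt (Rr c u₀ α β) s := by
  have hin : ContinuousWithinAt (Rr c u₀ α β) {s | |s| ≤ c} s := by
    refine (continuous_innerR hc hu hgen α β).continuousWithinAt.congr (fun t ht => ?_) ?_
    · rcases (show |t| ≤ c from ht).lt_or_eq with h' | h'
      · exact Rr_eq_innerR hc hu hgen α β h'
      · rw [Rr_of_abs_eq hc hu hgen α β h', innerR_of_abs_eq α β h', ← innerR_of_abs_eq α β hs, h]
    · rw [Rr_of_abs_eq hc hu hgen α β hs, h]
  have hU := hin.union (continuousWithinAt_Rr hc hu hgen α β hs)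
  have : {s : ℝ | |s| ≤ c} ∪ {s : ℝ | c ≤ |s|} = Set.univ :=
    Set.eq_univ_of_forall fun t => le_total |t| c
  rwa [this, continuousWithinAt_univ] at hU

/-- The behaviour of `1 / (a⁺(-s) A⁺(s))` at `-c`, and the matching of the two sides that it
dictates. -/
theorem exists_matching (hc : 0 < c)
    (hu : Integrable (fun x : ℝ => (1 + |x|) ^ (k + 1) * u₀ x) volume) (hgen : IsGeneric c u₀) :
    ∃ κ₁ : ℂ, κ₁ ≠ 0 ∧
      Tendsto (fun s : ℝ => 1 / (aPlus c u₀ (-s) * APlus c u₀ s) / (Real.sqrt (s + c) : ℂ))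
        (𝓝[>] (-c)) (𝓝 κ₁) ∧
      ∀ α β : ℂ, κ₁ * α * (Real.sqrt c : ℂ) / (Real.sqrt 2 : ℂ) = 1 →
        ContinuousAt (Rr c u₀ α β) c ∧ ContinuousAt (Rr c u₀ α β) (-c) := by
  have hWc := jostW_ne_zero hc hu hgen c
  have hWc' := jostW_ne_zero hc hu hgen (-c)
  have hcc : (c : ℂ) ≠ 0 := Complex.ofReal_ne_zero.2 hc.ne'
  have h2c : (Real.sqrt (2 * c) : ℂ) ≠ 0 :=
    Complex.ofReal_ne_zero.2 (Real.sqrt_pos.2 (by linarith)).ne'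
  set f : ℝ → ℂ := fun s => 4 * Complex.I * (s : ℂ) * (Real.sqrt (c - s) : ℂ)
        * (jostW c u₀ s * jostW c u₀ ((-s : ℝ) : ℂ))⁻¹ with hf
  have hfc : Continuous f := by
    have hW := continuous_jostW_ofReal (c := c) hu
    have hW' : Continuous fun s : ℝ => jostW c u₀ ((-s : ℝ) : ℂ) := hW.comp continuous_neg
    have hi := (hW.mul hW').inv₀ fun s =>
      mul_ne_zero (jostW_ne_zero hc hu hgen s) (jostW_ne_zero hc hu hgen (-s))
    exact Continuous.mul (by fun_prop) hi
  have hval : f (-c) = -(4 * Complex.I * (c : ℂ) * (Real.sqrt (2 * c) : ℂ))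
      * (jostW c u₀ c * jostW c u₀ ((-c : ℝ) : ℂ))⁻¹ := by
    rw [hf]
    simp only [neg_neg, sub_neg_eq_add]
    rw [mul_comm (jostW c u₀ ((-c : ℝ) : ℂ)), ← two_mul]
    push_cast
    ring
  refine ⟨f (-c), ?_, ?_, ?_⟩
  · rw [hval]
    refine mul_ne_zero (neg_ne_zero.2 ?_) (inv_ne_zero (mul_ne_zero hWc hWc'))
    exact mul_ne_zero (mul_ne_zero (by simp : 4 * Complex.I ≠ 0) hcc) h2c
  · refine ((hfc.tendsto (-c)).mono_left nhdsWithin_le_nhds).congr' ?_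
    filter_upwards [self_mem_nhdsWithin, mem_nhdsWithin_of_mem_nhds
      (gt_mem_nhds (show -c < 0 by linarith))] with s hs hs0
    have hs' : -c < s := hs
    have habs : |s| < c := abs_lt.2 ⟨hs', by linarith⟩
    have hsq : (Real.sqrt (s + c) : ℂ) ≠ 0 :=
      Complex.ofReal_ne_zero.2 (Real.sqrt_pos.2 (by linarith)).ne'
    have e : Real.sqrt (c ^ 2 - s ^ 2) = Real.sqrt (s + c) * Real.sqrt (c - s) := by
      rw [← Real.sqrt_mul (by linarith)]
      congr 1
      ring
    rw [one_div, inv_aPlus_mul_APlus hc hu hs0.ne habs, e, hf]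
    push_cast
    field_simp
  · intro α β hα
    have h2 : (Real.sqrt 2 : ℂ) ≠ 0 := Complex.ofReal_ne_zero.2 (by positivity)
    have hin : 4 * Complex.I * (α * (c : ℂ) ^ 2)
        * (jostW c u₀ c * jostW c u₀ ((-c : ℝ) : ℂ))⁻¹ = -1 := by
      have e : (Real.sqrt c : ℂ) * Real.sqrt c = c := by
        rw [← Complex.ofReal_mul, Real.mul_self_sqrt hc.le]
      rw [div_eq_one_iff_eq h2, hval, Real.sqrt_mul zero_le_two] at hα
      refine mul_right_cancel₀ h2 ?_
      push_cast at hα ⊢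
      linear_combination -hα - 4 * Complex.I * c * Real.sqrt 2 * α
        * (jostW c u₀ c * jostW c u₀ (-(c : ℂ)))⁻¹ * e
    exact ⟨continuousAt_Rr hc hu hgen α β (abs_of_pos hc)
        ((innerR_of_abs_eq α β (abs_of_pos hc)).trans hin),
      continuousAt_Rr hc hu hgen α β (by rw [abs_neg, abs_of_pos hc])
        ((innerR_of_abs_eq α β (by rw [abs_neg, abs_of_pos hc])).trans hin)⟩

end scattering

end StepKdV

end

theorem theoremt (c : ℝ) (hc : 0 < c) (k : ℕ) (u₀ : ℝ → ℝ)
    (hu : Integrable (fun x : ℝ => (1 + |x|) ^ (k + 1) * u₀ x) volume)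
    (hgen : IsGeneric c u₀) :
    -- matching expansions of `R_l` on the two sides of `-c`
    (∃ a a' : ℕ → ℂ,
      (fun s : ℝ => Rl c u₀ s -
          ∑ j ∈ Finset.range (k + 1), a j * (Real.sqrt (-s - c) : ℂ) ^ j)
        =o[𝓝[<] (-c)] (fun s : ℝ => |s + c| ^ ((k : ℝ) / 2)) ∧
      (fun s : ℝ => Rl c u₀ s -
          ∑ j ∈ Finset.range (k + 1), a' j * (-Complex.I * (Real.sqrt (s + c) : ℂ)) ^ j)
        =o[𝓝[>] (-c)] (fun s : ℝ => |s + c| ^ ((k : ℝ) / 2)) ∧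
      ∀ j ≤ k, a j = a' j) ∧
    -- matching expansions of `R_l` on the two sides of `c`
    (∃ d d' : ℕ → ℂ,
      (fun s : ℝ => Rl c u₀ s -
          ∑ j ∈ Finset.range (k + 1), d j * (Real.sqrt (s - c) : ℂ) ^ j)
        =o[𝓝[>] c] (fun s : ℝ => |s - c| ^ ((k : ℝ) / 2)) ∧
      (fun s : ℝ => Rl c u₀ s -
          ∑ j ∈ Finset.range (k + 1), d' j * (Complex.I * (Real.sqrt (c - s) : ℂ)) ^ j)
        =o[𝓝[<] c] (fun s : ℝ => |s - c| ^ ((k : ℝ) / 2)) ∧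
      ∀ j ≤ k, d j = d' j) ∧
    -- smoothness of `R_l` off `± c`, and its value at `0`
    ContDiffOn ℝ (k : WithTop ℕ∞) (Rl c u₀) ({c, -c} : Set ℝ)ᶜ ∧
    Rl c u₀ 0 = -1 ∧
    -- smoothness of `R_r` off `± c`, and its values at `± c`
    (∀ α β : ℂ,
      ContDiffOn ℝ (k : WithTop ℕ∞) (Rr c u₀ α β) ({c, -c} : Set ℝ)ᶜ ∧
      Rr c u₀ α β c = -1 ∧ Rr c u₀ α β (-c) = -1 ∧
      ContinuousWithinAt (Rr c u₀ α β) {s : ℝ | c ≤ |s|} c ∧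
      ContinuousWithinAt (Rr c u₀ α β) {s : ℝ | c ≤ |s|} (-c)) ∧
    -- for the constant `α` that is matched at `-c`, `R_r` is continuous at `± c` from both sides
    (∃ κ₁ : ℂ, κ₁ ≠ 0 ∧
      Tendsto (fun s : ℝ => 1 / (aPlus c u₀ (-s) * APlus c u₀ s) / (Real.sqrt (s + c) : ℂ))
        (𝓝[>] (-c)) (𝓝 κ₁) ∧
      ∀ α β : ℂ, κ₁ * α * (Real.sqrt c : ℂ) / (Real.sqrt 2 : ℂ) = 1 →
        ContinuousAt (Rr c u₀ α β) c ∧ ContinuousAt (Rr c u₀ α β) (-c)) := by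
  obtain ⟨a, ha, ha'⟩ := exists_expansion_Rl_neg hc hu hgen
  obtain ⟨d, hd, hd'⟩ := exists_expansion_Rl hc hu hgen
  have hc1 : |c| = c := abs_of_pos hc
  have hc2 : |-c| = c := by rw [abs_neg, hc1]
  exact ⟨⟨a, a, ha, ha', fun _ _ => rfl⟩, ⟨d, d, hd, hd', fun _ _ => rfl⟩,
    contDiffOn_Rl hc hu hgen, Rl_zero hc hu hgen,
    fun α β => ⟨contDiffOn_Rr hc hu hgen α β, Rr_of_abs_eq hc hu hgen α β hc1,
      Rr_of_abs_eq hc hu hgen α β hc2, continuousWithinAt_Rr hc hu hgen α β hc1,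
      continuousWithinAt_Rr hc hu hgen α β hc2⟩,
    exists_matching hc hu hgen⟩
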